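/- Let $n,m\ge 0$ be integers and $0\le d\le n$. For integers $k,l$ let $\mathcal P_{k,l}=\mathrm{span}\{z^sw^t: 0\le s\le k,\ 0\le t\le l\}\subset\mathbb C[z,w]$ (so $\mathcal P_{k,l}=\{0\}$ if $k<0$ or $l<0$) and $\mathcal L_{n,m}=\mathrm{span}\{z^sw^t: |s|\le n,\ |t|\le m\}$. For a polynomial $g$ let $\bar g(z,w)=\overline{g(\bar z,\bar w)}$. Let $\mathcal T:\mathcal L_{n,m}\to\mathbb C$ be a positive linear form, i.e. $\mathcal T\big(f(z,w)\bar f(1/z,1/w)\big)>0$ for every nonzero $f\in\mathcal P_{n,m}$, and equip $\mathcal P_{n,m}$ with the inner product $\langle f,g\rangle=\mathcal T\big(f(z,w)\bar g(1/z,1/w)\big)$. Orthogonality, orthogonal complements ($\ominus$), orthogonal direct sums ($\oplus$), orthogonal projections $P_{\mathcal S}$ onto subspaces $\mathcal S$, and adjoints ($^*$) refer to this inner product. For $k\le n$, $l\le m$ put $$\mathcal E^1_{k,l}=\mathcal P_{k,l}\ominus w\mathcal P_{k,l-1},\qquad \mathcal E^2_{k,l}=\mathcal P_{k,l}\ominus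 z\mathcal P_{k-1,l},\qquad \mathcal F^2_{k,l}=\mathcal P_{k,l}\ominus \mathcal P_{k-1,l}.$$ Let $M_z$ be multiplication by $z$ and define $$A=P_{w\mathcal E^2_{n,m-1}}M_z:\mathcal E^1_{n-1,m}\to w\mathcal E^2_{n,m-1},\quad B=P_{\mathcal E^1_{n-1,m}}:w\mathcal F^2_{n,m-1}\to\mathcal E^1_{n-1,m},\quad T=P_{\mathcal E^1_{n-1,m}}M_z:\mathcal E^1_{n-1,m}\to\mathcal E^1_{n-1,m},$$ $$\mathcal A=\mathrm{span}\{(T^*)^jA^*f: f\in w\mathcal E^2_{n,m-1},\ j\ge 0\},\qquad \mathcal B=\mathrm{span}\{T^jBf: f\in w\mathcal F^2_{n,m-1},\ j\ge 0\}.$$ Write $\mathbb D=\{z\in\mathbb C:|z|<1\}$, $\mathbb T=\partial\mathbb D$. Then the following are equivalent. 1. (Bernstein–Szegő condition) There is $p\in\mathbb C[z,w]$ of degree at most $n$ in $z$ and at most $m$ in $w$, with no zeros on $\mathbb T\times\overline{\mathbb D}$, such that $p(z,0)$ has exactly $d$ zeros in $\mathbb D$, counted with multiplicity, and $$\mathcal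 T(z^jw^k)=\int_{\mathbb T^2}z^jw^k\,\frac{|dz|\,|dw|}{(2\pi)^2|p(z,w)|^2}\qquad\text{for all } |j|\le n,\ |k|\le m.$$ 2. (Split-shift condition) There are subspaces $\mathcal K_1,\mathcal K_2\subset\mathcal P_{n,m}$ such that $\mathcal E^1_{n-1,m}=\mathcal K_1\oplus\mathcal K_2$, $\mathcal K_1\perp z\mathcal K_2$, $\mathcal K_1\subset\mathcal E^1_{n,m}$, $z\mathcal K_2\subset\mathcal E^1_{n,m}$, and $\dim\mathcal K_1=d$. 3. (Matrix condition) The smallest $T$-invariant subspace of $\mathcal E^1_{n-1,m}$ containing the range of $B$ is contained in the kernel of $A$, and $$\dim\mathcal A\le d\le n-\dim\mathcal B.$$ -/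

import Mathlib

namespace BernsteinSzego

noncomputable section

/-- Polynomials in two complex variables; `X 0` is `z` and `X 1` is `w`. -/
abbrev Poly2 : Type := MvPolynomial (Fin 2) ℂ

/-- Laurent polynomials in two complex variables; `mono j k` below is `z ^ j * w ^ k`. -/
abbrev Laurent2 : Type := AddMonoidAlgebra ℂ (ℤ × ℤ)

/-- The Laurent monomial `z ^ j * w ^ k`. -/
def mono (j k : ℤ) : Laurent2 := AddMonoidAlgebra.single (j, k) 1

/-- Laurent polynomials spanned by `z ^ j * w ^ k` with `|j| ≤ n`, `|k| ≤ m`. -/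
def laurentSpace (n m : ℕ) : Submodule ℂ Laurent2 :=
  Submodule.span ℂ {x | ∃ j k : ℤ, |j| ≤ n ∧ |k| ≤ m ∧ x = mono j k}

/-- Polynomials spanned by `z ^ s * w ^ t` with `0 ≤ s ≤ k`, `0 ≤ t ≤ l`.
It is `⊥` when `k` or `l` is negative. -/
def polySpace (k l : ℤ) : Submodule ℂ Poly2 :=
  Submodule.span ℂ {x | ∃ s t : ℕ, (s : ℤ) ≤ k ∧ (t : ℤ) ≤ l ∧
    x = MvPolynomial.X 0 ^ s * MvPolynomial.X 1 ^ t}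

/-- `f(z, w)` as a Laurent polynomial. -/
def toLaurent : Poly2 →ₐ[ℂ] Laurent2 := MvPolynomial.aeval ![mono 1 0, mono 0 1]

/-- The Laurent polynomial `f̄(1/z, 1/w)`, where `f̄` has the conjugate coefficients of `f`. -/
def conjInv (f : Poly2) : Laurent2 :=
  MvPolynomial.aeval ![mono (-1) 0, mono 0 (-1)] (MvPolynomial.map (starRingEnd ℂ) f)

theorem mono_mul (a b c d : ℤ) : mono a b * mono c d = mono (a + c) (b + d) := by
  simp [mono, AddMonoidAlgebra.single_mul_single]

theorem mono_pow (a b : ℤ) (s : ℕ) : mono a b ^ s = mono (s * a) (s * b) := by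
  simp [mono, AddMonoidAlgebra.single_pow]

theorem conjInv_add (f g : Poly2) : conjInv (f + g) = conjInv f + conjInv g := by
  simp [conjInv]

theorem conjInv_zero : conjInv 0 = 0 := by simp [conjInv]

theorem conjInv_smul (c : ℂ) (f : Poly2) :
    conjInv (c • f) = (starRingEnd ℂ) c • conjInv f := by
  simp [conjInv, Algebra.smul_def]

theorem toLaurent_monomial (s t : ℕ) :
    toLaurent (MvPolynomial.X 0 ^ s * MvPolynomial.X 1 ^ t) = mono s t := by
  simp [toLaurent, mono_pow, mono_mul]

theorem conjInv_monomial (s t : ℕ) :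
    conjInv (MvPolynomial.X 0 ^ s * MvPolynomial.X 1 ^ t) = mono (-s) (-t) := by
  simp [conjInv, mono_pow, mono_mul]

theorem mono_mem (n m : ℕ) (j k : ℤ) (hj : |j| ≤ n) (hk : |k| ≤ m) :
    mono j k ∈ laurentSpace n m :=
  Submodule.subset_span ⟨j, k, hj, hk, rfl⟩

theorem mul_conjInv_mem (n m : ℕ) {f g : Poly2} (hf : f ∈ polySpace n m)
    (hg : g ∈ polySpace n m) : toLaurent f * conjInv g ∈ laurentSpace n m := by
  induction hf using Submodule.span_induction with
  | zero => simp
  | add x y _ _ hx hy => simpa [add_mul] using Submodule.add_mem _ hx hy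
  | smul c x _ hx => simpa using Submodule.smul_mem _ c hx
  | mem x hx =>
    obtain ⟨s, t, hs, ht, rfl⟩ := hx
    induction hg using Submodule.span_induction with
    | zero => simp [conjInv_zero]
    | add x y _ _ hx hy => simpa [mul_add, conjInv_add] using Submodule.add_mem _ hx hy
    | smul c x _ hx => simpa [conjInv_smul] using Submodule.smul_mem _ _ hx
    | mem x hx =>
      obtain ⟨s', t', hs', ht', rfl⟩ := hx
      rw [toLaurent_monomial, conjInv_monomial, mono_mul]
      refine mono_mem n m _ _ ?_ ?_ <;> rw [abs_le] <;> constructor <;> omega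

/-- `f(z, w) ḡ(1/z, 1/w)` as an element of the space on which linear forms act. -/
def sesq {n m : ℕ} (f g : polySpace n m) : laurentSpace n m :=
  ⟨toLaurent f * conjInv g, mul_conjInv_mem n m f.2 g.2⟩

theorem sesq_add_left {n m : ℕ} (f g h : polySpace n m) :
    sesq (f + g) h = sesq f h + sesq g h := by
  ext1; simp [sesq, add_mul]

theorem sesq_add_right {n m : ℕ} (f g h : polySpace n m) :
    sesq f (g + h) = sesq f g + sesq f h := by
  ext1; simp [sesq, mul_add, conjInv_add]

theorem sesq_smul_left {n m : ℕ} (c : ℂ) (f g : polySpace n m) :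
    sesq (c • f) g = c • sesq f g := by
  ext1; simp [sesq]

theorem sesq_smul_right {n m : ℕ} (c : ℂ) (f g : polySpace n m) :
    sesq f (c • g) = (starRingEnd ℂ) c • sesq f g := by
  ext1; simp [sesq, conjInv_smul]

/-- A positive linear form on `laurentSpace n m`: for every nonzero `f` of degree at most `(n, m)`
the value at `f(z, w) f̄(1/z, 1/w)` is a (real and) positive number. -/
structure PositiveForm (n m : ℕ) where
  form : laurentSpace n m →ₗ[ℂ] ℂ
  pos : ∀ f : polySpace n m, f ≠ 0 → (form (sesq f f)).im = 0 ∧ 0 < (form (sesq f f)).re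

namespace PositiveForm

variable {n m : ℕ} (τ : PositiveForm n m)

/-- The moment `τ(z ^ j * w ^ k)`. -/
def moment (j k : ℤ) (hj : |j| ≤ n) (hk : |k| ≤ m) : ℂ :=
  τ.form ⟨mono j k, mono_mem n m j k hj hk⟩

theorem im_self (f : polySpace n m) : (τ.form (sesq f f)).im = 0 := by
  by_cases h : f = 0
  · subst h
    have : sesq (0 : polySpace n m) 0 = 0 := by ext1; simp [sesq]
    simp [this]
  · exact (τ.pos f h).1

theorem conj_form (f g : polySpace n m) :
    (starRingEnd ℂ) (τ.form (sesq f g)) = τ.form (sesq g f) := by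
  have h1 := τ.im_self (f + g)
  have h2 := τ.im_self (f + Complex.I • g)
  have hf := τ.im_self f
  have hg := τ.im_self g
  simp only [sesq_add_left, sesq_add_right, sesq_smul_left, sesq_smul_right, map_add, map_smul,
    smul_eq_mul, Complex.conj_I, Complex.add_im, Complex.add_re, Complex.mul_im, Complex.mul_re,
    Complex.neg_re, Complex.neg_im, Complex.I_re, Complex.I_im, hf, hg] at h1 h2
  apply Complex.ext
  · simp only [Complex.conj_re]; linarith
  · simp only [Complex.conj_im]; linarith

/-- The space of polynomials of degree at most `(n, m)`, as a type that carries the inner product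
given by `τ`. -/
def H (_τ : PositiveForm n m) : Type := polySpace n m

instance : AddCommGroup τ.H := inferInstanceAs (AddCommGroup (polySpace n m))
instance : Module ℂ τ.H := inferInstanceAs (Module ℂ (polySpace n m))

/-- The elements of `τ.H` are the polynomials of degree at most `(n, m)`. -/
def equivPoly : τ.H ≃ₗ[ℂ] polySpace n m := LinearEquiv.refl ℂ (polySpace n m)

/-- The inclusion of `τ.H` into the polynomials. -/
def incl : τ.H →ₗ[ℂ] Poly2 := (polySpace n m).subtype ∘ₗ τ.equivPoly.toLinearMap

/-- The inner product `⟨f, g⟩ = τ(f(z, w) ḡ(1/z, 1/w))`, linear in `f`; with Mathlib's convention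
(linearity in the second argument) this is `inner ℂ g f`. -/
@[reducible]
def core : InnerProductSpace.Core ℂ τ.H where
  inner g f := τ.form (sesq (τ.equivPoly f) (τ.equivPoly g))
  conj_inner_symm f g := τ.conj_form _ _
  re_inner_nonneg f := by
    by_cases h : f = 0
    · subst h
      have : sesq (0 : polySpace n m) 0 = 0 := by ext1; simp [sesq]
      simp [this]
    · exact (τ.pos (τ.equivPoly f) (by simpa using h)).2.le
  add_left f g h := by simp [sesq_add_right]
  smul_left f g c := by simp [sesq_smul_right]
  definite f hf := by
    by_contra h
    have := (τ.pos (τ.equivPoly f) (by simpa using h)).2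
    change τ.form (sesq (τ.equivPoly f) (τ.equivPoly f)) = 0 at hf
    rw [hf] at this
    simp at this

instance : NormedAddCommGroup τ.H := τ.core.toNormedAddCommGroup
instance : InnerProductSpace ℂ τ.H := InnerProductSpace.ofCore τ.core.toCore

theorem inner_eq (f g : τ.H) :
    inner ℂ g f = τ.form (sesq (τ.equivPoly f) (τ.equivPoly g)) := rfl

theorem finite_polySpace (k l : ℤ) : Module.Finite ℂ (polySpace k l) := by
  refine Module.Finite.span_of_finite ℂ (Set.Finite.subset
    (((Set.finite_Iic k.toNat).prod (Set.finite_Iic l.toNat)).image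
      (fun q : ℕ × ℕ => (MvPolynomial.X 0 ^ q.1 * MvPolynomial.X 1 ^ q.2 : Poly2))) ?_)
  rintro x ⟨s, t, hs, ht, rfl⟩
  exact ⟨(s, t), ⟨by simp only [Set.mem_Iic]; omega, by simp only [Set.mem_Iic]; omega⟩, rfl⟩

instance : FiniteDimensional ℂ τ.H :=
  haveI := finite_polySpace (n : ℤ) (m : ℤ)
  Module.Finite.equiv τ.equivPoly.symm

/-- Polynomials of degree at most `(k, l)` inside `τ.H` (for `k ≤ n`, `l ≤ m`). -/
def poly (k l : ℤ) : Submodule ℂ τ.H := (polySpace k l).comap τ.incl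

/-- `q • S = {q f : f ∈ S}` as a subspace of `τ.H`. It is used only for `q = z` and
`S ⊆ τ.poly (n - 1) m` and for `q = w` and `S ⊆ τ.poly n (m - 1)`, where all products `q f`
do lie in `τ.H`. -/
def mulBy (q : Poly2) (S : Submodule ℂ τ.H) : Submodule ℂ τ.H :=
  ((S.map τ.incl).map (LinearMap.mulLeft ℂ q)).comap τ.incl

/-- `z S`. -/
def zMul (S : Submodule ℂ τ.H) : Submodule ℂ τ.H := τ.mulBy (MvPolynomial.X 0) S

/-- `w S`. -/
def wMul (S : Submodule ℂ τ.H) : Submodule ℂ τ.H := τ.mulBy (MvPolynomial.X 1) S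

/-- The orthogonal complement of `w P_{k,l-1}` in `P_{k,l}`. -/
def E1 (k l : ℤ) : Submodule ℂ τ.H := τ.poly k l ⊓ (τ.wMul (τ.poly k (l - 1)))ᗮ

/-- The orthogonal complement of `z P_{k-1,l}` in `P_{k,l}`. -/
def E2 (k l : ℤ) : Submodule ℂ τ.H := τ.poly k l ⊓ (τ.zMul (τ.poly (k - 1) l))ᗮ

/-- The orthogonal complement of `P_{k-1,l}` in `P_{k,l}`. -/
def F2 (k l : ℤ) : Submodule ℂ τ.H := τ.poly k l ⊓ (τ.poly (k - 1) l)ᗮ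

/-- `(K₁, K₂)` satisfies the split-shift orthogonality condition for `τ`: the space
`E1 (n - 1) m` is the orthogonal direct sum of `K₁` and `K₂`, `K₁ ⟂ z K₂`, and both `K₁` and
`z K₂` lie in `E1 n m`. -/
def IsShiftSplit (K₁ K₂ : Submodule ℂ τ.H) : Prop :=
  (K₁ ⟂ K₂ ∧ K₁ ⊔ K₂ = τ.E1 (n - 1) m) ∧ K₁ ⟂ τ.zMul K₂ ∧
    K₁ ≤ τ.E1 n m ∧ τ.zMul K₂ ≤ τ.E1 n m

theorem X_mul_mem {f : Poly2} (hf : f ∈ polySpace (n - 1) m) :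
    MvPolynomial.X 0 * f ∈ polySpace n m := by
  induction hf using Submodule.span_induction with
  | zero => simp
  | add x y _ _ hx hy => simpa [mul_add] using Submodule.add_mem _ hx hy
  | smul c x _ hx => simpa using Submodule.smul_mem _ c hx
  | mem x hx =>
    obtain ⟨s, t, hs, ht, rfl⟩ := hx
    exact Submodule.subset_span ⟨s + 1, t, by push_cast; omega, ht, by ring⟩

/-- Multiplication by `z`, restricted to `E1 (n - 1) m`. -/
def Mz : τ.E1 (n - 1) m →ₗ[ℂ] τ.H :=
  τ.equivPoly.symm.toLinearMap ∘ₗ LinearMap.codRestrict (polySpace n m)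
    (LinearMap.mulLeft ℂ (MvPolynomial.X 0) ∘ₗ τ.incl ∘ₗ (τ.E1 (n - 1) m).subtype)
    (fun f => X_mul_mem f.2.1)

theorem incl_Mz (f : τ.E1 (n - 1) m) :
    τ.incl (τ.Mz f) = MvPolynomial.X 0 * τ.incl f := rfl

/-- `A f`, for `f` in `E1 (n - 1) m`, is the projection of `z f` onto `w E2 n (m - 1)`. -/
def opA : τ.E1 (n - 1) m →ₗ[ℂ] τ.wMul (τ.E2 n (m - 1)) :=
  (τ.wMul (τ.E2 n (m - 1))).orthogonalProjectionOnto.toLinearMap ∘ₗ τ.Mz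

/-- `B f`, for `f` in `w F2 n (m - 1)`, is the projection of `f` onto `E1 (n - 1) m`. -/
def opB : τ.wMul (τ.F2 n (m - 1)) →ₗ[ℂ] τ.E1 (n - 1) m :=
  (τ.E1 (n - 1) m).orthogonalProjectionOnto.toLinearMap ∘ₗ (τ.wMul (τ.F2 n (m - 1))).subtype

/-- `T f`, for `f` in `E1 (n - 1) m`, is the projection of `z f` onto `E1 (n - 1) m`. -/
def opT : τ.E1 (n - 1) m →ₗ[ℂ] τ.E1 (n - 1) m :=
  (τ.E1 (n - 1) m).orthogonalProjectionOnto.toLinearMap ∘ₗ τ.Mz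

/-- The span of all `(T*)^j A* f`. -/
def spaceA : Submodule ℂ (τ.E1 (n - 1) m) :=
  Submodule.span ℂ {x | ∃ (j : ℕ) (f : τ.wMul (τ.E2 n (m - 1))),
    x = (LinearMap.adjoint τ.opT ^ j) (LinearMap.adjoint τ.opA f)}

/-- The span of all `T^j B f`. -/
def spaceB : Submodule ℂ (τ.E1 (n - 1) m) :=
  Submodule.span ℂ {x | ∃ (j : ℕ) (f : τ.wMul (τ.F2 n (m - 1))), x = (τ.opT ^ j) (τ.opB f)}

/-- The matrix condition: the smallest `T`-invariant subspace containing the range of `B` is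
contained in the kernel of `A`. -/
def MatrixCondition : Prop :=
  sInf {U : Submodule ℂ (τ.E1 (n - 1) m) |
    LinearMap.range τ.opB ≤ U ∧ U ∈ Module.End.invtSubmodule τ.opT} ≤ LinearMap.ker τ.opA

/-- `τ(z^j w^k)` is, for `|j| ≤ n` and `|k| ≤ m`, the `(j, k)` moment of the measure on the
two-torus with density `1 / |p|²` with respect to normalized Lebesgue measure. -/
def HasBernsteinSzegoMoments (p : Poly2) : Prop :=
  ∀ (j k : ℤ) (hj : |j| ≤ n) (hk : |k| ≤ m), τ.moment j k hj hk =
    1 / (2 * (Real.pi : ℂ)) ^ 2 *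
      ∫ θ in (0 : ℝ)..(2 * Real.pi), ∫ φ in (0 : ℝ)..(2 * Real.pi),
        Complex.exp (θ * Complex.I) ^ j * Complex.exp (φ * Complex.I) ^ k /
          ((‖MvPolynomial.eval ![Complex.exp (θ * Complex.I), Complex.exp (φ * Complex.I)] p‖ ^ 2
            : ℝ) : ℂ)

end PositiveForm

/-- `p` has no zeros on (unit circle) × (closed unit disk). -/
def NoZerosOnFace (p : Poly2) : Prop :=
  ∀ z w : ℂ, ‖z‖ = 1 → ‖w‖ ≤ 1 → MvPolynomial.eval ![z, w] p ≠ 0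

/-- The one-variable polynomial `p(z, 0)`. -/
def atWZero (p : Poly2) : Polynomial ℂ := MvPolynomial.aeval ![Polynomial.X, 0] p

open Classical in
/-- The number of zeros of `q` in the open unit disk, counted with multiplicity. -/
def zerosInDisk (q : Polynomial ℂ) : ℕ := q.roots.countP (fun z => ‖z‖ < 1)

end

end BernsteinSzego

namespace BernsteinSzego

noncomputable section

open scoped Polynomial

/-! ### Polynomials in two variables -/

/-! The matrix condition is the split-shift condition read off from `K₂`. Regard `K₂` as a subspace
`U` of `E1 (n - 1) m`. Then `K₁ ⟂ z K₂` says that `U` is `T`-invariant, `K₁ ≤ E1 n m` that `U`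
contains the range of `B`, and `z K₂ ≤ E1 n m` that `U` lies in the kernel of `A`
(`exists_shiftSplit_iff`). The least invariant subspace containing the range of `B` is `spaceB`, the
largest one inside the kernel of `A` is `spaceAᗮ`, and over ℂ invariant subspaces of every
intermediate dimension lie between two nested ones (`exists_invtSubmodule_finrank_eq`).

From a split to a polynomial: `K₁ ⊕ z K₂` has codimension one in `E1 n m`, and `p` is a unit vector
of the complement. Comparing reproducing kernels on `|z| = 1` and using their symmetry under
reversal gives a Christoffel-Darboux formula for the kernel of `E2 n m`
(`split_christoffel_darboux`). It makes `p(z, ·)` zero-free on the closed disk, and it shows that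
for each unimodular `z` the slice map from `E2 n m` to `L²(1 / |p(z, ·)|²)` is isometric
(`split_ip_E2`). Since the slices of a basis of `E2 n m` stay independent for all `|z| ≤ 1`
(`E2_eq_zero`), the mean value property shows that `E2 n m` is orthogonal to multiples of `z` for
the measure as well (`split_bs_X0_mul`). Reversal carries this over to `F2 n m`, and together they
show that the kernel of the whole space reproduces for both inner products (`split_bs_rep`). At `w =
0` the kernel identities bound `K₂` inside the disk and `K₁` outside of it by `|p(z, 0)|²`. So `K₂`
inherits the inner zeros of `p(z, 0)` and `K₁` the outer ones; the resulting bounds on the two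
dimensions add up to `n` and must be sharp (`split_zerosInDisk`).

From a polynomial to a split: factor `p(z, 0)` into an inner part (zeros in the disk) and an outer
part, and let `K₁`, `K₂` consist of the `f` in `E1 (n - 1) m` for which `f(z, 0)` is a multiple of
the outer, respectively the inner part. Then `f(z, 0) / p(z, 0)` has only negative frequencies for
`K₁` and only nonnegative ones for `K₂`. The remaining data of `f` are the slice inner products
`u_k(z)` with `w ^ (k + 1)`. They satisfy a block Toeplitz equation whose symbol is the inverse Gram
matrix of the slice; by the Gohberg-Semencul formula it is a trigonometric polynomial of degree at
most `n`. Membership in `E1 (n - 1) m` makes `n` consecutive Fourier coefficients of `u_k` vanish,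
which decouples the two half lines, and injectivity of Toeplitz operators with positive symbol
(`toeplitz_injective`) kills the half line that has no source term. All requirements on a split are
then statements about separated spectra (`bs_eq_zero`). -/

theorem polySpace_mono {k k' l l' : ℤ} (hk : k ≤ k') (hl : l ≤ l') :
    polySpace k l ≤ polySpace k' l' := by
  refine Submodule.span_mono ?_
  rintro x ⟨s, t, hs, ht, rfl⟩
  exact ⟨s, t, hs.trans hk, ht.trans hl, rfl⟩

theorem monomial_mem_polySpace {k l : ℤ} {s t : ℕ} (hs : (s : ℤ) ≤ k) (ht : (t : ℤ) ≤ l) :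
    (MvPolynomial.X 0 ^ s * MvPolynomial.X 1 ^ t : Poly2) ∈ polySpace k l :=
  Submodule.subset_span ⟨s, t, hs, ht, rfl⟩

theorem mem_polySpace_of_degreeOf {n m : ℕ} {p : Poly2} (h0 : p.degreeOf 0 ≤ n)
    (h1 : p.degreeOf 1 ≤ m) : p ∈ polySpace n m := by
  rw [← p.support_sum_monomial_coeff]
  refine Submodule.sum_mem _ fun e he => ?_
  have : MvPolynomial.monomial e (p.coeff e) =
      p.coeff e • (MvPolynomial.X 0 ^ e 0 * MvPolynomial.X 1 ^ e 1 : Poly2) := by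
    rw [MvPolynomial.monomial_eq, Finsupp.prod_fintype _ _ (by simp), Fin.prod_univ_two,
      MvPolynomial.smul_eq_C_mul]
  rw [this]
  refine Submodule.smul_mem _ _ (monomial_mem_polySpace ?_ ?_)
  · exact_mod_cast (MvPolynomial.degreeOf_le_iff.1 h0 e he)
  · exact_mod_cast (MvPolynomial.degreeOf_le_iff.1 h1 e he)

theorem degreeOf_le_of_mem_polySpace {n m : ℕ} {p : Poly2} (hp : p ∈ polySpace n m) :
    p.degreeOf 0 ≤ n ∧ p.degreeOf 1 ≤ m := by
  induction hp using Submodule.span_induction with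
  | zero => simp
  | add x y _ _ hx hy =>
    exact ⟨(MvPolynomial.degreeOf_add_le _ _ _).trans (max_le hx.1 hy.1),
      (MvPolynomial.degreeOf_add_le _ _ _).trans (max_le hx.2 hy.2)⟩
  | smul c x _ hx =>
    rw [MvPolynomial.smul_eq_C_mul]
    exact ⟨(MvPolynomial.degreeOf_C_mul_le _ _ _).trans hx.1,
      (MvPolynomial.degreeOf_C_mul_le _ _ _).trans hx.2⟩
  | mem x hx =>
    obtain ⟨s, t, hs, ht, rfl⟩ := hx
    constructor
    · refine (MvPolynomial.degreeOf_mul_le _ _ _).trans ((add_le_add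
        (MvPolynomial.degreeOf_pow_le _ _ _) (MvPolynomial.degreeOf_pow_le _ _ _)).trans ?_)
      simp [MvPolynomial.degreeOf_X]; omega
    · refine (MvPolynomial.degreeOf_mul_le _ _ _).trans ((add_le_add
        (MvPolynomial.degreeOf_pow_le _ _ _) (MvPolynomial.degreeOf_pow_le _ _ _)).trans ?_)
      simp [MvPolynomial.degreeOf_X]; omega

/-- `f(z, w)` as a polynomial in `w` whose coefficients are polynomials in `z`. -/
def bi : Poly2 →ₐ[ℂ] ℂ[X][X] := MvPolynomial.aeval ![Polynomial.C Polynomial.X, Polynomial.X]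

/-- The polynomial `f(z, ·)`. -/
def slice (z : ℂ) (f : Poly2) : ℂ[X] := (bi f).map (Polynomial.evalRingHom z)

@[simp] theorem slice_X0 (z : ℂ) : slice z (MvPolynomial.X 0) = Polynomial.C z := by
  simp [slice, bi]

@[simp] theorem slice_X1 (z : ℂ) : slice z (MvPolynomial.X 1) = Polynomial.X := by
  simp [slice, bi]

@[simp] theorem slice_C (z c : ℂ) : slice z (MvPolynomial.C c) = Polynomial.C c := by
  have : bi (MvPolynomial.C c) = algebraMap ℂ _ c := bi.commutes c
  rw [slice, this, Polynomial.algebraMap_apply, Polynomial.map_C]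
  simp

@[simp] theorem slice_mul (z : ℂ) (f g : Poly2) : slice z (f * g) = slice z f * slice z g := by
  simp [slice]

@[simp] theorem slice_add (z : ℂ) (f g : Poly2) : slice z (f + g) = slice z f + slice z g := by
  simp [slice]

@[simp] theorem slice_zero (z : ℂ) : slice z 0 = 0 := by simp [slice]

@[simp] theorem slice_pow (z : ℂ) (f : Poly2) (s : ℕ) : slice z (f ^ s) = slice z f ^ s := by
  simp [slice]

@[simp] theorem slice_smul (z c : ℂ) (f : Poly2) : slice z (c • f) = c • slice z f := by
  rw [MvPolynomial.smul_eq_C_mul, slice_mul, slice_C, Polynomial.smul_eq_C_mul]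

theorem coeff_slice (z : ℂ) (f : Poly2) (t : ℕ) :
    (slice z f).coeff t = ((bi f).coeff t).eval z := by
  simp [slice]

theorem eval_slice (z w : ℂ) (f : Poly2) :
    (slice z f).eval w = MvPolynomial.eval ![z, w] f := by
  induction f using MvPolynomial.induction_on with
  | C a => simp
  | add p q hp hq => simp [hp, hq]
  | mul_X p i hp => fin_cases i <;> simp [hp]

theorem coeff_bi_eq_zero {k l : ℤ} {f : Poly2} (hf : f ∈ polySpace k l) {s t : ℕ}
    (h : k < s ∨ l < t) : ((bi f).coeff t).coeff s = 0 := by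
  induction hf using Submodule.span_induction with
  | zero => simp
  | add x y _ _ hx hy => simp [hx, hy]
  | smul c x _ hx => simp [hx]
  | mem x hx =>
    obtain ⟨s', t', hs, ht, rfl⟩ := hx
    have : bi (MvPolynomial.X 0 ^ s' * MvPolynomial.X 1 ^ t') =
        Polynomial.C (Polynomial.X ^ s') * Polynomial.X ^ t' := by simp [bi]
    rw [this, Polynomial.coeff_C_mul, Polynomial.coeff_X_pow]
    split_ifs with h'
    · rw [mul_one, Polynomial.coeff_X_pow, if_neg]
      omega
    · simp

theorem natDegree_coeff_bi_le {n : ℕ} {l : ℤ} {f : Poly2} (hf : f ∈ polySpace n l) (t : ℕ) :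
    ((bi f).coeff t).natDegree ≤ n :=
  Polynomial.natDegree_le_iff_coeff_eq_zero.2 fun s hs =>
    coeff_bi_eq_zero hf (Or.inl (by exact_mod_cast hs))

theorem coeff_bi_eq_zero_of_lt {k l : ℤ} {f : Poly2} (hf : f ∈ polySpace k l) {t : ℕ}
    (h : l < t) : (bi f).coeff t = 0 := by
  ext s
  simpa using coeff_bi_eq_zero hf (Or.inr h)

theorem natDegree_slice_le {k : ℤ} {m : ℕ} {f : Poly2} (hf : f ∈ polySpace k m) (z : ℂ) :
    (slice z f).natDegree ≤ m :=
  Polynomial.natDegree_le_iff_coeff_eq_zero.2 fun t ht => by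
    rw [coeff_slice, coeff_bi_eq_zero_of_lt hf (by exact_mod_cast ht), Polynomial.eval_zero]

theorem slice_mem_degreeLT {k : ℤ} {m : ℕ} {f : Poly2} (hf : f ∈ polySpace k m) (z : ℂ) :
    slice z f ∈ Polynomial.degreeLT ℂ (m + 1) := by
  rw [Polynomial.mem_degreeLT, Polynomial.degree_lt_iff_coeff_zero]
  intro t ht
  rw [coeff_slice, coeff_bi_eq_zero_of_lt hf (by omega), Polynomial.eval_zero]

/-- A polynomial that vanishes on `D × ℂ`, `D` infinite, is zero. -/
theorem eq_zero_of_slice_eq_zero {f : Poly2} {D : Set ℂ} (hD : D.Infinite)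
    (h : ∀ z ∈ D, slice z f = 0) : f = 0 := by
  have hb : bi f = 0 := by
    ext1 t
    rw [Polynomial.coeff_zero]
    refine Polynomial.eq_zero_of_infinite_isRoot _ (hD.mono fun z hz => ?_)
    have := coeff_slice z f t
    rw [h z hz, Polynomial.coeff_zero] at this
    exact this.symm
  refine MvPolynomial.funext fun x => ?_
  have hx : x = ![x 0, x 1] := by ext i; fin_cases i <;> rfl
  rw [hx, ← eval_slice, slice, hb]
  simp

/-- This is division by `X 0 - z` through the geometric sum. What matters are the degrees: the
quotient loses one degree in the first variable and gains none in the second, so its multiples by `X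
0` lie in the space to which `E2` is orthogonal. -/
theorem exists_eq_X0_sub_mul_add (z : ℂ) {k l : ℤ} {f : Poly2} (hf : f ∈ polySpace k l) :
    ∃ g ∈ polySpace (k - 1) l, f = (MvPolynomial.X 0 - MvPolynomial.C z) * g +
      Polynomial.aeval (MvPolynomial.X 1) (slice z f) := by
  induction hf using Submodule.span_induction with
  | zero => exact ⟨0, Submodule.zero_mem _, by simp⟩
  | add x y _ _ hx hy =>
    obtain ⟨g, hg, h⟩ := hx
    obtain ⟨g', hg', h'⟩ := hy
    refine ⟨g + g', Submodule.add_mem _ hg hg', ?_⟩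
    conv_lhs => rw [h, h']
    simp only [slice_add, map_add]
    ring
  | smul c x _ hx =>
    obtain ⟨g, hg, h⟩ := hx
    refine ⟨c • g, Submodule.smul_mem _ c hg, ?_⟩
    conv_lhs => rw [h]
    simp only [slice_smul, map_smul, smul_add, mul_smul_comm]
  | mem x hx =>
    obtain ⟨s, t, hs, ht, rfl⟩ := hx
    refine ⟨(∑ i ∈ Finset.range s, MvPolynomial.X 0 ^ i * MvPolynomial.C z ^ (s - 1 - i)) *
      MvPolynomial.X 1 ^ t, ?_, ?_⟩
    · rw [Finset.sum_mul]
      refine Submodule.sum_mem _ fun i hi => ?_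
      have : (MvPolynomial.X 0 ^ i * MvPolynomial.C z ^ (s - 1 - i) * MvPolynomial.X 1 ^ t : Poly2)
          = z ^ (s - 1 - i) • (MvPolynomial.X 0 ^ i * MvPolynomial.X 1 ^ t) := by
        rw [MvPolynomial.smul_eq_C_mul, map_pow]; ring
      rw [this]
      rw [Finset.mem_range] at hi
      exact Submodule.smul_mem _ _ (monomial_mem_polySpace (by omega) ht)
    · rw [← mul_assoc, mul_comm (MvPolynomial.X 0 - MvPolynomial.C z : Poly2), geom_sum₂_mul]
      have : (Polynomial.aeval (MvPolynomial.X 1 : Poly2))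
          (slice z (MvPolynomial.X 0 ^ s * MvPolynomial.X 1 ^ t)) =
          MvPolynomial.C z ^ s * MvPolynomial.X 1 ^ t := by
        simp [MvPolynomial.algebraMap_eq]
      rw [this]
      ring

theorem atWZero_eval (z : ℂ) (f : Poly2) :
    (atWZero f).eval z = MvPolynomial.eval ![z, 0] f := by
  induction f using MvPolynomial.induction_on with
  | C a => simp [atWZero]
  | add p q hp hq => simpa [atWZero] using congrArg₂ (· + ·) hp hq
  | mul_X p i hp =>
    simp only [atWZero, map_mul, MvPolynomial.aeval_X, MvPolynomial.eval_X,
      Polynomial.eval_mul] at hp ⊢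
    rw [hp]
    fin_cases i <;> simp

theorem atWZero_eq_coeff (f : Poly2) : atWZero f = (bi f).coeff 0 := by
  refine Polynomial.funext fun z => ?_
  rw [atWZero_eval, ← eval_slice, ← coeff_slice, Polynomial.coeff_zero_eq_eval_zero]

theorem exists_eq_X1_mul_add {k l : ℤ} {f : Poly2} (hf : f ∈ polySpace k l) :
    ∃ g ∈ polySpace k (l - 1), f = MvPolynomial.X 1 * g +
      Polynomial.aeval (MvPolynomial.X 0) (atWZero f) := by
  induction hf using Submodule.span_induction with
  | zero => exact ⟨0, Submodule.zero_mem _, by simp [atWZero]⟩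
  | add x y _ _ hx hy =>
    obtain ⟨g, hg, h⟩ := hx
    obtain ⟨g', hg', h'⟩ := hy
    refine ⟨g + g', Submodule.add_mem _ hg hg', ?_⟩
    conv_lhs => rw [h, h']
    simp only [atWZero, map_add]
    ring
  | smul c x _ hx =>
    obtain ⟨g, hg, h⟩ := hx
    refine ⟨c • g, Submodule.smul_mem _ c hg, ?_⟩
    conv_lhs => rw [h]
    simp only [atWZero, map_smul, smul_add, mul_smul_comm]
  | mem x hx =>
    obtain ⟨s, t, hs, ht, rfl⟩ := hx
    rcases Nat.eq_zero_or_pos t with rfl | h0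
    · exact ⟨0, Submodule.zero_mem _, by simp [atWZero]⟩
    · refine ⟨MvPolynomial.X 0 ^ s * MvPolynomial.X 1 ^ (t - 1),
        monomial_mem_polySpace hs (by omega), ?_⟩
      obtain ⟨t, rfl⟩ := Nat.exists_eq_add_of_lt h0
      simp [atWZero]
      ring

theorem X1_mul_mem {k l : ℤ} {f : Poly2} (hf : f ∈ polySpace k (l - 1)) :
    MvPolynomial.X 1 * f ∈ polySpace k l := by
  induction hf using Submodule.span_induction with
  | zero => simp
  | add x y _ _ hx hy => simpa [mul_add] using Submodule.add_mem _ hx hy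
  | smul c x _ hx => simpa using Submodule.smul_mem _ c hx
  | mem x hx =>
    obtain ⟨s, t, hs, ht, rfl⟩ := hx
    exact Submodule.subset_span ⟨s, t + 1, hs, by push_cast; omega, by ring⟩

theorem X0_mul_mem {k l : ℤ} {f : Poly2} (hf : f ∈ polySpace (k - 1) l) :
    MvPolynomial.X 0 * f ∈ polySpace k l := by
  induction hf using Submodule.span_induction with
  | zero => simp
  | add x y _ _ hx hy => simpa [mul_add] using Submodule.add_mem _ hx hy
  | smul c x _ hx => simpa using Submodule.smul_mem _ c hx
  | mem x hx =>
    obtain ⟨s, t, hs, ht, rfl⟩ := hx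
    exact Submodule.subset_span ⟨s + 1, t, by push_cast; omega, ht, by ring⟩

theorem aeval_X0_mem {N : ℕ} {l : ℤ} (hl : 0 ≤ l) {r : ℂ[X]} (hr : r ∈ Polynomial.degreeLT ℂ N) :
    Polynomial.aeval (MvPolynomial.X 0 : Poly2) r ∈ polySpace ((N : ℤ) - 1) l := by
  rw [Polynomial.mem_degreeLT, Polynomial.degree_lt_iff_coeff_zero] at hr
  rw [Polynomial.aeval_eq_sum_range]
  refine Submodule.sum_mem _ fun i _ => ?_
  by_cases hi : i < N
  · have := monomial_mem_polySpace (k := (N : ℤ) - 1) (l := l) (s := i) (t := 0) (by omega) hl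
    rw [pow_zero, mul_one] at this
    exact Submodule.smul_mem _ _ this
  · rw [hr i (by omega), zero_smul]
    exact Submodule.zero_mem _

theorem aeval_X1_mem {N : ℕ} {k : ℤ} (hk : 0 ≤ k) {r : ℂ[X]} (hr : r ∈ Polynomial.degreeLT ℂ N) :
    Polynomial.aeval (MvPolynomial.X 1 : Poly2) r ∈ polySpace k ((N : ℤ) - 1) := by
  rw [Polynomial.mem_degreeLT, Polynomial.degree_lt_iff_coeff_zero] at hr
  rw [Polynomial.aeval_eq_sum_range]
  refine Submodule.sum_mem _ fun i _ => ?_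
  by_cases hi : i < N
  · have := monomial_mem_polySpace (k := k) (l := (N : ℤ) - 1) (s := 0) (t := i) hk (by omega)
    rw [pow_zero, one_mul] at this
    exact Submodule.smul_mem _ _ this
  · rw [hr i (by omega), zero_smul]
    exact Submodule.zero_mem _

theorem atWZero_aeval_X0 (r : ℂ[X]) :
    atWZero (Polynomial.aeval (MvPolynomial.X 0 : Poly2) r) = r := by
  rw [atWZero, ← Polynomial.aeval_algHom_apply]
  simp

theorem slice_aeval_X1 (z : ℂ) (r : ℂ[X]) :
    slice z (Polynomial.aeval (MvPolynomial.X 1 : Poly2) r) = r := by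
  refine Polynomial.funext fun w => ?_
  rw [eval_slice, Polynomial.aeval_eq_sum_range, Polynomial.eval_eq_sum_range]
  simp [MvPolynomial.smul_eval]
end

end BernsteinSzego

/-! ### Reversal and reproducing kernels. -/

namespace BernsteinSzego

noncomputable section

open scoped Polynomial ComplexConjugate InnerProductSpace

theorem toLaurent_X0 : toLaurent (MvPolynomial.X 0) = mono 1 0 := by simp [toLaurent]

theorem toLaurent_X1 : toLaurent (MvPolynomial.X 1) = mono 0 1 := by simp [toLaurent]

theorem conjInv_mul (f g : Poly2) : conjInv (f * g) = conjInv f * conjInv g := by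
  simp [conjInv]

theorem conjInv_X0 : conjInv (MvPolynomial.X 0) = mono (-1) 0 := by simp [conjInv]

theorem conjInv_X1 : conjInv (MvPolynomial.X 1) = mono 0 (-1) := by simp [conjInv]

theorem mono_zero_zero : mono 0 0 = 1 := rfl

theorem toLaurent_mul_conjInv_monomial (s t : ℕ) :
    toLaurent (MvPolynomial.X 0 ^ s * MvPolynomial.X 1 ^ t) *
      conjInv (MvPolynomial.X 0 ^ s * MvPolynomial.X 1 ^ t) = 1 := by
  rw [toLaurent_monomial, conjInv_monomial, mono_mul]
  simp [mono_zero_zero]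

/-! ### The reversal `z ^ n * w ^ m * f̄(1 / z, 1 / w)` -/

/-- The polynomial `z ^ n * w ^ m * f̄(1 / z, 1 / w)`, for `f` of degree at most `(n, m)`. -/
def rev (n m : ℕ) (f : Poly2) : Poly2 :=
  ∑ s ∈ Finset.range (n + 1), ∑ t ∈ Finset.range (m + 1), conj (((bi f).coeff t).coeff s) •
    (MvPolynomial.X 0 ^ (n - s) * MvPolynomial.X 1 ^ (m - t))

theorem rev_add (n m : ℕ) (f g : Poly2) : rev n m (f + g) = rev n m f + rev n m g := by
  simp only [rev, map_add, Polynomial.coeff_add, add_smul, Finset.sum_add_distrib]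

theorem rev_smul (n m : ℕ) (c : ℂ) (f : Poly2) : rev n m (c • f) = conj c • rev n m f := by
  simp only [rev, map_smul, Polynomial.coeff_smul, smul_eq_mul, map_mul, mul_smul,
    Finset.smul_sum]

theorem rev_zero (n m : ℕ) : rev n m 0 = 0 := by simp [rev]

theorem rev_monomial {n m s t : ℕ} (hs : s ≤ n) (ht : t ≤ m) :
    rev n m (MvPolynomial.X 0 ^ s * MvPolynomial.X 1 ^ t) =
      MvPolynomial.X 0 ^ (n - s) * MvPolynomial.X 1 ^ (m - t) := by
  have hb : ∀ s' t', ((bi (MvPolynomial.X 0 ^ s * MvPolynomial.X 1 ^ t)).coeff t').coeff s' =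
      if s' = s then if t' = t then 1 else 0 else 0 := by
    intro s' t'
    have : bi (MvPolynomial.X 0 ^ s * MvPolynomial.X 1 ^ t) =
        Polynomial.C (Polynomial.X ^ s) * Polynomial.X ^ t := by simp [bi]
    rw [this, Polynomial.coeff_C_mul, Polynomial.coeff_X_pow]
    split_ifs <;> simp_all [Polynomial.coeff_X_pow]
  rw [rev, Finset.sum_eq_single_of_mem s (by simp; omega), Finset.sum_eq_single_of_mem t
    (by simp; omega)]
  · rw [hb]; simp
  · intro t' _ h; rw [hb]; simp [h]
  · intro s' _ h
    refine Finset.sum_eq_zero fun t' _ => ?_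
    rw [hb]; simp [h]

variable {n m : ℕ}

theorem toLaurent_rev {f : Poly2} (hf : f ∈ polySpace n m) :
    toLaurent (rev n m f) = mono n m * conjInv f := by
  induction hf using Submodule.span_induction with
  | zero => simp [rev_zero, conjInv_zero]
  | add x y _ _ hx hy => simp [rev_add, conjInv_add, hx, hy, mul_add]
  | smul c x _ hx => simp [rev_smul, conjInv_smul, hx]
  | mem x hx =>
    obtain ⟨s, t, hs, ht, rfl⟩ := hx
    rw [rev_monomial (by exact_mod_cast hs) (by exact_mod_cast ht), toLaurent_monomial,
      conjInv_monomial, mono_mul]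
    congr 1 <;> omega

theorem conjInv_rev {f : Poly2} (hf : f ∈ polySpace n m) :
    conjInv (rev n m f) = mono (-n) (-m) * toLaurent f := by
  induction hf using Submodule.span_induction with
  | zero => simp [rev_zero, conjInv_zero]
  | add x y _ _ hx hy => simp [rev_add, conjInv_add, hx, hy, mul_add]
  | smul c x _ hx => simp [rev_smul, conjInv_smul, hx]
  | mem x hx =>
    obtain ⟨s, t, hs, ht, rfl⟩ := hx
    rw [rev_monomial (by exact_mod_cast hs) (by exact_mod_cast ht), toLaurent_monomial,
      conjInv_monomial, mono_mul]
    congr 1 <;> omega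

theorem rev_rev {f : Poly2} (hf : f ∈ polySpace n m) : rev n m (rev n m f) = f := by
  induction hf using Submodule.span_induction with
  | zero => simp [rev_zero]
  | add x y _ _ hx hy => simp [rev_add, hx, hy]
  | smul c x _ hx => simp [rev_smul, hx]
  | mem x hx =>
    obtain ⟨s, t, hs, ht, rfl⟩ := hx
    have hs' : s ≤ n := by exact_mod_cast hs
    have ht' : t ≤ m := by exact_mod_cast ht
    rw [rev_monomial hs' ht', rev_monomial (by omega) (by omega)]
    congr 2 <;> omega

theorem eval_rev {f : Poly2} (hf : f ∈ polySpace n m) {z w : ℂ} (hz : z ≠ 0) (hw : w ≠ 0) :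
    MvPolynomial.eval ![z, w] (rev n m f) =
      z ^ n * w ^ m * conj (MvPolynomial.eval ![(conj z)⁻¹, (conj w)⁻¹] f) := by
  induction hf using Submodule.span_induction with
  | zero => simp [rev_zero]
  | add x y _ _ hx hy => simp [rev_add, hx, hy, mul_add]
  | smul c x _ hx => simp [rev_smul, MvPolynomial.smul_eval, hx]; ring
  | mem x hx =>
    obtain ⟨s, t, hs, ht, rfl⟩ := hx
    have hs' : s ≤ n := by exact_mod_cast hs
    have ht' : t ≤ m := by exact_mod_cast ht
    rw [rev_monomial hs' ht']
    obtain ⟨s', rfl⟩ := Nat.exists_eq_add_of_le hs'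
    obtain ⟨t', rfl⟩ := Nat.exists_eq_add_of_le ht'
    simp
    field_simp
    ring

/-- Degrees that `f` does not use become monomial factors of its reversal. Together with
`rev_mul_mem` this makes reversal exchange `P_{n-a,m-b}` and `z^a w^b P_{n-a,m-b}`, the source of
the kernel symmetry for the smaller spaces. -/
theorem exists_rev_eq {a b : ℕ} {f : Poly2} (hf : f ∈ polySpace (n - a) (m - b)) :
    ∃ g ∈ polySpace (n - a) (m - b),
      rev n m f = MvPolynomial.X 0 ^ a * MvPolynomial.X 1 ^ b * g := by
  induction hf using Submodule.span_induction with
  | zero => exact ⟨0, Submodule.zero_mem _, by simp [rev_zero]⟩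
  | add x y _ _ hx hy =>
    obtain ⟨g, hg, h⟩ := hx
    obtain ⟨g', hg', h'⟩ := hy
    exact ⟨g + g', Submodule.add_mem _ hg hg', by rw [rev_add, h, h', mul_add]⟩
  | smul c x _ hx =>
    obtain ⟨g, hg, h⟩ := hx
    exact ⟨conj c • g, Submodule.smul_mem _ _ hg, by rw [rev_smul, h, mul_smul_comm]⟩
  | mem x hx =>
    obtain ⟨s, t, hs, ht, rfl⟩ := hx
    refine ⟨MvPolynomial.X 0 ^ (n - a - s) * MvPolynomial.X 1 ^ (m - b - t),
      monomial_mem_polySpace (by omega) (by omega), ?_⟩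
    rw [rev_monomial (by omega) (by omega), show n - s = a + (n - a - s) by omega,
      show m - t = b + (m - b - t) by omega]
    ring

theorem rev_mul_mem {a b : ℕ} {f : Poly2} (hf : f ∈ polySpace (n - a) (m - b)) :
    rev n m (MvPolynomial.X 0 ^ a * MvPolynomial.X 1 ^ b * f) ∈ polySpace (n - a) (m - b) := by
  induction hf using Submodule.span_induction with
  | zero => simp [rev_zero]
  | add x y _ _ hx hy => simpa [mul_add, rev_add] using Submodule.add_mem _ hx hy
  | smul c x _ hx => simpa [rev_smul] using Submodule.smul_mem _ (conj c) hx
  | mem x hx =>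
    obtain ⟨s, t, hs, ht, rfl⟩ := hx
    have : (MvPolynomial.X 0 ^ a * MvPolynomial.X 1 ^ b *
        (MvPolynomial.X 0 ^ s * MvPolynomial.X 1 ^ t) : Poly2) =
        MvPolynomial.X 0 ^ (a + s) * MvPolynomial.X 1 ^ (b + t) := by ring
    rw [this, rev_monomial (by omega) (by omega)]
    exact monomial_mem_polySpace (by omega) (by omega)

theorem monomial_mul_mem {a b : ℕ} {f : Poly2} (hf : f ∈ polySpace (n - a) (m - b)) :
    MvPolynomial.X 0 ^ a * MvPolynomial.X 1 ^ b * f ∈ polySpace n m := by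
  induction hf using Submodule.span_induction with
  | zero => simp
  | add x y _ _ hx hy => simpa [mul_add] using Submodule.add_mem _ hx hy
  | smul c x _ hx => simpa using Submodule.smul_mem _ c hx
  | mem x hx =>
    obtain ⟨s, t, hs, ht, rfl⟩ := hx
    exact Submodule.subset_span ⟨a + s, b + t, by push_cast; omega, by push_cast; omega, by ring⟩

theorem rev_mem {f : Poly2} (hf : f ∈ polySpace n m) : rev n m f ∈ polySpace n m := by
  have := rev_mul_mem (n := n) (m := m) (a := 0) (b := 0) (f := f) (by simpa using hf)
  simpa using this

/-! ### The Hilbert space of polynomials -/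

namespace PositiveForm

variable (τ : PositiveForm n m)

theorem incl_injective : Function.Injective τ.incl :=
  (Submodule.injective_subtype _).comp τ.equivPoly.injective

theorem incl_mem (f : τ.H) : τ.incl f ∈ polySpace n m := (τ.equivPoly f).2

/-- A polynomial of degree at most `(n, m)` as an element of `τ.H`. -/
def ofPoly (f : Poly2) (hf : f ∈ polySpace n m) : τ.H := τ.equivPoly.symm ⟨f, hf⟩

@[simp] theorem incl_ofPoly (f : Poly2) (hf : f ∈ polySpace n m) : τ.incl (τ.ofPoly f hf) = f := rfl

theorem mem_poly {k l : ℤ} {f : τ.H} : f ∈ τ.poly k l ↔ τ.incl f ∈ polySpace k l := Iff.rfl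

theorem mem_poly_self (f : τ.H) : f ∈ τ.poly n m := τ.incl_mem f

theorem poly_mono {k k' l l' : ℤ} (hk : k ≤ k') (hl : l ≤ l') : τ.poly k l ≤ τ.poly k' l' :=
  Submodule.comap_mono (polySpace_mono hk hl)

theorem mem_mulBy {q : Poly2} {S : Submodule ℂ τ.H} {f : τ.H} :
    f ∈ τ.mulBy q S ↔ ∃ g ∈ S, τ.incl f = q * τ.incl g := by
  simp only [mulBy, Submodule.mem_comap, Submodule.mem_map, LinearMap.mulLeft_apply]
  constructor
  · rintro ⟨_, ⟨g, hg, rfl⟩, h⟩; exact ⟨g, hg, h.symm⟩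
  · rintro ⟨g, hg, h⟩; exact ⟨_, ⟨g, hg, rfl⟩, h.symm⟩

theorem mem_zMul {S : Submodule ℂ τ.H} {f : τ.H} :
    f ∈ τ.zMul S ↔ ∃ g ∈ S, τ.incl f = MvPolynomial.X 0 * τ.incl g := τ.mem_mulBy

theorem mem_wMul {S : Submodule ℂ τ.H} {f : τ.H} :
    f ∈ τ.wMul S ↔ ∃ g ∈ S, τ.incl f = MvPolynomial.X 1 * τ.incl g := τ.mem_mulBy

theorem wMul_poly_le (k l : ℤ) : τ.wMul (τ.poly k (l - 1)) ≤ τ.poly k l := by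
  intro f hf
  obtain ⟨g, hg, h⟩ := τ.mem_wMul.1 hf
  rw [mem_poly, h]
  exact X1_mul_mem hg

theorem zMul_poly_le (k l : ℤ) : τ.zMul (τ.poly (k - 1) l) ≤ τ.poly k l := by
  intro f hf
  obtain ⟨g, hg, h⟩ := τ.mem_zMul.1 hf
  rw [mem_poly, h]
  exact X0_mul_mem hg

/-- The form sees only the Laurent polynomial `f(z, w) ḡ(1/z, 1/w)`. Both the isometry of
multiplication by monomials and the antiunitarity of reversal come from this. -/
theorem inner_congr {f g f' g' : τ.H} (h : toLaurent (τ.incl f) * conjInv (τ.incl g) =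
    toLaurent (τ.incl f') * conjInv (τ.incl g')) : ⟪g, f⟫_ℂ = ⟪g', f'⟫_ℂ := by
  rw [inner_eq, inner_eq]
  exact congrArg τ.form (Subtype.ext h)

theorem inner_mul_mul {q : Poly2} (hq : toLaurent q * conjInv q = 1) {f g f' g' : τ.H}
    (hf : τ.incl f' = q * τ.incl f) (hg : τ.incl g' = q * τ.incl g) : ⟪g', f'⟫_ℂ = ⟪g, f⟫_ℂ := by
  apply τ.inner_congr
  rw [hf, hg, map_mul, conjInv_mul]
  linear_combination (toLaurent (τ.incl f) * conjInv (τ.incl g)) * hq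

theorem toLaurent_mul_conjInv_X0 :
    toLaurent (MvPolynomial.X 0) * conjInv (MvPolynomial.X 0) = 1 := by
  rw [toLaurent_X0, conjInv_X0, mono_mul]; rfl

theorem toLaurent_mul_conjInv_X1 :
    toLaurent (MvPolynomial.X 1) * conjInv (MvPolynomial.X 1) = 1 := by
  rw [toLaurent_X1, conjInv_X1, mono_mul]; rfl

/-- The reversal on `τ.H`. -/
def reversal (f : τ.H) : τ.H := τ.ofPoly (rev n m (τ.incl f)) (rev_mem (τ.incl_mem f))

@[simp] theorem incl_reversal (f : τ.H) : τ.incl (τ.reversal f) = rev n m (τ.incl f) := rfl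

@[simp] theorem reversal_reversal (f : τ.H) : τ.reversal (τ.reversal f) = f :=
  τ.incl_injective (rev_rev (τ.incl_mem f))

theorem inner_reversal (f g : τ.H) : ⟪τ.reversal g, τ.reversal f⟫_ℂ = ⟪f, g⟫_ℂ := by
  apply τ.inner_congr
  rw [incl_reversal, incl_reversal, toLaurent_rev (τ.incl_mem f), conjInv_rev (τ.incl_mem g)]
  have : mono n m * mono (-n) (-m) = 1 := by rw [mono_mul]; simp [mono_zero_zero]
  linear_combination (toLaurent (τ.incl g) * conjInv (τ.incl f)) * this

/-- Evaluation at a point, as a linear form. -/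
def ev (z w : ℂ) : τ.H →ₗ[ℂ] ℂ := (MvPolynomial.aeval ![z, w]).toLinearMap ∘ₗ τ.incl

theorem ev_apply (z w : ℂ) (f : τ.H) : τ.ev z w f = MvPolynomial.eval ![z, w] (τ.incl f) := by
  simp [ev, MvPolynomial.aeval_eq_eval]

theorem ev_mul {q : Poly2} {f f' : τ.H} (h : τ.incl f' = q * τ.incl f) (z w : ℂ) :
    τ.ev z w f' = MvPolynomial.eval ![z, w] q * τ.ev z w f := by
  rw [ev_apply, h, map_mul, ev_apply]

theorem ev_reversal {z w : ℂ} (hz : z ≠ 0) (hw : w ≠ 0) (f : τ.H) :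
    τ.ev z w (τ.reversal f) = z ^ n * w ^ m * conj (τ.ev (conj z)⁻¹ (conj w)⁻¹ f) := by
  rw [ev_apply, incl_reversal, eval_rev (τ.incl_mem f) hz hw, ev_apply]

/-- The vector that represents evaluation at a point. -/
def rep (z w : ℂ) : τ.H :=
  (InnerProductSpace.toDual ℂ τ.H).symm (LinearMap.toContinuousLinearMap (τ.ev z w))

theorem inner_rep (z w : ℂ) (f : τ.H) : ⟪τ.rep z w, f⟫_ℂ = τ.ev z w f := by
  simp [rep]

/-- The vector in `V` that represents evaluation at a point on `V`. -/
def kern (V : Submodule ℂ τ.H) (z w : ℂ) : τ.H := V.starProjection (τ.rep z w)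

variable {τ}

theorem kern_mem (V : Submodule ℂ τ.H) (z w : ℂ) : τ.kern V z w ∈ V :=
  V.starProjection_apply_mem _

theorem inner_kern {V : Submodule ℂ τ.H} (z w : ℂ) {f : τ.H} (hf : f ∈ V) :
    ⟪τ.kern V z w, f⟫_ℂ = τ.ev z w f := by
  have := V.starProjection_inner_eq_zero (τ.rep z w) f hf
  rw [inner_sub_left, sub_eq_zero, inner_rep] at this
  exact this.symm

/-- Uniqueness in the Riesz representation. The transformation rules for kernels below are proved by
exhibiting a vector with the reproducing property. -/
theorem eq_kern {V : Submodule ℂ τ.H} {z w : ℂ} {g : τ.H} (hg : g ∈ V)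
    (h : ∀ f ∈ V, ⟪g, f⟫_ℂ = τ.ev z w f) : g = τ.kern V z w := by
  rw [← sub_eq_zero, ← inner_self_eq_zero (𝕜 := ℂ), inner_sub_left,
    h _ (V.sub_mem hg (kern_mem V z w)), inner_kern _ _ (V.sub_mem hg (kern_mem V z w)), sub_self]

theorem kern_sup {V W : Submodule ℂ τ.H} (h : V ⟂ W) (z w : ℂ) :
    τ.kern (V ⊔ W) z w = τ.kern V z w + τ.kern W z w := by
  refine (eq_kern (Submodule.add_mem_sup (kern_mem V z w) (kern_mem W z w)) fun f hf => ?_).symm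
  obtain ⟨a, ha, b, hb, rfl⟩ := Submodule.mem_sup.1 hf
  have h1 : ⟪τ.kern V z w, b⟫_ℂ = 0 := Submodule.isOrtho_iff_inner_eq.1 h _ (kern_mem V z w) b hb
  have h2 : ⟪τ.kern W z w, a⟫_ℂ = 0 :=
    Submodule.isOrtho_iff_inner_eq.1 h.symm _ (kern_mem W z w) a ha
  rw [inner_add_left, inner_add_right, inner_add_right, h1, h2, inner_kern z w ha,
    inner_kern z w hb, map_add, add_zero, zero_add]

/-- The reproducing kernel of `V`. -/
def kap (V : Submodule ℂ τ.H) (z w ζ η : ℂ) : ℂ := τ.ev z w (τ.kern V ζ η)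

theorem kap_eq_inner (V : Submodule ℂ τ.H) (z w ζ η : ℂ) :
    kap V z w ζ η = ⟪τ.kern V z w, τ.kern V ζ η⟫_ℂ := (inner_kern z w (kern_mem V ζ η)).symm

theorem kap_sup {V W : Submodule ℂ τ.H} (h : V ⟂ W) (z w ζ η : ℂ) :
    kap (V ⊔ W) z w ζ η = kap V z w ζ η + kap W z w ζ η := by
  rw [kap, kern_sup h, map_add]; rfl

theorem kap_self (V : Submodule ℂ τ.H) (z w : ℂ) :
    kap V z w z w = ((‖τ.kern V z w‖ ^ 2 : ℝ) : ℂ) := by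
  rw [kap_eq_inner, inner_self_eq_norm_sq_to_K]; norm_cast

/-- Cauchy-Schwarz; it turns identities between kernels on the diagonal into growth bounds. -/
theorem norm_ev_sq_le {V : Submodule ℂ τ.H} {f : τ.H} (hf : f ∈ V) (z w : ℂ) :
    ‖τ.ev z w f‖ ^ 2 ≤ ‖τ.kern V z w‖ ^ 2 * ‖f‖ ^ 2 := by
  rw [← inner_kern z w hf, ← mul_pow]
  gcongr
  exact norm_inner_le_norm _ _

theorem kap_span_singleton {p : τ.H} (hp : ‖p‖ = 1) (z w ζ η : ℂ) :
    kap (ℂ ∙ p) z w ζ η = τ.ev z w p * conj (τ.ev ζ η p) := by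
  have : conj (τ.ev ζ η p) • p = τ.kern (ℂ ∙ p) ζ η := by
    refine eq_kern (Submodule.smul_mem _ _ (Submodule.mem_span_singleton_self p)) fun f hf => ?_
    obtain ⟨c, rfl⟩ := Submodule.mem_span_singleton.1 hf
    rw [inner_smul_left, inner_smul_right, inner_self_eq_norm_sq_to_K, hp, map_smul]
    simp [mul_comm]
  rw [kap, ← this, map_smul, smul_eq_mul, mul_comm]

/-- Multiplication by `q` is isometric, so it carries kernel vectors to kernel vectors up to the
scalar conjugate to `q(ζ, η)`. -/
theorem kap_mulBy {q : Poly2} (hq : toLaurent q * conjInv q = 1) {S : Submodule ℂ τ.H}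
    (hS : ∀ f ∈ S, q * τ.incl f ∈ polySpace n m) (z w ζ η : ℂ) :
    kap (τ.mulBy q S) z w ζ η = MvPolynomial.eval ![z, w] q *
      conj (MvPolynomial.eval ![ζ, η] q) * kap S z w ζ η := by
  set g : τ.H := τ.ofPoly _ (hS _ (kern_mem S ζ η)) with hg
  have : conj (MvPolynomial.eval ![ζ, η] q) • g = τ.kern (τ.mulBy q S) ζ η := by
    refine eq_kern (Submodule.smul_mem _ _ (τ.mem_mulBy.2 ⟨_, kern_mem S ζ η, rfl⟩)) fun f hf => ?_
    obtain ⟨f₀, hf₀, hf⟩ := τ.mem_mulBy.1 hf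
    rw [inner_smul_left, τ.inner_mul_mul hq hf (g := τ.kern S ζ η) rfl, inner_kern _ _ hf₀,
      τ.ev_mul hf, RingHomCompTriple.comp_apply, RingHom.id_apply]
  rw [kap, ← this, map_smul, smul_eq_mul, τ.ev_mul (f := τ.kern S ζ η) rfl, kap]
  ring

theorem kap_reversal {V W : Submodule ℂ τ.H} (hVW : ∀ f ∈ V, τ.reversal f ∈ W)
    (hWV : ∀ f ∈ W, τ.reversal f ∈ V) {z w ζ η : ℂ} (hz : z ≠ 0) (hw : w ≠ 0) (hζ : ζ ≠ 0)
    (hη : η ≠ 0) : kap W z w ζ η = (z * conj ζ) ^ n * (w * conj η) ^ m *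
      conj (kap V (conj z)⁻¹ (conj w)⁻¹ (conj ζ)⁻¹ (conj η)⁻¹) := by
  have : conj (ζ ^ n * η ^ m) • τ.reversal (τ.kern V (conj ζ)⁻¹ (conj η)⁻¹) = τ.kern W ζ η := by
    refine eq_kern (Submodule.smul_mem _ _ (hVW _ (kern_mem V _ _))) fun f hf => ?_
    obtain ⟨g, rfl⟩ : ∃ g, f = τ.reversal g := ⟨τ.reversal f, by simp⟩
    have hg : g ∈ V := by simpa using hWV _ hf
    rw [inner_smul_left, τ.inner_reversal, ← inner_conj_symm, inner_kern _ _ hg,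
      τ.ev_reversal hζ hη, RingHomCompTriple.comp_apply, RingHom.id_apply]
  rw [kap, ← this, map_smul, smul_eq_mul, τ.ev_reversal hz hw, kap]
  simp only [map_mul, map_pow]
  ring

end PositiveForm

end

end BernsteinSzego

/-! ### The spaces `E1`, `E2`, `F2` and evaluation on them. -/

namespace BernsteinSzego

noncomputable section

open scoped Polynomial ComplexConjugate InnerProductSpace

namespace PositiveForm

variable {n m : ℕ} (τ : PositiveForm n m)

/-! ### Orthogonal decompositions of the spaces of polynomials -/

theorem exists_X0_mul {S : Submodule ℂ τ.H} (hS : S ≤ τ.poly (n - 1) m) {f : τ.H} (hf : f ∈ S) :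
    ∃ g ∈ τ.zMul S, τ.incl g = MvPolynomial.X 0 * τ.incl f :=
  ⟨τ.ofPoly _ (X_mul_mem (hS hf)), τ.mem_zMul.2 ⟨f, hf, rfl⟩, rfl⟩

theorem E1_sup (k l : ℤ) : τ.E1 k l ⊔ τ.wMul (τ.poly k (l - 1)) = τ.poly k l := by
  rw [E1, inf_comm, sup_comm]
  exact Submodule.sup_orthogonal_inf_of_hasOrthogonalProjection (τ.wMul_poly_le k l)

theorem E1_isOrtho (k l : ℤ) : τ.E1 k l ⟂ τ.wMul (τ.poly k (l - 1)) :=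
  inf_le_right

theorem E2_sup (k l : ℤ) : τ.E2 k l ⊔ τ.zMul (τ.poly (k - 1) l) = τ.poly k l := by
  rw [E2, inf_comm, sup_comm]
  exact Submodule.sup_orthogonal_inf_of_hasOrthogonalProjection (τ.zMul_poly_le k l)

theorem E2_isOrtho (k l : ℤ) : τ.E2 k l ⟂ τ.zMul (τ.poly (k - 1) l) :=
  inf_le_right

theorem F2_sup (k l : ℤ) : τ.F2 k l ⊔ τ.poly (k - 1) l = τ.poly k l := by
  rw [F2, inf_comm, sup_comm]
  exact Submodule.sup_orthogonal_inf_of_hasOrthogonalProjection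
    (τ.poly_mono (by omega) le_rfl)

theorem F2_isOrtho (k l : ℤ) : τ.F2 k l ⟂ τ.poly (k - 1) l :=
  inf_le_right

variable {τ}

theorem kap_zMul {S : Submodule ℂ τ.H} (hS : S ≤ τ.poly (n - 1) m) (z w ζ η : ℂ) :
    kap (τ.zMul S) z w ζ η = z * conj ζ * kap S z w ζ η := by
  have := kap_mulBy toLaurent_mul_conjInv_X0 (S := S) (fun f hf => X_mul_mem (hS hf)) z w ζ η
  rw [MvPolynomial.eval_X, MvPolynomial.eval_X] at this
  exact this

theorem kap_wMul {S : Submodule ℂ τ.H} (hS : S ≤ τ.poly n (m - 1)) (z w ζ η : ℂ) :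
    kap (τ.wMul S) z w ζ η = w * conj η * kap S z w ζ η := by
  have := kap_mulBy toLaurent_mul_conjInv_X1 (S := S) (fun f hf => X1_mul_mem (hS hf)) z w ζ η
  rw [MvPolynomial.eval_X, MvPolynomial.eval_X] at this
  exact this

theorem kap_poly_eq_E1 {k l : ℤ} (hk : k ≤ n) (hl : l ≤ m) (z w ζ η : ℂ) :
    kap (τ.poly k l) z w ζ η =
      kap (τ.E1 k l) z w ζ η + w * conj η * kap (τ.poly k (l - 1)) z w ζ η := by
  rw [← kap_wMul (τ.poly_mono hk (by omega)), ← kap_sup (τ.E1_isOrtho k l), E1_sup]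

theorem kap_poly_eq_E2 {k l : ℤ} (hk : k ≤ n) (hl : l ≤ m) (z w ζ η : ℂ) :
    kap (τ.poly k l) z w ζ η =
      kap (τ.E2 k l) z w ζ η + z * conj ζ * kap (τ.poly (k - 1) l) z w ζ η := by
  rw [← kap_zMul (τ.poly_mono (by omega) hl), ← kap_sup (τ.E2_isOrtho k l), E2_sup]

theorem kap_poly_eq_F2 (k l : ℤ) (z w ζ η : ℂ) :
    kap (τ.poly k l) z w ζ η =
      kap (τ.F2 k l) z w ζ η + kap (τ.poly (k - 1) l) z w ζ η := by
  rw [← kap_sup (τ.F2_isOrtho k l), F2_sup]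

theorem mul_conj_eq_one {z : ℂ} (hz : ‖z‖ = 1) : z * conj z = 1 := by
  rw [Complex.mul_conj, Complex.normSq_eq_norm_sq, hz]; simp

theorem ne_zero_of_norm_eq_one {z : ℂ} (hz : ‖z‖ = 1) : z ≠ 0 := by
  rintro rfl; simp at hz

theorem inv_conj_of_norm_eq_one {z : ℂ} (hz : ‖z‖ = 1) : (conj z)⁻¹ = z :=
  (eq_inv_of_mul_eq_one_left (mul_conj_eq_one hz)).symm

/-- The symmetry of the reproducing kernel of a space of polynomials under reversal. -/
theorem kap_poly_symm (a b : ℕ) {z w η : ℂ} (hz : ‖z‖ = 1) (hw : w ≠ 0) (hη : η ≠ 0) :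
    (w * conj η) ^ b * kap (τ.poly (n - a) (m - b)) z w z η = (w * conj η) ^ m *
      conj (kap (τ.poly (n - a) (m - b)) z (conj w)⁻¹ z (conj η)⁻¹) := by
  have h0 := ne_zero_of_norm_eq_one hz
  -- Reversal maps `P_{n-a,m-b}` onto `z^a w^b P_{n-a,m-b}`. At equal first arguments on the unit
  -- circle the powers of `z` cancel, and only the factor `(w η̄)^b` survives.
  have h := kap_reversal (τ := τ) (V := τ.poly (n - a) (m - b))
    (W := τ.mulBy (MvPolynomial.X 0 ^ a * MvPolynomial.X 1 ^ b) (τ.poly (n - a) (m - b)))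
    (fun f hf => ?_) (fun f hf => ?_) h0 hw h0 hη
  · rw [kap_mulBy (toLaurent_mul_conjInv_monomial a b) (fun f hf => monomial_mul_mem hf),
      mul_conj_eq_one hz, inv_conj_of_norm_eq_one hz, one_pow, one_mul] at h
    rw [← h]
    have hzz := mul_conj_eq_one hz
    have : z ^ a * conj z ^ a = 1 := by rw [← mul_pow, hzz, one_pow]
    simp only [map_mul, map_pow, MvPolynomial.eval_X, Matrix.cons_val_zero, Matrix.cons_val_one]
    rw [mul_pow]
    linear_combination (-w ^ b * conj η ^ b * kap (τ.poly (n - a) (m - b)) z w z η) * this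
  · obtain ⟨g, hg, h⟩ := exists_rev_eq (n := n) (m := m) hf
    refine τ.mem_mulBy.2 ⟨τ.ofPoly g (polySpace_mono (by omega) (by omega) hg), hg, ?_⟩
    rw [incl_reversal, h, incl_ofPoly]
  · obtain ⟨g, hg, h⟩ := τ.mem_mulBy.1 hf
    rw [mem_poly, incl_reversal, h]
    exact rev_mul_mem hg

/-! ### Values at `w = 0` on `E1` -/

theorem atWZero_wMul {S : Submodule ℂ τ.H} {f : τ.H} (hf : f ∈ τ.wMul S) :
    atWZero (τ.incl f) = 0 := by
  obtain ⟨g, -, h⟩ := τ.mem_wMul.1 hf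
  rw [h]
  simp [atWZero]

theorem mem_wMul_of_atWZero {k l : ℤ} (hk : k ≤ n) (hl : l ≤ m) {f : τ.H} (hf : f ∈ τ.poly k l)
    (h : atWZero (τ.incl f) = 0) : f ∈ τ.wMul (τ.poly k (l - 1)) := by
  obtain ⟨g, hg, hfg⟩ := exists_eq_X1_mul_add hf
  rw [h, map_zero, add_zero] at hfg
  exact τ.mem_wMul.2 ⟨τ.ofPoly g (polySpace_mono hk (by omega) hg), hg, hfg⟩

theorem eq_zero_of_mem_of_mem_orthogonal {V : Submodule ℂ τ.H} {f : τ.H} (h : f ∈ V)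
    (h' : f ∈ Vᗮ) : f = 0 := by
  exact inner_self_eq_zero (𝕜 := ℂ).1 (h' f h)

variable (τ) in
/-- The value at `w = 0`, as a linear map to polynomials in `z`. -/
def valW : τ.H →ₗ[ℂ] ℂ[X] := (MvPolynomial.aeval ![Polynomial.X, 0]).toLinearMap ∘ₗ τ.incl

theorem valW_apply (f : τ.H) : τ.valW f = atWZero (τ.incl f) := rfl

theorem eval_valW (f : τ.H) (z : ℂ) : (τ.valW f).eval z = τ.ev z 0 f := by
  rw [valW_apply, atWZero_eval, ev_apply]

/-- Such an `f` is a multiple of `w`, hence lies in the very space to which `E1` is orthogonal. So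
an element of `E1` is determined by a polynomial in `z` alone, which makes dimension counts
possible. -/
theorem E1_eq_zero {k l : ℤ} (hk : k ≤ n) (hl : l ≤ m) {f : τ.H} (hf : f ∈ τ.E1 k l)
    (h : τ.valW f = 0) : f = 0 :=
  eq_zero_of_mem_of_mem_orthogonal (mem_wMul_of_atWZero hk hl hf.1 h) hf.2

theorem valW_mem {k : ℤ} {N : ℕ} (hN : k + 1 = N) {l : ℤ} {f : τ.H} (hf : f ∈ τ.poly k l) :
    τ.valW f ∈ Polynomial.degreeLT ℂ N := by
  rw [valW_apply, atWZero_eq_coeff, Polynomial.mem_degreeLT,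
    Polynomial.degree_lt_iff_coeff_zero]
  intro s hs
  exact coeff_bi_eq_zero hf (Or.inl (by omega))

theorem exists_mem_E1 {k : ℤ} {N : ℕ} (hN : k + 1 = N) (hk : k ≤ n) {r : ℂ[X]}
    (hr : r ∈ Polynomial.degreeLT ℂ N) : ∃ f ∈ τ.E1 k m, τ.valW f = r := by
  have hmem := aeval_X0_mem (l := m) (by omega) hr
  rw [← hN, add_sub_cancel_right] at hmem
  set ρ : τ.H := τ.ofPoly _ (polySpace_mono hk le_rfl hmem) with hρ
  have hρ' : ρ ∈ τ.poly k m := hmem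
  rw [← E1_sup] at hρ'
  obtain ⟨f, hf, g, hg, hfg⟩ := Submodule.mem_sup.1 hρ'
  refine ⟨f, hf, ?_⟩
  have h1 : τ.valW ρ = r := atWZero_aeval_X0 r
  rw [← hfg, map_add, valW_apply g, atWZero_wMul hg, add_zero] at h1
  exact h1

variable (τ) in
/-- The value at `w = 0` identifies `E1 k m` with the polynomials in `z` of degree at most `k`. -/
def E1Equiv {k : ℤ} {N : ℕ} (hN : k + 1 = N) (hk : k ≤ n) :
    τ.E1 k m ≃ₗ[ℂ] Polynomial.degreeLT ℂ N :=
  LinearEquiv.ofBijective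
    ((τ.valW ∘ₗ (τ.E1 k m).subtype).codRestrict _ fun f => valW_mem hN f.2.1) <| by
    constructor
    · rw [← LinearMap.ker_eq_bot, LinearMap.ker_codRestrict, LinearMap.ker_eq_bot']
      intro f hf
      exact Subtype.ext (E1_eq_zero hk le_rfl f.2 hf)
    · rintro ⟨r, hr⟩
      obtain ⟨f, hf, h⟩ := exists_mem_E1 (τ := τ) hN hk hr
      exact ⟨⟨f, hf⟩, Subtype.ext h⟩

theorem finrank_degreeLT (N : ℕ) : Module.finrank ℂ (Polynomial.degreeLT ℂ N) = N := by
  rw [(Polynomial.degreeLTEquiv ℂ N).finrank_eq]; simp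

theorem finrank_E1 {k : ℤ} {N : ℕ} (hN : k + 1 = N) (hk : k ≤ n) :
    Module.finrank ℂ (τ.E1 k m) = N := by
  rw [(τ.E1Equiv hN hk).finrank_eq, finrank_degreeLT]

/-! ### Slices of functions in `E2` -/

/-- Write `f = (z - ζ) G`. Since `f ⟂ z G` and multiplication by `z` is isometric, `‖f‖² = (|ζ|² -
1) ‖G‖²`, which is not positive when `|ζ| ≤ 1`. This stability property underlies all arguments on
the closed disk. -/
theorem E2_eq_zero {ζ : ℂ} (hζ : ‖ζ‖ ≤ 1) {f : τ.H} (hf : f ∈ τ.E2 n m)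
    (h : slice ζ (τ.incl f) = 0) : f = 0 := by
  obtain ⟨g, hg, hfg⟩ := exists_eq_X0_sub_mul_add ζ (τ.incl_mem f)
  rw [h, map_zero, add_zero] at hfg
  set G : τ.H := τ.ofPoly g (polySpace_mono (by omega) le_rfl hg) with hG
  have hGmem : G ∈ τ.poly (n - 1) m := hg
  obtain ⟨Z, hZ, hZG⟩ := τ.exists_X0_mul le_rfl hGmem
  have hf' : f = Z - ζ • G := by
    apply τ.incl_injective
    rw [hfg, map_sub, map_smul, hZG, hG, incl_ofPoly, MvPolynomial.smul_eq_C_mul]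
    ring
  have h1 : ⟪Z, f⟫_ℂ = 0 := hf.2 Z hZ
  have h2 : ⟪Z, Z⟫_ℂ = ⟪G, G⟫_ℂ := τ.inner_mul_mul toLaurent_mul_conjInv_X0 hZG hZG
  have h3 : ⟪f, Z⟫_ℂ = 0 := by rw [← inner_conj_symm, h1, map_zero]
  have h4 : ⟪f, f⟫_ℂ = (ζ * conj ζ - 1) * ⟪G, G⟫_ℂ := by
    have e1 : ⟪f, Z⟫_ℂ = ⟪Z, Z⟫_ℂ - conj ζ * ⟪G, Z⟫_ℂ := by
      conv_lhs => rw [hf', inner_sub_left, inner_smul_left]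
    have e2 : ⟪f, f⟫_ℂ = ⟪Z, f⟫_ℂ - conj ζ * ⟪G, f⟫_ℂ := by
      nth_rewrite 1 [hf']
      rw [inner_sub_left, inner_smul_left]
    have e3 : ⟪G, f⟫_ℂ = ⟪G, Z⟫_ℂ - ζ * ⟪G, G⟫_ℂ := by
      rw [hf', inner_sub_right, inner_smul_right]
    rw [e2, e3, h1]
    rw [h3, h2] at e1
    linear_combination -e1
  have h5 : ‖f‖ ^ 2 = (‖ζ‖ ^ 2 - 1) * ‖G‖ ^ 2 := by
    rw [inner_self_eq_norm_sq_to_K, inner_self_eq_norm_sq_to_K, Complex.mul_conj,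
      Complex.normSq_eq_norm_sq] at h4
    apply Complex.ofReal_injective
    push_cast at h4 ⊢
    exact h4
  have h6 : ‖f‖ ^ 2 ≤ 0 := by
    rw [h5]
    exact mul_nonpos_of_nonpos_of_nonneg
      (sub_nonpos.2 (pow_le_one₀ (norm_nonneg _) hζ)) (sq_nonneg _)
  exact norm_eq_zero.1 (pow_eq_zero_iff two_ne_zero |>.1 (le_antisymm h6 (sq_nonneg _)))

variable (τ) in
/-- The polynomial `f(z, ·)` as a linear function of `f`. -/
def sliceL (ζ : ℂ) : τ.H →ₗ[ℂ] ℂ[X] where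
  toFun f := slice ζ (τ.incl f)
  map_add' f g := by simp
  map_smul' c f := by simp

theorem sliceL_apply (ζ : ℂ) (f : τ.H) : τ.sliceL ζ f = slice ζ (τ.incl f) := rfl

theorem eval_sliceL (z w : ℂ) (f : τ.H) : (τ.sliceL z f).eval w = τ.ev z w f := by
  rw [sliceL_apply, eval_slice, ev_apply]

theorem sliceL_mem (ζ : ℂ) (f : τ.H) : τ.sliceL ζ f ∈ Polynomial.degreeLT ℂ (m + 1) :=
  slice_mem_degreeLT (τ.incl_mem f) ζ

theorem natDegree_sliceL (ζ : ℂ) (f : τ.H) : (τ.sliceL ζ f).natDegree ≤ m :=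
  natDegree_slice_le (τ.incl_mem f) ζ

theorem exists_mem_E2_slice_zero {r : ℂ[X]} (hr : r ∈ Polynomial.degreeLT ℂ (m + 1)) :
    ∃ f ∈ τ.E2 n m, τ.sliceL 0 f = r := by
  have hmem := aeval_X1_mem (k := n) (by omega) hr
  rw [Nat.cast_add, Nat.cast_one, add_sub_cancel_right] at hmem
  set ρ : τ.H := τ.ofPoly _ hmem with hρ
  have hρ' : ρ ∈ τ.poly n m := hmem
  rw [← E2_sup] at hρ'
  obtain ⟨f, hf, g, hg, hfg⟩ := Submodule.mem_sup.1 hρ'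
  refine ⟨f, hf, ?_⟩
  have h1 : τ.sliceL 0 ρ = r := slice_aeval_X1 0 r
  have h2 : τ.sliceL 0 g = 0 := by
    obtain ⟨g', -, h⟩ := τ.mem_zMul.1 hg
    rw [sliceL_apply, h]
    simp
  rw [← hfg, map_add, h2, add_zero] at h1
  exact h1

variable (τ) in
/-- The map `f ↦ f(ζ, ·)` on `E2 n m`. -/
def E2Slice (ζ : ℂ) : τ.E2 n m →ₗ[ℂ] Polynomial.degreeLT ℂ (m + 1) :=
  (τ.sliceL ζ ∘ₗ (τ.E2 n m).subtype).codRestrict _ fun f => sliceL_mem ζ (f : τ.H)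

theorem E2Slice_injective {ζ : ℂ} (hζ : ‖ζ‖ ≤ 1) : Function.Injective (τ.E2Slice ζ) := by
  rw [← LinearMap.ker_eq_bot, LinearMap.ker_eq_bot']
  intro f hf
  exact Subtype.ext (E2_eq_zero hζ f.2 (congrArg Subtype.val hf))

/-- The slice at `ζ = 0` is onto, because removing a multiple of `z` from a polynomial in `w` does
not change it. This fixes the dimension, after which injectivity alone gives surjectivity at every
other point of the closed disk. -/
theorem finrank_E2 : Module.finrank ℂ (τ.E2 n m) = m + 1 := by
  have hs : Function.Surjective (τ.E2Slice 0) := by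
    rintro ⟨r, hr⟩
    obtain ⟨f, hf, h⟩ := exists_mem_E2_slice_zero (τ := τ) hr
    exact ⟨⟨f, hf⟩, Subtype.ext h⟩
  rw [(LinearEquiv.ofBijective _ ⟨E2Slice_injective (by simp), hs⟩).finrank_eq, finrank_degreeLT]

theorem exists_mem_E2_slice {ζ : ℂ} (hζ : ‖ζ‖ ≤ 1) {r : ℂ[X]}
    (hr : r ∈ Polynomial.degreeLT ℂ (m + 1)) : ∃ f ∈ τ.E2 n m, τ.sliceL ζ f = r := by
  have : FiniteDimensional ℂ (Polynomial.degreeLT ℂ (m + 1)) :=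
    Module.Finite.equiv (Polynomial.degreeLTEquiv ℂ (m + 1)).symm
  have hs : Function.Surjective (τ.E2Slice ζ) :=
    (LinearMap.injective_iff_surjective_of_finrank_eq_finrank
      (by rw [finrank_E2, finrank_degreeLT])).1 (E2Slice_injective hζ)
  obtain ⟨f, h⟩ := hs ⟨r, hr⟩
  exact ⟨f, f.2, congrArg Subtype.val h⟩

/-- Every polynomial is the sum of an element of `E2` and a multiple of `z - ζ`. -/
theorem exists_E2_add_mul {ζ : ℂ} (hζ : ‖ζ‖ ≤ 1) (f : τ.H) :
    ∃ φ ∈ τ.E2 n m, ∃ g ∈ τ.poly (n - 1) m, ∃ g' : τ.H,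
      τ.incl g' = MvPolynomial.X 0 * τ.incl g ∧ f = φ + (g' - ζ • g) := by
  obtain ⟨φ, hφ, h⟩ := exists_mem_E2_slice (τ := τ) hζ (sliceL_mem ζ f)
  obtain ⟨g, hg, hfg⟩ := exists_eq_X0_sub_mul_add ζ (τ.incl_mem (f - φ))
  rw [← sliceL_apply, map_sub (τ.sliceL ζ), h, sub_self, map_zero, add_zero] at hfg
  have hg' : τ.ofPoly g (polySpace_mono (by omega) le_rfl hg) ∈ τ.poly (n - 1) m := hg
  obtain ⟨Z, -, hZ⟩ := τ.exists_X0_mul le_rfl hg'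
  refine ⟨φ, hφ, _, hg', Z, hZ, ?_⟩
  rw [← sub_eq_iff_eq_add']
  apply τ.incl_injective
  rw [hfg, map_sub, map_smul, hZ, incl_ofPoly, MvPolynomial.smul_eq_C_mul]
  ring

end PositiveForm

end

end BernsteinSzego

/-! ### The equivalence of the split-shift condition and the matrix condition. -/

namespace BernsteinSzego

noncomputable section

open scoped Polynomial ComplexConjugate InnerProductSpace

/-! ### Invariant subspaces between two given ones -/

/-- The map induced on `V / W` has an eigenvector because ℂ is algebraically closed; a lift of it,
added to `W`, spans an invariant subspace one dimension larger. -/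
theorem exists_invtSubmodule_succ {E : Type*} [AddCommGroup E] [Module ℂ E]
    [FiniteDimensional ℂ E] (T : Module.End ℂ E) {W V : Submodule ℂ E}
    (hW : W ∈ T.invtSubmodule) (hV : V ∈ T.invtSubmodule) (hWV : W < V) :
    ∃ U ∈ T.invtSubmodule, W ≤ U ∧ U ≤ V ∧ Module.finrank ℂ U = Module.finrank ℂ W + 1 := by
  rw [Module.End.mem_invtSubmodule_iff_forall_mem_of_mem] at hW hV
  set S : Module.End ℂ V := T.restrict hV with hS
  set W' : Submodule ℂ V := W.comap V.subtype with hW'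
  have hinv : W' ≤ W'.comap S := fun x hx => hW _ hx
  have : Nontrivial (V ⧸ W') := by
    rw [Submodule.Quotient.nontrivial_iff]
    intro h
    refine hWV.not_ge fun x hx => ?_
    have : (⟨x, hx⟩ : V) ∈ W' := h ▸ Submodule.mem_top
    exact this
  obtain ⟨c, hc⟩ := Module.End.exists_eigenvalue (W'.mapQ W' S hinv)
  obtain ⟨q, hq⟩ := hc.exists_hasEigenvector
  obtain ⟨v, rfl⟩ := Submodule.Quotient.mk_surjective _ q
  have hv : (v : E) ∉ W := fun h => hq.2 ((Submodule.Quotient.mk_eq_zero W').2 h)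
  have hv' : T v - c • (v : E) ∈ W := by
    have := hq.apply_eq_smul
    rw [Submodule.mapQ_apply, ← Submodule.Quotient.mk_smul, Submodule.Quotient.eq] at this
    exact this
  refine ⟨W ⊔ Submodule.span ℂ {(v : E)}, ?_, le_sup_left, sup_le hWV.le ?_,
    Submodule.finrank_sup_span_singleton hv⟩
  · rw [Module.End.mem_invtSubmodule_iff_forall_mem_of_mem]
    intro x hx
    obtain ⟨a, ha, b, hb, rfl⟩ := Submodule.mem_sup.1 hx
    obtain ⟨e, rfl⟩ := Submodule.mem_span_singleton.1 hb
    rw [map_add, map_smul]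
    refine Submodule.add_mem _ (Submodule.mem_sup_left (hW _ ha)) (Submodule.smul_mem _ _ ?_)
    rw [← sub_add_cancel (T v) (c • (v : E))]
    exact Submodule.add_mem_sup hv' (Submodule.smul_mem _ _ (Submodule.mem_span_singleton_self _))
  · rw [Submodule.span_singleton_le_iff_mem]
    exact v.2

theorem exists_invtSubmodule_finrank_eq {E : Type*} [AddCommGroup E] [Module ℂ E]
    [FiniteDimensional ℂ E] (T : Module.End ℂ E) {W V : Submodule ℂ E}
    (hW : W ∈ T.invtSubmodule) (hV : V ∈ T.invtSubmodule) (hWV : W ≤ V) {e : ℕ}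
    (h1 : Module.finrank ℂ W ≤ e) (h2 : e ≤ Module.finrank ℂ V) :
    ∃ U ∈ T.invtSubmodule, W ≤ U ∧ U ≤ V ∧ Module.finrank ℂ U = e := by
  induction e, h1 using Nat.le_induction with
  | base => exact ⟨W, hW, le_rfl, hWV, rfl⟩
  | succ k hk ih =>
    obtain ⟨U, hU, hWU, hUV, rfl⟩ := ih (by omega)
    obtain ⟨U', hU', h, h', h''⟩ := exists_invtSubmodule_succ T hU hV
      (lt_of_le_of_ne hUV (by rintro rfl; omega))
    exact ⟨U', hU', hWU.trans h, h', h''⟩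

theorem finrank_sup_of_isOrtho {E : Type*} [NormedAddCommGroup E] [InnerProductSpace ℂ E]
    [FiniteDimensional ℂ E] {V W : Submodule ℂ E} (h : V ⟂ W) :
    Module.finrank ℂ (V ⊔ W : Submodule ℂ E) = Module.finrank ℂ V + Module.finrank ℂ W := by
  rw [← Submodule.finrank_sup_add_finrank_inf_eq, h.disjoint.eq_bot, finrank_bot, add_zero]

namespace PositiveForm

variable {n m : ℕ} (τ : PositiveForm n m)

/-! ### The operators `A`, `B` and `T` -/

/-- Decompose `w P_{n,m-1} = w E2 ⊕ z w P_{n-1,m-1}`. Orthogonality of `z f` to the second summand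
is automatic, since `f ⟂ w P_{n-1,m-1}` and multiplication by `z` is isometric. Only `w E2` has to
be tested, and this is what `A` does. -/
theorem Mz_mem_E1_iff (f : τ.E1 (n - 1) m) : τ.Mz f ∈ τ.E1 n m ↔ τ.opA f = 0 := by
  have hA : τ.opA f = 0 ↔ τ.Mz f ∈ (τ.wMul (τ.E2 n (m - 1)))ᗮ :=
    Submodule.orthogonalProjectionOnto_eq_zero_iff (K := τ.wMul (τ.E2 n (m - 1))) (v := τ.Mz f)
  rw [hA]
  constructor
  · intro h g hg
    obtain ⟨g', hg', hgg⟩ := τ.mem_wMul.1 hg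
    exact h.2 g (τ.mem_wMul.2 ⟨g', hg'.1, hgg⟩)
  · refine fun h => ⟨τ.mem_poly_self _, fun g hg => ?_⟩
    obtain ⟨g', hg', hgg⟩ := τ.mem_wMul.1 hg
    rw [← E2_sup] at hg'
    obtain ⟨a, ha, b, hb, rfl⟩ := Submodule.mem_sup.1 hg'
    obtain ⟨b', hb', hbb⟩ := τ.mem_zMul.1 hb
    set wa : τ.H := τ.ofPoly (MvPolynomial.X 1 * τ.incl a) (X1_mul_mem ha.1) with hwa
    have hb'' : MvPolynomial.X 1 * τ.incl b' ∈ polySpace (n - 1) m := X1_mul_mem hb'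
    set wb : τ.H := τ.ofPoly (MvPolynomial.X 1 * τ.incl b')
      (polySpace_mono (by omega) le_rfl hb'') with hwb
    obtain ⟨Z, -, hZ⟩ := τ.exists_X0_mul le_rfl (f := wb) hb''
    have hg : g = wa + Z := by
      apply τ.incl_injective
      rw [hgg, map_add, map_add, hZ, hwa, hwb, incl_ofPoly, incl_ofPoly, hbb]
      ring
    rw [hg, inner_add_left, h wa (τ.mem_wMul.2 ⟨a, ha, rfl⟩),
      τ.inner_mul_mul toLaurent_mul_conjInv_X0 (τ.incl_Mz f) hZ, zero_add]
    exact f.2.2 wb (τ.mem_wMul.2 ⟨b', hb', rfl⟩)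

/-- Decompose `w P_{n,m-1} = w F2 ⊕ w P_{n-1,m-1}`. The second summand is orthogonal to `f` already,
and pairing `f` with `w F2` is pairing it with the range of `B`. -/
theorem mem_E1_iff (f : τ.E1 (n - 1) m) :
    (f : τ.H) ∈ τ.E1 n m ↔ f ∈ (LinearMap.range τ.opB)ᗮ := by
  have hB : ∀ g, ⟪τ.opB g, f⟫_ℂ = ⟪(g : τ.H), (f : τ.H)⟫_ℂ := fun g =>
    Submodule.inner_orthogonalProjectionOnto_eq_of_mem_right f (g : τ.H)
  constructor
  · rintro h _ ⟨g, rfl⟩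
    rw [hB]
    obtain ⟨g', hg', hgg⟩ := τ.mem_wMul.1 g.2
    exact h.2 g (τ.mem_wMul.2 ⟨g', hg'.1, hgg⟩)
  · refine fun h => ⟨τ.mem_poly_self _, fun g hg => ?_⟩
    obtain ⟨g', hg', hgg⟩ := τ.mem_wMul.1 hg
    rw [← F2_sup] at hg'
    obtain ⟨a, ha, b, hb, rfl⟩ := Submodule.mem_sup.1 hg'
    set wa : τ.H := τ.ofPoly (MvPolynomial.X 1 * τ.incl a) (X1_mul_mem ha.1) with hwa
    have hb' : MvPolynomial.X 1 * τ.incl b ∈ polySpace (n - 1) m := X1_mul_mem hb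
    set wb : τ.H := τ.ofPoly (MvPolynomial.X 1 * τ.incl b)
      (polySpace_mono (by omega) le_rfl hb') with hwb
    have hg : g = wa + wb := by
      apply τ.incl_injective
      rw [hgg, map_add, map_add, hwa, hwb, incl_ofPoly, incl_ofPoly]
      ring
    have h1 : ⟪wa, (f : τ.H)⟫_ℂ = 0 := by
      rw [← hB ⟨wa, τ.mem_wMul.2 ⟨a, ha, rfl⟩⟩]
      exact h _ (LinearMap.mem_range_self _ _)
    rw [hg, inner_add_left, h1, zero_add]
    exact f.2.2 wb (τ.mem_wMul.2 ⟨b, hb, rfl⟩)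

theorem inner_opT (f g : τ.E1 (n - 1) m) : ⟪τ.opT g, f⟫_ℂ = ⟪τ.Mz g, (f : τ.H)⟫_ℂ :=
  Submodule.inner_orthogonalProjectionOnto_eq_of_mem_right f (τ.Mz g)

/-- `U` is `K₂`, and `K₁` is its complement inside `E1 (n - 1) m`. Invariance of `U` expresses `K₁ ⟂
z K₂`, because compressing `z` to `E1 (n - 1) m` does not affect inner products with `K₁`. -/
theorem exists_shiftSplit_iff {d : ℕ} :
    (∃ K₁ K₂ : Submodule ℂ τ.H, τ.IsShiftSplit K₁ K₂ ∧ Module.finrank ℂ K₁ = d) ↔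
      ∃ U ∈ Module.End.invtSubmodule τ.opT, LinearMap.range τ.opB ≤ U ∧
        U ≤ LinearMap.ker τ.opA ∧ Module.finrank ℂ Uᗮ = d := by
  constructor
  · rintro ⟨K₁, K₂, ⟨⟨h12, hsup⟩, hz, h1, h2⟩, rfl⟩
    have hK₁ : K₁ ≤ τ.E1 (n - 1) m := hsup ▸ le_sup_left
    have hK₂ : K₂ ≤ τ.E1 (n - 1) m := hsup ▸ le_sup_right
    have hmem : ∀ f : τ.E1 (n - 1) m, (∀ g ∈ K₁, ⟪g, (f : τ.H)⟫_ℂ = 0) → (f : τ.H) ∈ K₂ := by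
      intro f hf
      have := hsup.ge f.2
      obtain ⟨a, ha, b, hb, hab⟩ := Submodule.mem_sup.1 this
      have h0 := hf a ha
      rw [← hab, inner_add_right, Submodule.isOrtho_iff_inner_eq.1 h12 a ha b hb, add_zero,
        inner_self_eq_zero] at h0
      rw [← hab, h0, zero_add]
      exact hb
    have horth : (K₂.comap (τ.E1 (n - 1) m).subtype)ᗮ = K₁.comap (τ.E1 (n - 1) m).subtype := by
      ext f
      constructor
      · intro hf
        have := hsup.ge f.2
        obtain ⟨a, ha, b, hb, hab⟩ := Submodule.mem_sup.1 this
        have h0 : ⟪b, (f : τ.H)⟫_ℂ = 0 := hf ⟨b, hK₂ hb⟩ hb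
        rw [← hab, inner_add_right, Submodule.isOrtho_iff_inner_eq.1 h12.symm b hb a ha, zero_add,
          inner_self_eq_zero] at h0
        change (f : τ.H) ∈ K₁
        rw [← hab, h0, add_zero]
        exact ha
      · intro hf g hg
        exact Submodule.isOrtho_iff_inner_eq.1 h12.symm _ hg _ hf
    refine ⟨K₂.comap (τ.E1 (n - 1) m).subtype, ?_, ?_, ?_, ?_⟩
    · rw [Module.End.mem_invtSubmodule_iff_forall_mem_of_mem]
      refine fun f hf => hmem _ fun g hg => ?_
      rw [← inner_conj_symm]
      have := τ.inner_opT ⟨g, hK₁ hg⟩ f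
      rw [Submodule.coe_inner] at this
      rw [this, ← inner_conj_symm, RingHomCompTriple.comp_apply, RingHom.id_apply]
      exact Submodule.isOrtho_iff_inner_eq.1 hz g hg _ (τ.mem_zMul.2 ⟨f, hf, rfl⟩)
    · rintro _ ⟨g, rfl⟩
      refine hmem _ fun f hf => ?_
      rw [← inner_conj_symm, map_eq_zero]
      exact (τ.mem_E1_iff ⟨f, hK₁ hf⟩).1 (h1 hf) _ (LinearMap.mem_range_self _ _)
    · intro f hf
      rw [LinearMap.mem_ker, ← Mz_mem_E1_iff]
      exact h2 (τ.mem_zMul.2 ⟨f, hf, rfl⟩)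
    · rw [horth]
      exact (Submodule.comapSubtypeEquivOfLe hK₁).finrank_eq
  · rintro ⟨U, hU, hB, hA, rfl⟩
    rw [Module.End.mem_invtSubmodule_iff_forall_mem_of_mem] at hU
    refine ⟨Uᗮ.map (τ.E1 (n - 1) m).subtype, U.map (τ.E1 (n - 1) m).subtype, ⟨⟨?_, ?_⟩, ?_, ?_, ?_⟩,
      Submodule.finrank_map_subtype_eq _ _⟩
    · rw [Submodule.isOrtho_iff_inner_eq]
      rintro _ ⟨f, hf, rfl⟩ _ ⟨g, hg, rfl⟩
      rw [← inner_conj_symm, map_eq_zero]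
      exact hf g hg
    · rw [← Submodule.map_sup, sup_comm, Submodule.sup_orthogonal_of_hasOrthogonalProjection,
        Submodule.map_subtype_top]
    · rw [Submodule.isOrtho_iff_inner_eq]
      rintro _ ⟨f, hf, rfl⟩ g hg
      obtain ⟨_, ⟨g', hg', rfl⟩, hgg⟩ := τ.mem_zMul.1 hg
      have : g = τ.Mz g' := τ.incl_injective hgg
      rw [this, ← inner_conj_symm, map_eq_zero]
      exact (τ.inner_opT f g').symm.trans (hf _ (hU _ hg'))
    · rintro _ ⟨f, hf, rfl⟩
      exact (τ.mem_E1_iff f).2 (Submodule.orthogonal_le hB hf)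
    · intro g hg
      obtain ⟨_, ⟨g', hg', rfl⟩, hgg⟩ := τ.mem_zMul.1 hg
      have : g = τ.Mz g' := τ.incl_injective hgg
      rw [this, Mz_mem_E1_iff]
      exact hA hg'

theorem range_opB_le_spaceB : LinearMap.range τ.opB ≤ τ.spaceB := by
  rintro _ ⟨g, rfl⟩
  exact Submodule.subset_span ⟨0, g, rfl⟩

theorem spaceB_mem_invtSubmodule : τ.spaceB ∈ Module.End.invtSubmodule τ.opT := by
  rw [Module.End.mem_invtSubmodule, spaceB, Submodule.span_le]
  rintro _ ⟨j, f, rfl⟩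
  exact Submodule.subset_span ⟨j + 1, f, by rw [pow_succ']; rfl⟩

theorem spaceB_le {U : Submodule ℂ (τ.E1 (n - 1) m)} (hU : U ∈ Module.End.invtSubmodule τ.opT)
    (hB : LinearMap.range τ.opB ≤ U) : τ.spaceB ≤ U := by
  rw [Module.End.mem_invtSubmodule_iff_forall_mem_of_mem] at hU
  rw [spaceB, Submodule.span_le]
  rintro _ ⟨j, f, rfl⟩
  induction j with
  | zero => exact hB (LinearMap.mem_range_self _ _)
  | succ j ih => rw [pow_succ']; exact hU _ ih

theorem matrixCondition_iff : τ.MatrixCondition ↔ τ.spaceB ≤ LinearMap.ker τ.opA := by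
  have : sInf {U : Submodule ℂ (τ.E1 (n - 1) m) |
      LinearMap.range τ.opB ≤ U ∧ U ∈ Module.End.invtSubmodule τ.opT} = τ.spaceB :=
    le_antisymm (sInf_le ⟨τ.range_opB_le_spaceB, τ.spaceB_mem_invtSubmodule⟩)
      (le_sInf fun U hU => τ.spaceB_le hU.2 hU.1)
  rw [MatrixCondition, this]

/-- Taking adjoints moves `(T*)^j A*` over to `A T^j`. Hence this complement is the largest
`T`-invariant subspace of the kernel of `A`. -/
theorem mem_orthogonal_spaceA {f : τ.E1 (n - 1) m} :
    f ∈ τ.spaceAᗮ ↔ ∀ j : ℕ, τ.opA ((τ.opT ^ j) f) = 0 := by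
  have key : ∀ (j : ℕ) (g : τ.wMul (τ.E2 n (m - 1))),
      ⟪(LinearMap.adjoint τ.opT ^ j) (LinearMap.adjoint τ.opA g), f⟫_ℂ =
        ⟪g, τ.opA ((τ.opT ^ j) f)⟫_ℂ := by
    intro j
    induction j generalizing f with
    | zero => exact fun g => LinearMap.adjoint_inner_left _ _ _
    | succ j ih =>
      intro g
      rw [pow_succ', Module.End.mul_apply, LinearMap.adjoint_inner_left, ih, pow_succ,
        Module.End.mul_apply]
  constructor
  · intro h j
    rw [← inner_self_eq_zero (𝕜 := ℂ), ← key]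
    exact h _ (Submodule.subset_span ⟨j, _, rfl⟩)
  · intro h
    refine (Submodule.mem_orthogonal _ _).2 fun g hg => ?_
    induction hg using Submodule.span_induction with
    | zero => simp
    | add x y _ _ hx hy => rw [inner_add_left, hx, hy, add_zero]
    | smul c x _ hx => rw [inner_smul_left, hx, mul_zero]
    | mem x hx =>
      obtain ⟨j, g, rfl⟩ := hx
      rw [key, h, inner_zero_right]

theorem orthogonal_spaceA_mem_invtSubmodule :
    τ.spaceAᗮ ∈ Module.End.invtSubmodule τ.opT := by
  rw [Module.End.mem_invtSubmodule_iff_forall_mem_of_mem]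
  intro f hf
  rw [mem_orthogonal_spaceA] at hf ⊢
  intro j
  have := hf (j + 1)
  rwa [pow_succ, Module.End.mul_apply] at this

theorem le_orthogonal_spaceA {U : Submodule ℂ (τ.E1 (n - 1) m)}
    (hU : U ∈ Module.End.invtSubmodule τ.opT) (hA : U ≤ LinearMap.ker τ.opA) :
    U ≤ τ.spaceAᗮ := by
  rw [Module.End.mem_invtSubmodule_iff_forall_mem_of_mem] at hU
  intro f hf
  rw [mem_orthogonal_spaceA]
  intro j
  have : (τ.opT ^ j) f ∈ U := by
    induction j with
    | zero => exact hf
    | succ j ih => rw [pow_succ']; exact hU _ ih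
  exact hA this

theorem orthogonal_spaceA_le : τ.spaceAᗮ ≤ LinearMap.ker τ.opA :=
  fun _ hf => τ.mem_orthogonal_spaceA.1 hf 0

/-- The split-shift condition and the matrix condition are equivalent. -/
theorem shiftSplit_iff_matrixCondition {d : ℕ} (hd : d ≤ n) :
    (∃ K₁ K₂ : Submodule ℂ τ.H, τ.IsShiftSplit K₁ K₂ ∧ Module.finrank ℂ K₁ = d) ↔
      τ.MatrixCondition ∧ Module.finrank ℂ τ.spaceA ≤ d ∧
        (d : ℤ) ≤ (n : ℤ) - (Module.finrank ℂ τ.spaceB : ℤ) := by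
  have hE : Module.finrank ℂ (τ.E1 (n - 1) m) = n := finrank_E1 (by ring) (by omega)
  have hO := fun U : Submodule ℂ (τ.E1 (n - 1) m) => U.finrank_add_finrank_orthogonal
  rw [exists_shiftSplit_iff, matrixCondition_iff]
  constructor
  · rintro ⟨U, hU, hB, hA, hd⟩
    have h1 := τ.spaceB_le hU hB
    have h2 := Submodule.finrank_mono h1
    have h3 := Submodule.finrank_mono (τ.le_orthogonal_spaceA hU hA)
    have h4 := hO U
    have h5 := hO τ.spaceA
    exact ⟨h1.trans hA, by omega, by omega⟩
  · rintro ⟨h, h1, h2⟩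
    have h5 := hO τ.spaceA
    -- `U` plays the role of `K₂`, so its dimension has to be `n - d`. The two dimension
    -- inequalities of the matrix condition place `n - d` between the dimensions of `spaceB` and
    -- `spaceAᗮ`.
    obtain ⟨U, hU, hBU, hUA, he⟩ := exists_invtSubmodule_finrank_eq (e := n - d) τ.opT
      τ.spaceB_mem_invtSubmodule τ.orthogonal_spaceA_mem_invtSubmodule
      (τ.le_orthogonal_spaceA τ.spaceB_mem_invtSubmodule h) (by omega) (by omega)
    have h4 := hO U
    exact ⟨U, hU, τ.range_opB_le_spaceB.trans hBU, hUA.trans τ.orthogonal_spaceA_le, by omega⟩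

end PositiveForm

end

end BernsteinSzego

/-! ### Fourier analysis and weighted inner products on the circle and the torus. -/

namespace BernsteinSzego

noncomputable section

open scoped Polynomial ComplexConjugate

/-! ### Averages over the unit circle -/

/-- The average of a function over the unit circle. -/
def avg (F : ℂ → ℂ) : ℂ := Real.circleAverage F 0 1

/-- Continuity of a function along the unit circle. -/
def CircleCont (F : ℂ → ℂ) : Prop := Continuous fun θ : ℝ => F (circleMap 0 1 θ)

theorem norm_circleMap (θ : ℝ) : ‖circleMap 0 1 θ‖ = 1 := by simp

namespace CircleCont

variable {F G : ℂ → ℂ}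

theorem circleIntegrable (hF : CircleCont F) : CircleIntegrable F 0 1 :=
  Continuous.intervalIntegrable hF _ _

theorem of_continuous (hF : Continuous F) : CircleCont F := hF.comp (continuous_circleMap 0 1)

theorem add (hF : CircleCont F) (hG : CircleCont G) : CircleCont fun z => F z + G z :=
  Continuous.add hF hG

theorem sub (hF : CircleCont F) (hG : CircleCont G) : CircleCont fun z => F z - G z :=
  Continuous.sub hF hG

theorem mul (hF : CircleCont F) (hG : CircleCont G) : CircleCont fun z => F z * G z :=
  Continuous.mul hF hG

theorem const_mul (c : ℂ) (hF : CircleCont F) : CircleCont fun z => c * F z :=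
  Continuous.mul continuous_const hF

theorem conjugate (hF : CircleCont F) : CircleCont fun z => conj (F z) :=
  Complex.continuous_conj.comp hF

theorem div (hF : CircleCont F) (hG : CircleCont G) (h : ∀ z, ‖z‖ = 1 → G z ≠ 0) :
    CircleCont fun z => F z / G z :=
  Continuous.div hF hG fun θ => h _ (norm_circleMap θ)

theorem sum {ι : Type*} {s : Finset ι} {F : ι → ℂ → ℂ} (h : ∀ i ∈ s, CircleCont (F i)) :
    CircleCont fun z => ∑ i ∈ s, F i z :=
  continuous_finsetSum _ h

theorem zpow (j : ℤ) : CircleCont fun z => z ^ j :=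
  Continuous.zpow₀ (continuous_circleMap 0 1) j fun θ => Or.inl <| by
    rw [← norm_ne_zero_iff, norm_circleMap]; exact one_ne_zero

theorem pow (j : ℕ) : CircleCont fun z => z ^ j := of_continuous (continuous_pow j)

theorem polynomial (a : ℂ[X]) : CircleCont fun z => a.eval z := of_continuous a.continuous

theorem congr (hF : CircleCont F) (h : ∀ z, ‖z‖ = 1 → G z = F z) : CircleCont G := by
  have : (fun θ : ℝ => G (circleMap 0 1 θ)) = fun θ : ℝ => F (circleMap 0 1 θ) :=
    funext fun θ => h _ (norm_circleMap θ)
  rw [CircleCont, this]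
  exact hF

end CircleCont

section avg

variable {F G : ℂ → ℂ}

theorem avg_congr (h : ∀ z, ‖z‖ = 1 → F z = G z) : avg F = avg G :=
  Real.circleAverage_congr_sphere fun z hz => h z (by simpa using hz)

theorem avg_add (hF : CircleCont F) (hG : CircleCont G) :
    avg (fun z => F z + G z) = avg F + avg G :=
  Real.circleAverage_fun_add hF.circleIntegrable hG.circleIntegrable

theorem avg_sub (hF : CircleCont F) (hG : CircleCont G) :
    avg (fun z => F z - G z) = avg F - avg G :=
  Real.circleAverage_fun_sub hF.circleIntegrable hG.circleIntegrable

theorem avg_const_mul (c : ℂ) (F : ℂ → ℂ) : avg (fun z => c * F z) = c * avg F :=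
  Real.circleAverage_fun_smul (a := c) (f := F) (c := 0) (R := 1)

theorem avg_const (c : ℂ) : avg (fun _ => c) = c := Real.circleAverage_const c 0 1

theorem avg_sum {ι : Type*} {s : Finset ι} {F : ι → ℂ → ℂ} (h : ∀ i ∈ s, CircleCont (F i)) :
    avg (fun z => ∑ i ∈ s, F i z) = ∑ i ∈ s, avg (F i) :=
  Real.circleAverage_fun_sum fun i hi => (h i hi).circleIntegrable

theorem avg_conj (F : ℂ → ℂ) : avg (fun z => conj (F z)) = conj (avg F) := by
  simp only [avg, Real.circleAverage, intervalIntegral, Complex.real_smul, map_mul,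
    map_sub, Complex.conj_ofReal, ← integral_conj]

theorem avg_pow_mul_eq_zero {s : ℕ} (hs : s ≠ 0)
    (hF : DiffContOnCl ℂ F (Metric.ball 0 1)) : avg (fun z => z ^ s * F z) = 0 := by
  have h : DiffContOnCl ℂ (fun z => z ^ s * F z) (Metric.ball 0 |1|) := by
    rw [abs_one]
    exact (differentiable_id.pow s).diffContOnCl.smul hF
  rw [avg, h.circleAverage]
  simp [hs]

theorem diffContOnCl_div {a : ℂ[X]} (ha : ∀ w, ‖w‖ ≤ 1 → a.eval w ≠ 0) (b : ℂ[X]) :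
    DiffContOnCl ℂ (fun w => b.eval w / a.eval w) (Metric.ball 0 1) := by
  simp_rw [div_eq_mul_inv]
  refine (b.differentiable.diffContOnCl).smul (a.differentiable.diffContOnCl.inv fun w hw => ?_)
  rw [closure_ball _ one_ne_zero] at hw
  exact ha w (by simpa using hw)

/-- The moments of positive order of a function that is holomorphic on the disk vanish. -/
theorem avg_pow_mul_div {a : ℂ[X]} (ha : ∀ w, ‖w‖ ≤ 1 → a.eval w ≠ 0) (b : ℂ[X]) {s : ℕ}
    (hs : s ≠ 0) : avg (fun w => w ^ s * (b.eval w / a.eval w)) = 0 :=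
  avg_pow_mul_eq_zero hs (diffContOnCl_div ha b)

theorem conj_eq_inv {z : ℂ} (hz : ‖z‖ = 1) : conj z = z⁻¹ :=
  eq_inv_of_mul_eq_one_right (PositiveForm.mul_conj_eq_one hz)

theorem avg_zpow (j : ℤ) : avg (fun z => z ^ j) = if j = 0 then 1 else 0 := by
  have hpos : ∀ s : ℕ, s ≠ 0 → avg (fun z => z ^ s) = 0 := fun s hs => by
    simpa using avg_pow_mul_div (a := 1) (by simp) 1 hs
  obtain ⟨s, rfl | rfl⟩ := j.eq_nat_or_neg
  · rcases eq_or_ne s 0 with rfl | hs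
    · simp [avg_const]
    · simp [hs, hpos s hs]
  · rcases eq_or_ne s 0 with rfl | hs
    · simp [avg_const]
    · rw [avg_congr (G := fun z => conj (z ^ s)), avg_conj, hpos s hs]
      · simp [hs]
      · intro z hz
        rw [map_pow, conj_eq_inv hz, zpow_neg, zpow_natCast, inv_pow]

theorem re_avg (F : ℂ → ℂ) (hF : CircleCont F) :
    (avg F).re = (2 * Real.pi)⁻¹ * ∫ θ in (0 : ℝ)..2 * Real.pi, (F (circleMap 0 1 θ)).re := by
  have := Complex.reCLM.intervalIntegral_comp_comm
    (hF.circleIntegrable : IntervalIntegrable (fun θ => F (circleMap 0 1 θ)) _ 0 (2 * Real.pi))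
  rw [avg, Real.circleAverage, Complex.real_smul, Complex.re_ofReal_mul]
  exact congrArg _ this.symm

theorem re_avg_mono (hF : CircleCont F) (hG : CircleCont G)
    (h : ∀ z, ‖z‖ = 1 → (F z).re ≤ (G z).re) : (avg F).re ≤ (avg G).re := by
  rw [re_avg F hF, re_avg G hG]
  refine mul_le_mul_of_nonneg_left ?_ (by positivity)
  exact intervalIntegral.integral_mono (by positivity)
    ((Complex.continuous_re.comp hF).intervalIntegrable _ _)
    ((Complex.continuous_re.comp hG).intervalIntegrable _ _) fun θ => h _ (norm_circleMap θ)

theorem re_avg_pos (hF : CircleCont F) (h : ∀ z, ‖z‖ = 1 → 0 ≤ (F z).re)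
    (h' : ∃ z, ‖z‖ = 1 ∧ 0 < (F z).re) : 0 < (avg F).re := by
  rw [re_avg F hF]
  refine mul_pos (by positivity) ?_
  obtain ⟨z, hz, hpos⟩ := h'
  have : z ∈ circleMap 0 1 '' Set.Ioc 0 (2 * Real.pi) := by
    rw [image_circleMap_Ioc]; simpa using hz
  obtain ⟨θ, hθ, rfl⟩ := this
  exact intervalIntegral.integral_pos (by positivity) (Complex.continuous_re.comp hF).continuousOn
    (fun θ _ => h _ (norm_circleMap θ)) ⟨θ, Set.Ioc_subset_Icc_self hθ, hpos⟩

end avg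

/-- The Fourier coefficients of a function on the unit circle. -/
def fc (F : ℂ → ℂ) (j : ℤ) : ℂ := avg fun z => z ^ (-j) * F z

/-- Gives access to Parseval's identity. -/
theorem fc_eq_fourierCoeffOn (F : ℂ → ℂ) (j : ℤ) :
    fc F j = fourierCoeffOn (a := 0) (b := 2 * Real.pi) (by positivity)
      (fun θ => F (circleMap 0 1 θ)) j := by
  rw [fourierCoeffOn_eq_integral, fc, avg, Real.circleAverage, one_div, sub_zero]
  congr 2
  funext θ
  rw [fourier_coe_apply, smul_eq_mul]
  congr 1
  simp only [circleMap, zero_add, Complex.ofReal_one, one_mul]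
  rw [← Complex.exp_int_mul]
  congr 1
  push_cast
  have : (Real.pi : ℂ) ≠ 0 := by exact_mod_cast Real.pi_ne_zero
  field_simp

theorem hasSum_sq_fc {F : ℂ → ℂ} (hF : CircleCont F) :
    HasSum (fun j => ‖fc F j‖ ^ 2)
      ((2 * Real.pi)⁻¹ * ∫ θ in (0 : ℝ)..2 * Real.pi, ‖F (circleMap 0 1 θ)‖ ^ 2) := by
  have hpi : (0 : ℝ) < 2 * Real.pi := by positivity
  have := hasSum_sq_fourierCoeffOn (f := fun θ => F (circleMap 0 1 θ)) hpi (by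
    obtain ⟨C, hC⟩ := (isCompact_Icc (a := (0 : ℝ)) (b := 2 * Real.pi)).exists_bound_of_continuousOn
      (Continuous.continuousOn hF)
    refine MeasureTheory.MemLp.of_bound (Continuous.aestronglyMeasurable hF) C ?_
    refine (MeasureTheory.ae_restrict_iff' measurableSet_Ioc).2 (Filter.Eventually.of_forall ?_)
    exact fun θ hθ => hC θ (Set.Ioc_subset_Icc_self hθ))
  simp_rw [← fc_eq_fourierCoeffOn] at this
  simpa using this

theorem hasSum_sq_fc' {F : ℂ → ℂ} (hF : CircleCont F) :
    HasSum (fun j => ‖fc F j‖ ^ 2) (avg fun z => F z * conj (F z)).re := by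
  convert! hasSum_sq_fc hF using 1
  rw [re_avg _ (hF.mul hF.conjugate)]
  simp_rw [Complex.mul_conj, Complex.ofReal_re, Complex.normSq_eq_norm_sq]

/-- Square summability forces decay. The Toeplitz argument uses no more than this. -/
theorem tendsto_fc {F : ℂ → ℂ} (hF : CircleCont F) :
    Filter.Tendsto (fc F) Filter.cofinite (nhds 0) := by
  have h := (hasSum_sq_fc hF).summable.tendsto_cofinite_zero
  rw [tendsto_zero_iff_norm_tendsto_zero]
  have h2 := h.sqrt
  simpa [Real.sqrt_sq (norm_nonneg _)] using h2

theorem fc_add {F G : ℂ → ℂ} (hF : CircleCont F) (hG : CircleCont G) (j : ℤ) :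
    fc (fun z => F z + G z) j = fc F j + fc G j := by
  simp only [fc, mul_add]
  exact avg_add ((CircleCont.zpow _).mul hF) ((CircleCont.zpow _).mul hG)

theorem fc_const_mul (c : ℂ) (F : ℂ → ℂ) (j : ℤ) : fc (fun z => c * F z) j = c * fc F j := by
  simp only [fc, mul_left_comm _ c]
  exact avg_const_mul c _

theorem fc_sum {ι : Type*} {s : Finset ι} {F : ι → ℂ → ℂ} (h : ∀ i ∈ s, CircleCont (F i)) (j : ℤ) :
    fc (fun z => ∑ i ∈ s, F i z) j = ∑ i ∈ s, fc (F i) j := by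
  simp only [fc, Finset.mul_sum]
  exact avg_sum fun i hi => (CircleCont.zpow _).mul (h i hi)

theorem fc_zpow_mul (t : ℤ) (F : ℂ → ℂ) (j : ℤ) : fc (fun z => z ^ t * F z) j = fc F (j - t) := by
  refine avg_congr fun z hz => ?_
  rw [← mul_assoc, ← zpow_add₀ (PositiveForm.ne_zero_of_norm_eq_one hz), neg_sub, sub_eq_neg_add]

theorem fc_pow_mul (t : ℕ) (F : ℂ → ℂ) (j : ℤ) : fc (fun z => z ^ t * F z) j = fc F (j - t) := by
  simpa using fc_zpow_mul t F j

theorem fc_congr {F G : ℂ → ℂ} (h : ∀ z, ‖z‖ = 1 → F z = G z) (j : ℤ) : fc F j = fc G j :=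
  avg_congr fun z hz => by rw [h z hz]

/-- Functions with disjoint Fourier spectra are orthogonal. -/
theorem avg_mul_conj_eq_zero {F G : ℂ → ℂ} (hF : CircleCont F) (hG : CircleCont G)
    (h : ∀ j, fc F j = 0 ∨ fc G j = 0) : avg (fun z => F z * conj (G z)) = 0 := by
  have hFG := hF.mul hG.conjugate
  -- Disjoint spectra make `‖F + c G‖² = ‖F‖² + ‖c G‖²` by Parseval, so the cross term has real part
  -- zero. The choices `c = 1` and `c = I` then give its real and imaginary parts.
  have key : ∀ c : ℂ, (conj c * avg (fun z => F z * conj (G z))).re = 0 := by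
    intro c
    have hcG := hG.const_mul c
    have h1 := hasSum_sq_fc' (hF.add hcG)
    have h2 := (hasSum_sq_fc' hF).add (hasSum_sq_fc' hcG)
    have h3 : (fun j => ‖fc (fun z => F z + c * G z) j‖ ^ 2) =
        fun j => ‖fc F j‖ ^ 2 + ‖fc (fun z => c * G z) j‖ ^ 2 := by
      funext j
      rw [fc_add hF hcG, fc_const_mul]
      rcases h j with h | h <;> simp [h]
    rw [h3] at h1
    have h4 := h1.unique h2
    have h5 : avg (fun z => (F z + c * G z) * conj (F z + c * G z)) =
        avg (fun z => F z * conj (F z)) + avg (fun z => (c * G z) * conj (c * G z)) +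
          (conj c * avg (fun z => F z * conj (G z)) +
            conj (conj c * avg (fun z => F z * conj (G z)))) := by
      rw [← avg_const_mul, ← avg_conj, ← avg_add (hFG.const_mul _) (hFG.const_mul _).conjugate,
        ← avg_add (hF.mul hF.conjugate) (hcG.mul hcG.conjugate),
        ← avg_add ((hF.mul hF.conjugate).add (hcG.mul hcG.conjugate))
          ((hFG.const_mul _).add (hFG.const_mul _).conjugate)]
      congr 1
      funext z
      simp only [map_add, map_mul, Complex.conj_conj]
      ring
    rw [h5] at h4
    simp only [Complex.add_re, Complex.conj_re] at h4
    linarith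
  have h1 := key 1
  have h2 := key Complex.I
  apply Complex.ext
  · simpa using h1
  · simpa using h2

/-! ### Orthogonality with respect to `1 / |a|²` on the unit circle -/

/-- The polynomial `w ^ m * f̄(1 / w)`. -/
def crev (m : ℕ) (f : ℂ[X]) : ℂ[X] :=
  ∑ i ∈ Finset.range (m + 1), Polynomial.monomial i (conj (f.coeff (m - i)))

theorem coeff_crev (m : ℕ) (f : ℂ[X]) (j : ℕ) :
    (crev m f).coeff j = if j ≤ m then conj (f.coeff (m - j)) else 0 := by
  simp [crev, Polynomial.coeff_monomial]

theorem eval_crev_of_ne_zero {m : ℕ} {f : ℂ[X]} (hf : f.natDegree ≤ m) {w : ℂ} (hw : w ≠ 0) :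
    (crev m f).eval w = w ^ m * conj (f.eval (conj w)⁻¹) := by
  rw [crev, Polynomial.eval_finsetSum, Polynomial.eval_eq_sum_range' (Nat.lt_succ_of_le hf),
    map_sum, Finset.mul_sum, ← Finset.sum_range_reflect]
  refine Finset.sum_congr rfl fun i hi => ?_
  rw [Finset.mem_range, Nat.lt_succ_iff] at hi
  obtain ⟨j, rfl⟩ := Nat.exists_eq_add_of_le hi
  have e1 : i + j + 1 - 1 - i = j := by omega
  have e2 : i + j - j = i := by omega
  have e3 : w ^ i * w⁻¹ ^ i = 1 := by rw [← mul_pow, mul_inv_cancel₀ hw, one_pow]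
  rw [e1, Polynomial.eval_monomial, e2, map_mul, map_pow, map_inv₀, Complex.conj_conj, pow_add]
  linear_combination (-conj (f.coeff i) * w ^ j) * e3

theorem eval_crev {m : ℕ} {f : ℂ[X]} (hf : f.natDegree ≤ m) {w : ℂ} (hw : ‖w‖ = 1) :
    (crev m f).eval w = w ^ m * conj (f.eval w) := by
  rw [eval_crev_of_ne_zero hf (PositiveForm.ne_zero_of_norm_eq_one hw),
    PositiveForm.inv_conj_of_norm_eq_one hw]

/-- The inner product of `L²` of the measure with density `1 / |a|²`. -/
def ip (a f g : ℂ[X]) : ℂ := avg fun w => f.eval w * conj (g.eval w) / (a.eval w * conj (a.eval w))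

section ip

variable {a : ℂ[X]} (ha : ∀ w, ‖w‖ ≤ 1 → a.eval w ≠ 0)

include ha

theorem mul_conj_ne_zero {w : ℂ} (hw : ‖w‖ = 1) : a.eval w * conj (a.eval w) ≠ 0 :=
  mul_ne_zero (ha w hw.le) ((map_ne_zero _).2 (ha w hw.le))

theorem circleCont_ip (f g : ℂ[X]) :
    CircleCont fun w => f.eval w * conj (g.eval w) / (a.eval w * conj (a.eval w)) :=
  ((CircleCont.polynomial f).mul (CircleCont.polynomial g).conjugate).div
    ((CircleCont.polynomial a).mul (CircleCont.polynomial a).conjugate) fun _ hw => mul_conj_ne_zero ha hw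

theorem ip_add_left (f f' g : ℂ[X]) : ip a (f + f') g = ip a f g + ip a f' g := by
  rw [ip, ip, ip, ← avg_add (circleCont_ip ha f g) (circleCont_ip ha f' g)]
  congr 1; funext w; rw [Polynomial.eval_add]; ring

theorem ip_add_right (f g g' : ℂ[X]) : ip a f (g + g') = ip a f g + ip a f g' := by
  rw [ip, ip, ip, ← avg_add (circleCont_ip ha f g) (circleCont_ip ha f g')]
  congr 1; funext w; rw [Polynomial.eval_add, map_add]; ring

omit ha in
theorem ip_smul_left (c : ℂ) (f g : ℂ[X]) : ip a (c • f) g = c * ip a f g := by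
  rw [ip, ip, ← avg_const_mul]
  congr 1; funext w; rw [Polynomial.eval_smul, smul_eq_mul]; ring

omit ha in
theorem ip_smul_right (c : ℂ) (f g : ℂ[X]) : ip a f (c • g) = conj c * ip a f g := by
  rw [ip, ip, ← avg_const_mul]
  congr 1; funext w; rw [Polynomial.eval_smul, smul_eq_mul, map_mul]; ring

omit ha in
theorem conj_ip (f g : ℂ[X]) : conj (ip a f g) = ip a g f := by
  rw [ip, ip, ← avg_conj]
  congr 1; funext w; simp only [map_div₀, map_mul, Complex.conj_conj]
  rw [mul_comm (conj (f.eval w)), mul_comm (conj (a.eval w))]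

theorem ip_sum_left {ι : Type*} (s : Finset ι) (f : ι → ℂ[X]) (g : ℂ[X]) :
    ip a (∑ i ∈ s, f i) g = ∑ i ∈ s, ip a (f i) g := by
  classical
  induction s using Finset.induction_on with
  | empty => simp [ip, avg_const]
  | insert i s hi ih => rw [Finset.sum_insert hi, Finset.sum_insert hi, ip_add_left ha, ih]

theorem ip_sum_right {ι : Type*} (s : Finset ι) (f : ℂ[X]) (g : ι → ℂ[X]) :
    ip a f (∑ i ∈ s, g i) = ∑ i ∈ s, ip a f (g i) := by
  rw [← conj_ip, ip_sum_left ha, map_sum]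
  exact Finset.sum_congr rfl fun i _ => conj_ip _ _

theorem ip_self_pos {f : ℂ[X]} (hf : f ≠ 0) : 0 < (ip a f f).re := by
  have hre : ∀ w, (f.eval w * conj (f.eval w) / (a.eval w * conj (a.eval w))).re =
      ‖f.eval w‖ ^ 2 / ‖a.eval w‖ ^ 2 := fun w => by
    rw [Complex.mul_conj, Complex.mul_conj, Complex.normSq_eq_norm_sq, Complex.normSq_eq_norm_sq,
      ← Complex.ofReal_div, Complex.ofReal_re]
  refine re_avg_pos (circleCont_ip ha f f) (fun w _ => by rw [hre]; positivity) ?_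
  by_contra! h
  refine hf (Polynomial.eq_zero_of_infinite_isRoot _ (Set.Infinite.mono (s := Metric.sphere 0 1)
    (fun w hw => ?_) ?_))
  · have hw' : ‖w‖ = 1 := by simpa using hw
    have := h w hw'
    rw [hre] at this
    have h1 : 0 < ‖a.eval w‖ ^ 2 := pow_pos (norm_pos_iff.2 (ha w hw'.le)) 2
    by_contra hne
    have h2 : 0 < ‖f.eval w‖ ^ 2 := pow_pos (norm_pos_iff.2 hne) 2
    exact absurd this (not_le.2 (div_pos h2 h1))
  · have e := image_circleMap_Ioc (0 : ℂ) 1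
    rw [abs_one] at e
    rw [← e]
    have hpi : (0 : ℝ) ≤ 2 * Real.pi := by positivity
    have hinj := injOn_circleMap_of_abs_sub_le (a := 0) (b := 2 * Real.pi) (c := 0)
      (one_ne_zero (α := ℝ)) (by rw [zero_sub, abs_neg, abs_of_nonneg hpi])
    rw [Set.uIoc_of_le hpi] at hinj
    exact Set.Infinite.image hinj (Set.Ioc_infinite (by positivity))

omit ha in
theorem ip_X_mul (f g : ℂ[X]) : ip a (Polynomial.X * f) (Polynomial.X * g) = ip a f g := by
  refine avg_congr fun w hw => ?_
  simp only [Polynomial.eval_mul, Polynomial.eval_X, map_mul]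
  have := PositiveForm.mul_conj_eq_one hw
  congr 1
  linear_combination (f.eval w * conj (g.eval w)) * this

/-- After conjugation the integrand is `w g / a`, holomorphic in the disk with a zero at the origin.
Thus `a` is orthogonal to all multiples of `w`. -/
theorem ip_self_X_mul (g : ℂ[X]) : ip a a (Polynomial.X * g) = 0 := by
  rw [← conj_ip, map_eq_zero, ip, ← avg_pow_mul_div ha g one_ne_zero]
  refine avg_congr fun w hw => ?_
  have h1 := ha w hw.le
  have h2 := (map_ne_zero (starRingEnd ℂ)).2 h1
  simp only [Polynomial.eval_mul, Polynomial.eval_X]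
  field_simp

theorem ip_self_self : ip a a a = 1 := by
  rw [ip, ← avg_const 1]
  exact avg_congr fun w hw => div_self (mul_conj_ne_zero ha hw)

/-- The reproducing property of the Christoffel-Darboux kernel. -/
theorem avg_mul_conj_kernel {m : ℕ} {f : ℂ[X]} (hf : f.natDegree ≤ m) {η c : ℂ} (hη : ‖η‖ < 1)
    {K : ℂ → ℂ} (hK : ∀ w, ‖w‖ = 1 → (1 - w * conj η) * K w =
      a.eval w * conj (a.eval η) - w * conj η * (w ^ m * conj (a.eval w)) * c) :
    avg (fun w => f.eval w * conj (K w) / (a.eval w * conj (a.eval w))) = f.eval η := by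
  set b : ℂ[X] := 1 - Polynomial.C (conj η) * Polynomial.X with hb
  have hb0 : ∀ w, ‖w‖ ≤ 1 → b.eval w ≠ 0 := by
    intro w hw h
    have h1 : conj η * w = 1 := by
      simp only [hb, Polynomial.eval_sub, Polynomial.eval_one, Polynomial.eval_mul,
        Polynomial.eval_C, Polynomial.eval_X] at h
      exact (sub_eq_zero.1 h).symm
    have h2 := congrArg norm h1
    rw [norm_mul, RCLike.norm_conj, norm_one] at h2
    nlinarith [norm_nonneg η, norm_nonneg w]
  have hab : ∀ w, ‖w‖ ≤ 1 → (a * b).eval w ≠ 0 := fun w hw => by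
    rw [Polynomial.eval_mul]; exact mul_ne_zero (ha w hw) (hb0 w hw)
  set q : ℂ[X] := Polynomial.C (conj η * c) * crev m f with hq
  -- Solving for `K` by division by `1 - w η̄` splits the integrand into a Cauchy kernel applied to
  -- `f / a`, and the conjugate of a holomorphic function that vanishes at the origin and so has
  -- mean zero. The bound on the degree of `f` is needed to write `w ^ m` times the conjugate of `f`
  -- as a polynomial on the circle.
  have hsplit : ∀ w, ‖w‖ = 1 → f.eval w * conj (K w) / (a.eval w * conj (a.eval w)) =
      a.eval η * ((w - 0) / (w - η) * (f.eval w / a.eval w)) -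
        conj (w ^ 1 * (q.eval w / (a * b).eval w)) := by
    intro w hw
    have h1 := ha w hw.le
    have h2 := (map_ne_zero (starRingEnd ℂ)).2 h1
    have hw0 := PositiveForm.ne_zero_of_norm_eq_one hw
    have hbw : b.eval w = 1 - w * conj η := by
      simp only [hb, Polynomial.eval_sub, Polynomial.eval_one, Polynomial.eval_mul, Polynomial.eval_C,
        Polynomial.eval_X]
      ring
    have h3 : 1 - w * conj η ≠ 0 := hbw ▸ hb0 w hw.le
    have h4 : 1 - w⁻¹ * η ≠ 0 := by
      have := (map_ne_zero (starRingEnd ℂ)).2 h3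
      simpa only [map_sub, map_mul, map_one, map_pow, Complex.conj_conj, conj_eq_inv hw] using this
    have h5 : w - η ≠ 0 := by
      intro h; apply h4; rw [← sub_eq_zero.1 h]; field_simp; ring
    have hK' : (1 - w⁻¹ * η) * conj (K w) =
        conj (a.eval w) * a.eval η - w⁻¹ * η * (w⁻¹ ^ m * a.eval w) * conj c := by
      have := congrArg (starRingEnd ℂ) (hK w hw)
      simpa only [map_sub, map_mul, map_one, map_pow, Complex.conj_conj, conj_eq_inv hw] using this
    have hKK : conj (K w) = (conj (a.eval w) * a.eval η -
        w⁻¹ * η * (w⁻¹ ^ m * a.eval w) * conj c) / (1 - w⁻¹ * η) := by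
      rw [← hK', mul_div_cancel_left₀ _ h4]
    have e1 : (a * b).eval w = a.eval w * (1 - w * conj η) := by rw [Polynomial.eval_mul, hbw]
    have e2 : q.eval w = conj η * c * (w ^ m * conj (f.eval w)) := by
      rw [hq, Polynomial.eval_mul, Polynomial.eval_C, eval_crev hf hw]
    rw [e1, e2, hKK]
    simp only [map_mul, map_div₀, map_sub, map_one, map_pow, Complex.conj_conj, conj_eq_inv hw,
      sub_zero, pow_one]
    have h6 : (w - 0) / (w - η) = 1 / (1 - w⁻¹ * η) := by
      rw [sub_zero, div_eq_div_iff h5 h4]; field_simp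
    rw [sub_zero] at h6
    rw [h6]
    field_simp
  rw [avg_congr hsplit, avg_sub, avg_const_mul, avg_conj, avg_pow_mul_div hab q one_ne_zero,
    map_zero, sub_zero]
  · have h := (diffContOnCl_div ha f)
    have := DiffContOnCl.circleAverage_smul_div (f := fun w => f.eval w / a.eval w) (R := 1)
      (c := 0) (w := η) (by rwa [abs_one]) (by simpa using hη)
    simp only [smul_eq_mul] at this
    rw [avg, this, mul_div_cancel₀]
    exact ha η hη.le
  · refine CircleCont.const_mul _ (CircleCont.mul (CircleCont.div
      (CircleCont.of_continuous (by fun_prop)) (CircleCont.of_continuous (by fun_prop)) ?_)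
      ((CircleCont.polynomial f).div (CircleCont.polynomial a) fun w hw => ha w hw.le))
    intro w hw h
    rw [sub_eq_zero.1 h] at hw
    linarith
  · exact ((CircleCont.pow 1).mul ((CircleCont.polynomial q).div (CircleCont.polynomial _)
      fun w hw => hab w hw.le)).conjugate

end ip

end

end BernsteinSzego

namespace BernsteinSzego

noncomputable section

open scoped Polynomial ComplexConjugate InnerProductSpace

/-! ### The inner product of `L²` of the measure with density `1 / |p|²` on the torus -/

/-- The inner product of `L²` of the measure with density `1 / |p|²` on the torus. -/
def bs (p f g : Poly2) : ℂ := avg fun z => ip (slice z p) (slice z f) (slice z g)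

theorem NoZerosOnFace.slice_ne_zero {p : Poly2} (hp : NoZerosOnFace p) {z : ℂ} (hz : ‖z‖ = 1) :
    ∀ w, ‖w‖ ≤ 1 → (slice z p).eval w ≠ 0 := fun w hw => by
  rw [eval_slice]; exact hp z w hz hw

theorem continuous_eval_slice (f : Poly2) :
    Continuous fun x : ℂ × ℂ => (slice x.1 f).eval x.2 := by
  simp_rw [eval_slice]
  refine (MvPolynomial.continuous_eval f).comp (continuous_pi fun i => ?_)
  fin_cases i
  · exact continuous_fst
  · exact continuous_snd

theorem circleCont_avg {F : ℂ → ℂ → ℂ}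
    (hF : Continuous fun x : ℝ × ℝ => F (circleMap 0 1 x.1) (circleMap 0 1 x.2)) :
    CircleCont fun z => avg (F z) := by
  refine Continuous.const_smul (M := ℝ) ?_ _
  exact intervalIntegral.continuous_parametric_intervalIntegral_of_continuous'
    (f := fun θ φ => F (circleMap 0 1 θ) (circleMap 0 1 φ)) hF 0 (2 * Real.pi)

theorem circleCont_bs {p : Poly2} (hp : NoZerosOnFace p) (f g : Poly2) :
    CircleCont fun z => ip (slice z p) (slice z f) (slice z g) := by
  have h : ∀ f : Poly2, Continuous fun x : ℝ × ℝ =>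
      (slice (circleMap 0 1 x.1) f).eval (circleMap 0 1 x.2) := fun f =>
    (continuous_eval_slice f).comp (((continuous_circleMap 0 1).comp continuous_fst).prodMk
      ((continuous_circleMap 0 1).comp continuous_snd))
  refine circleCont_avg (F := fun z w => (slice z f).eval w * conj ((slice z g).eval w) /
    ((slice z p).eval w * conj ((slice z p).eval w))) ?_
  refine Continuous.div ((h f).mul (Complex.continuous_conj.comp (h g)))
    ((h p).mul (Complex.continuous_conj.comp (h p))) fun x => ?_
  exact mul_conj_ne_zero (hp.slice_ne_zero (norm_circleMap _)) (norm_circleMap _)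

variable {p : Poly2}

theorem bs_add_left (hp : NoZerosOnFace p) (f f' g : Poly2) :
    bs p (f + f') g = bs p f g + bs p f' g := by
  rw [bs, bs, bs, ← avg_add (circleCont_bs hp f g) (circleCont_bs hp f' g)]
  refine avg_congr fun z hz => ?_
  rw [slice_add, ip_add_left (hp.slice_ne_zero hz)]

theorem conj_bs (f g : Poly2) : conj (bs p f g) = bs p g f := by
  rw [bs, bs, ← avg_conj]
  simp_rw [conj_ip]

theorem bs_add_right (hp : NoZerosOnFace p) (f g g' : Poly2) :
    bs p f (g + g') = bs p f g + bs p f g' := by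
  rw [← conj_bs, bs_add_left hp, map_add, conj_bs, conj_bs]

theorem bs_smul_left (c : ℂ) (f g : Poly2) : bs p (c • f) g = c * bs p f g := by
  rw [bs, bs, ← avg_const_mul]
  simp_rw [slice_smul, ip_smul_left]

theorem bs_smul_right (c : ℂ) (f g : Poly2) : bs p f (c • g) = conj c * bs p f g := by
  rw [← conj_bs, bs_smul_left, map_mul, conj_bs]

theorem bs_zero_left (g : Poly2) : bs p 0 g = 0 := by
  simpa using bs_smul_left (p := p) 0 0 g

theorem bs_zero_right (g : Poly2) : bs p g 0 = 0 := by
  simpa using bs_smul_right (p := p) 0 g 0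

theorem bs_X0_mul (f g : Poly2) :
    bs p (MvPolynomial.X 0 * f) (MvPolynomial.X 0 * g) = bs p f g := by
  refine avg_congr fun z hz => ?_
  simp only [slice_mul, slice_X0, ← Polynomial.smul_eq_C_mul, ip_smul_left, ip_smul_right]
  rw [← mul_assoc, mul_comm (conj z) z, PositiveForm.mul_conj_eq_one hz, one_mul]

/-- On the torus, reversal is conjugation followed by multiplication by the unimodular function `z ^
n w ^ m`. -/
theorem bs_rev {n m : ℕ} {f g : Poly2} (hf : f ∈ polySpace n m) (hg : g ∈ polySpace n m) :
    bs p (rev n m f) (rev n m g) = bs p g f := by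
  refine avg_congr fun z hz => avg_congr fun w hw => ?_
  have hz0 := PositiveForm.ne_zero_of_norm_eq_one hz
  have hw0 := PositiveForm.ne_zero_of_norm_eq_one hw
  simp only [eval_slice]
  rw [eval_rev hf hz0 hw0, eval_rev hg hz0 hw0, PositiveForm.inv_conj_of_norm_eq_one hz,
    PositiveForm.inv_conj_of_norm_eq_one hw]
  simp only [map_mul, map_pow, Complex.conj_conj]
  have h1 : z ^ n * conj z ^ n = 1 := by rw [← mul_pow, PositiveForm.mul_conj_eq_one hz, one_pow]
  have h2 : w ^ m * conj w ^ m = 1 := by rw [← mul_pow, PositiveForm.mul_conj_eq_one hw, one_pow]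
  have h3 : z ^ n * conj z ^ n * (w ^ m * conj w ^ m) = 1 := by rw [h1, h2, mul_one]
  congr 1
  linear_combination (conj (MvPolynomial.eval ![z, w] f) * MvPolynomial.eval ![z, w] g) * h3

theorem bs_monomial (s t s' t' : ℕ) :
    bs p (MvPolynomial.X 0 ^ s * MvPolynomial.X 1 ^ t)
      (MvPolynomial.X 0 ^ s' * MvPolynomial.X 1 ^ t') =
    1 / (2 * (Real.pi : ℂ)) ^ 2 *
      ∫ θ in (0 : ℝ)..(2 * Real.pi), ∫ φ in (0 : ℝ)..(2 * Real.pi),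
        Complex.exp (θ * Complex.I) ^ ((s : ℤ) - s') * Complex.exp (φ * Complex.I) ^ ((t : ℤ) - t') /
          ((‖MvPolynomial.eval ![Complex.exp (θ * Complex.I), Complex.exp (φ * Complex.I)] p‖ ^ 2
            : ℝ) : ℂ) := by
  have key : ∀ z w : ℂ, ‖z‖ = 1 → ‖w‖ = 1 →
      (slice z (MvPolynomial.X 0 ^ s * MvPolynomial.X 1 ^ t)).eval w *
        conj ((slice z (MvPolynomial.X 0 ^ s' * MvPolynomial.X 1 ^ t')).eval w) /
        ((slice z p).eval w * conj ((slice z p).eval w)) =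
      z ^ ((s : ℤ) - s') * w ^ ((t : ℤ) - t') / ((‖MvPolynomial.eval ![z, w] p‖ ^ 2 : ℝ) : ℂ) := by
    intro z w hz hw
    have hz0 := PositiveForm.ne_zero_of_norm_eq_one hz
    have hw0 := PositiveForm.ne_zero_of_norm_eq_one hw
    rw [Complex.mul_conj, Complex.normSq_eq_norm_sq, eval_slice z w p]
    congr 1
    simp only [slice_mul, slice_pow, slice_X0, slice_X1, Polynomial.eval_mul, Polynomial.eval_pow,
      Polynomial.eval_C, Polynomial.eval_X, map_mul, map_pow, conj_eq_inv hz, conj_eq_inv hw]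
    rw [zpow_sub₀ hz0, zpow_sub₀ hw0]
    simp only [zpow_natCast, inv_pow]
    field_simp
  have hbs : bs p (MvPolynomial.X 0 ^ s * MvPolynomial.X 1 ^ t)
      (MvPolynomial.X 0 ^ s' * MvPolynomial.X 1 ^ t') =
      avg fun z => avg fun w => z ^ ((s : ℤ) - s') * w ^ ((t : ℤ) - t') /
        ((‖MvPolynomial.eval ![z, w] p‖ ^ 2 : ℝ) : ℂ) :=
    avg_congr fun z hz => avg_congr fun w hw => key z w hz hw
  rw [hbs]
  simp only [avg, Real.circleAverage, circleMap, zero_add, Complex.ofReal_one, one_mul]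
  rw [intervalIntegral.integral_smul]
  simp only [Complex.real_smul]
  push_cast
  ring

namespace PositiveForm

variable {n m : ℕ} (τ : PositiveForm n m)

/-- The moments of `τ` are those of the measure with density `1 / |p|²` if and only if the inner
products agree. -/
theorem hasBernsteinSzegoMoments_iff (hp : NoZerosOnFace p) :
    τ.HasBernsteinSzegoMoments p ↔ ∀ f g : τ.H, ⟪g, f⟫_ℂ = bs p (τ.incl f) (τ.incl g) := by
  have hmono : ∀ {s t s' t' : ℕ} (f g : τ.H) (hs : |(s : ℤ) - s'| ≤ n) (ht : |(t : ℤ) - t'| ≤ m),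
      τ.incl f = MvPolynomial.X 0 ^ s * MvPolynomial.X 1 ^ t →
      τ.incl g = MvPolynomial.X 0 ^ s' * MvPolynomial.X 1 ^ t' →
      ⟪g, f⟫_ℂ = τ.moment ((s : ℤ) - s') ((t : ℤ) - t') hs ht := by
    intro s t s' t' f g hs ht hf hg
    rw [inner_eq]
    refine congrArg τ.form (Subtype.ext ?_)
    change toLaurent (τ.incl f) * conjInv (τ.incl g) = _
    rw [hf, hg, toLaurent_monomial, conjInv_monomial, mono_mul]
    rfl
  constructor
  · intro h f g
    have ind : ∀ (f : Poly2) (hf : f ∈ polySpace n m) (g : Poly2) (hg : g ∈ polySpace n m),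
        ⟪τ.ofPoly g hg, τ.ofPoly f hf⟫_ℂ = bs p f g := by
      intro f hf
      induction hf using Submodule.span_induction with
      | zero =>
        intro g hg
        rw [bs_zero_left]
        exact inner_zero_right _
      | add x y hx hy ihx ihy =>
        intro g hg
        rw [bs_add_left hp, ← ihx g hg, ← ihy g hg]
        exact inner_add_right _ (τ.ofPoly x hx) (τ.ofPoly y hy)
      | smul c x hx ihx =>
        intro g hg
        rw [bs_smul_left, ← ihx g hg]
        exact inner_smul_right _ (τ.ofPoly x hx) c
      | mem x hx =>
        intro g hg
        have hx' := hx
        obtain ⟨s, t, hs, ht, rfl⟩ := hx'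
        induction hg using Submodule.span_induction with
        | zero =>
          rw [bs_zero_right]
          exact inner_zero_left _
        | add u v hu hv ihu ihv =>
          rw [bs_add_right hp, ← ihu, ← ihv]
          exact inner_add_left (τ.ofPoly u hu) (τ.ofPoly v hv) _
        | smul c u hu ihu =>
          rw [bs_smul_right, ← ihu]
          exact inner_smul_left (τ.ofPoly u hu) _ c
        | mem u hu =>
          have hu' := hu
          obtain ⟨s', t', hs', ht', rfl⟩ := hu'
          have hj : |(s : ℤ) - s'| ≤ n := by rw [abs_le]; constructor <;> omega
          have hk : |(t : ℤ) - t'| ≤ m := by rw [abs_le]; constructor <;> omega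
          exact (hmono _ _ hj hk rfl rfl).trans (by rw [h _ _ hj hk, bs_monomial])
    have e : ∀ f, τ.ofPoly (τ.incl f) (τ.incl_mem f) = f := fun f => τ.incl_injective rfl
    have := ind _ (τ.incl_mem f) _ (τ.incl_mem g)
    rwa [e, e] at this
  · intro h j k hj hk
    rw [abs_le] at hj hk
    -- A moment of arbitrary sign pattern is an inner product of two monomials: split `j` and `k`
    -- into positive and negative parts, and give the positive parts to one factor and the negative
    -- parts to the other.
    have hs : (MvPolynomial.X 0 ^ j.toNat * MvPolynomial.X 1 ^ k.toNat : Poly2) ∈ polySpace n m :=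
      monomial_mem_polySpace (by omega) (by omega)
    have hs' : (MvPolynomial.X 0 ^ (-j).toNat * MvPolynomial.X 1 ^ (-k).toNat : Poly2) ∈
        polySpace n m := monomial_mem_polySpace (by omega) (by omega)
    have hj' : (j.toNat : ℤ) - ((-j).toNat : ℤ) = j := by omega
    have hk' : (k.toNat : ℤ) - ((-k).toNat : ℤ) = k := by omega
    have h1 := hmono (τ.ofPoly _ hs) (τ.ofPoly _ hs') (by rw [hj', abs_le]; omega)
      (by rw [hk', abs_le]; omega) rfl rfl
    rw [h, incl_ofPoly, incl_ofPoly, bs_monomial] at h1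
    simp only [hj', hk'] at h1
    exact h1.symm

end PositiveForm

end

end BernsteinSzego

/-! ### From a split to a Bernstein-Szegő polynomial. -/

namespace BernsteinSzego

noncomputable section

open scoped Polynomial

/-! ### Zeros of polynomials and growth -/

/-- If `q` vanished to higher order at `a`, dividing the bound by `|z - a| ^ (2 j)`, with `j` the
order of `f`, and letting `z → a` would leave a positive left side below `0`. -/
theorem rootMultiplicity_le_of_bound {q f : ℂ[X]} (hf : f ≠ 0) {a : ℂ} {h : ℂ → ℝ}
    (hc : Continuous h) (ha : 0 < h a) {C : ℝ}
    (hb : ∀ᶠ z in nhds a, h z * ‖f.eval z‖ ^ 2 ≤ C * ‖q.eval z‖ ^ 2) :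
    q.rootMultiplicity a ≤ f.rootMultiplicity a := by
  by_contra! hlt
  set j := f.rootMultiplicity a with hj
  obtain ⟨f₁, hf₁, hnd⟩ := Polynomial.exists_eq_pow_rootMultiplicity_mul_and_not_dvd f hf a
  have hf₁a : f₁.eval a ≠ 0 := fun h0 => hnd (Polynomial.dvd_iff_isRoot.2 h0)
  have hq : (Polynomial.X - Polynomial.C a) ^ (j + 1) ∣ q :=
    (pow_dvd_pow _ hlt).trans (Polynomial.pow_rootMultiplicity_dvd q a)
  obtain ⟨q₁, hq₁⟩ := hq
  have h1 : ∀ᶠ z in nhdsWithin a {a}ᶜ,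
      h z * ‖f₁.eval z‖ ^ 2 ≤ C * (‖z - a‖ ^ 2 * ‖q₁.eval z‖ ^ 2) := by
    filter_upwards [nhdsWithin_le_nhds hb, self_mem_nhdsWithin] with z hz hza
    have hza : z - a ≠ 0 := sub_ne_zero.2 hza
    have hpos : 0 < (‖z - a‖ ^ j) ^ 2 := by positivity
    rw [hf₁, hq₁] at hz
    simp only [← hj, Polynomial.eval_mul, Polynomial.eval_pow, Polynomial.eval_sub,
      Polynomial.eval_X, Polynomial.eval_C, norm_mul, norm_pow] at hz
    refine le_of_mul_le_mul_left ?_ hpos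
    calc _ = h z * (‖z - a‖ ^ j * ‖f₁.eval z‖) ^ 2 := by ring
      _ ≤ _ := hz
      _ = _ := by ring
  have h2 : Filter.Tendsto (fun z => h z * ‖f₁.eval z‖ ^ 2) (nhdsWithin a {a}ᶜ)
      (nhds (h a * ‖f₁.eval a‖ ^ 2)) :=
    ((hc.mul ((f₁.continuous.norm).pow 2)).tendsto a).mono_left nhdsWithin_le_nhds
  have h3 : Filter.Tendsto (fun z => C * (‖z - a‖ ^ 2 * ‖q₁.eval z‖ ^ 2)) (nhdsWithin a {a}ᶜ)
      (nhds (C * (‖a - a‖ ^ 2 * ‖q₁.eval a‖ ^ 2))) := by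
    have : Continuous fun z => C * (‖z - a‖ ^ 2 * ‖q₁.eval z‖ ^ 2) :=
      continuous_const.mul ((((continuous_id.sub continuous_const).norm).pow 2).mul
        ((q₁.continuous.norm).pow 2))
    exact (this.tendsto a).mono_left nhdsWithin_le_nhds
  have h4 := le_of_tendsto_of_tendsto h2 h3 h1
  rw [sub_self, norm_zero] at h4
  have : 0 < h a * ‖f₁.eval a‖ ^ 2 := mul_pos ha (pow_pos (norm_pos_iff.2 hf₁a) 2)
  nlinarith

/-- This is the same comparison of orders at infinity, seen at the origin after `z ↦ 1 / z`. The
growing weight `|z|² - 1` makes the inequality of degrees strict. -/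
theorem natDegree_lt_of_bound {q f : ℂ[X]} (hf : f ≠ 0) {C : ℝ}
    (hb : ∀ z, 1 < ‖z‖ → (‖z‖ ^ 2 - 1) * ‖f.eval z‖ ^ 2 ≤ C * ‖q.eval z‖ ^ 2) :
    f.natDegree < q.natDegree := by
  by_contra! hle
  set N := f.natDegree with hN
  have hrefl : ∀ (r : ℂ[X]), r.natDegree ≤ N → ∀ z : ℂ, z ≠ 0 →
      (r.reflect N).eval z = z ^ N * r.eval z⁻¹ := by
    intro r hr z hz
    have := invertibleOfNonzero (inv_ne_zero hz)
    have h := Polynomial.eval₂_reflect_mul_pow (RingHom.id ℂ) z⁻¹ N r hr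
    rw [invOf_eq_inv, inv_inv] at h
    change (r.reflect N).eval z * z⁻¹ ^ N = r.eval z⁻¹ at h
    rw [← h, inv_pow]
    field_simp
  have h1 : ∀ᶠ z in nhdsWithin (0 : ℂ) {0}ᶜ, (1 - ‖z‖ ^ 2) * ‖(f.reflect N).eval z‖ ^ 2 ≤
      C * (‖z‖ ^ 2 * ‖(q.reflect N).eval z‖ ^ 2) := by
    filter_upwards [nhdsWithin_le_nhds (Metric.ball_mem_nhds (0 : ℂ) one_pos),
      self_mem_nhdsWithin] with z hz hz0
    have hz0 : z ≠ 0 := hz0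
    have hn : 0 < ‖z‖ := norm_pos_iff.2 hz0
    have hlt : ‖z‖ < 1 := by simpa using hz
    rw [hrefl f le_rfl z hz0, hrefl q hle z hz0, norm_mul, norm_mul, norm_pow]
    have hb' := hb z⁻¹ (by rw [norm_inv]; exact (one_lt_inv₀ hn).2 hlt)
    rw [norm_inv] at hb'
    have hpos : 0 ≤ ‖z‖ ^ 2 * (‖z‖ ^ N) ^ 2 := by positivity
    have e : ‖z‖ ^ 2 * (‖z‖⁻¹ ^ 2 - 1) = 1 - ‖z‖ ^ 2 := by field_simp
    calc _ = (‖z‖ ^ 2 * (‖z‖ ^ N) ^ 2) * ((‖z‖⁻¹ ^ 2 - 1) * ‖f.eval z⁻¹‖ ^ 2) := by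
          rw [← e]; ring
      _ ≤ _ := mul_le_mul_of_nonneg_left hb' hpos
      _ = _ := by ring
  have h2 : Filter.Tendsto (fun z => (1 - ‖z‖ ^ 2) * ‖(f.reflect N).eval z‖ ^ 2)
      (nhdsWithin (0 : ℂ) {0}ᶜ) (nhds ((1 - ‖(0 : ℂ)‖ ^ 2) * ‖(f.reflect N).eval 0‖ ^ 2)) := by
    have : Continuous fun z : ℂ => (1 - ‖z‖ ^ 2) * ‖(f.reflect N).eval z‖ ^ 2 :=
      (continuous_const.sub (continuous_norm.pow 2)).mul (((Polynomial.continuous _).norm).pow 2)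
    exact (this.tendsto 0).mono_left nhdsWithin_le_nhds
  have h3 : Filter.Tendsto (fun z => C * (‖z‖ ^ 2 * ‖(q.reflect N).eval z‖ ^ 2))
      (nhdsWithin (0 : ℂ) {0}ᶜ) (nhds (C * (‖(0 : ℂ)‖ ^ 2 * ‖(q.reflect N).eval 0‖ ^ 2))) := by
    have : Continuous fun z : ℂ => C * (‖z‖ ^ 2 * ‖(q.reflect N).eval z‖ ^ 2) :=
      continuous_const.mul ((continuous_norm.pow 2).mul (((Polynomial.continuous _).norm).pow 2))
    exact (this.tendsto 0).mono_left nhdsWithin_le_nhds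
  have h4 := le_of_tendsto_of_tendsto h2 h3 h1
  have h5 : (f.reflect N).eval 0 = f.leadingCoeff := by
    rw [← Polynomial.coeff_zero_eq_eval_zero, Polynomial.coeff_reflect, Polynomial.revAt_zero]
    rfl
  rw [h5, norm_zero] at h4
  have : 0 < ‖f.leadingCoeff‖ ^ 2 := pow_pos (norm_pos_iff.2 (Polynomial.leadingCoeff_ne_zero.2 hf)) 2
  nlinarith

open Classical in
/-- The monic factor of `q` that collects the zeros in the open unit disk. -/
def innerPart (q : ℂ[X]) : ℂ[X] :=
  ((q.roots.filter fun z => ‖z‖ < 1).map fun a => Polynomial.X - Polynomial.C a).prod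

open Classical in
/-- The factor of `q` that collects the zeros outside of the open unit disk. -/
def outerPart (q : ℂ[X]) : ℂ[X] := Polynomial.C q.leadingCoeff *
  ((q.roots.filter fun z => ¬ ‖z‖ < 1).map fun a => Polynomial.X - Polynomial.C a).prod

theorem innerPart_mul_outerPart (q : ℂ[X]) : innerPart q * outerPart q = q := by
  classical
  rw [innerPart, outerPart, mul_left_comm, ← Multiset.prod_add, ← Multiset.map_add,
    Multiset.filter_add_not]
  exact Polynomial.C_leadingCoeff_mul_prod_multiset_X_sub_C
    IsAlgClosed.card_roots_eq_natDegree

theorem innerPart_monic (q : ℂ[X]) : (innerPart q).Monic :=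
  Polynomial.monic_multiset_prod_of_monic _ _ fun a _ => Polynomial.monic_X_sub_C a

theorem natDegree_innerPart (q : ℂ[X]) : (innerPart q).natDegree = zerosInDisk q := by
  classical
  rw [innerPart, Polynomial.natDegree_multiset_prod_X_sub_C_eq_card, zerosInDisk,
    Multiset.countP_eq_card_filter]

theorem outerPart_ne_zero {q : ℂ[X]} (hq : q ≠ 0) : outerPart q ≠ 0 := by
  intro h
  apply hq
  rw [← innerPart_mul_outerPart q, h, mul_zero]

theorem natDegree_outerPart_add {q : ℂ[X]} (hq : q ≠ 0) :
    zerosInDisk q + (outerPart q).natDegree = q.natDegree := by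
  conv_rhs => rw [← innerPart_mul_outerPart q]
  rw [Polynomial.natDegree_mul (innerPart_monic q).ne_zero (outerPart_ne_zero hq),
    natDegree_innerPart]

theorem innerPart_eval_ne_zero {q : ℂ[X]} {z : ℂ} (hz : 1 ≤ ‖z‖) : (innerPart q).eval z ≠ 0 := by
  classical
  rw [innerPart, Polynomial.eval_multiset_prod, Multiset.map_map, ne_eq, Multiset.prod_eq_zero_iff,
    Multiset.mem_map]
  rintro ⟨a, ha, h⟩
  rw [Multiset.mem_filter] at ha
  simp only [Function.comp_apply, Polynomial.eval_sub, Polynomial.eval_X, Polynomial.eval_C,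
    sub_eq_zero] at h
  rw [h] at hz
  exact absurd ha.2 (not_lt.2 hz)

theorem outerPart_eval_ne_zero {q : ℂ[X]} (hq : ∀ z, ‖z‖ = 1 → q.eval z ≠ 0) {z : ℂ}
    (hz : ‖z‖ ≤ 1) : (outerPart q).eval z ≠ 0 := by
  classical
  have hq0 : q ≠ 0 := by rintro rfl; exact hq 1 (by simp) (by simp)
  rw [outerPart, Polynomial.eval_mul, Polynomial.eval_C, Polynomial.eval_multiset_prod,
    Multiset.map_map]
  refine mul_ne_zero (Polynomial.leadingCoeff_ne_zero.2 hq0) ?_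
  rw [ne_eq, Multiset.prod_eq_zero_iff, Multiset.mem_map]
  rintro ⟨a, ha, h⟩
  rw [Multiset.mem_filter, Polynomial.mem_roots hq0] at ha
  simp only [Function.comp_apply, Polynomial.eval_sub, Polynomial.eval_X, Polynomial.eval_C,
    sub_eq_zero] at h
  rw [h] at hz
  exact hq a (le_antisymm hz (not_lt.1 ha.2)) ha.1

theorem prod_filter_dvd {q f : ℂ[X]} (P : ℂ → Prop) [DecidablePred P]
    (h : ∀ a, P a → f ≠ 0 → q.rootMultiplicity a ≤ f.rootMultiplicity a) :
    ((q.roots.filter P).map fun a => Polynomial.X - Polynomial.C a).prod ∣ f := by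
  rcases eq_or_ne f 0 with rfl | hf
  · exact dvd_zero _
  rw [Multiset.prod_X_sub_C_dvd_iff_le_roots hf, Multiset.le_iff_count]
  intro a
  rw [Multiset.count_filter]
  split_ifs with ha
  · rw [Polynomial.count_roots, Polynomial.count_roots]
    exact h a ha hf
  · exact Nat.zero_le _

theorem innerPart_dvd {q f : ℂ[X]} {C : ℝ}
    (hb : ∀ z, ‖z‖ < 1 → (1 - ‖z‖ ^ 2) * ‖f.eval z‖ ^ 2 ≤ C * ‖q.eval z‖ ^ 2) :
    innerPart q ∣ f := by
  refine prod_filter_dvd _ fun a ha hf => rootMultiplicity_le_of_bound hf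
    (h := fun z => 1 - ‖z‖ ^ 2) (continuous_const.sub (continuous_norm.pow 2)) ?_ (C := C) ?_
  · have := norm_nonneg a
    change 0 < 1 - ‖a‖ ^ 2
    nlinarith
  · filter_upwards [(isOpen_lt continuous_norm continuous_const).mem_nhds ha] with z hz
    exact hb z hz

/-- The weight degenerates on the unit circle, so the bound says nothing there; the hypothesis that
`q` has no zeros on the circle closes this gap. -/
theorem outerPart_dvd {q f : ℂ[X]} (hq : ∀ z, ‖z‖ = 1 → q.eval z ≠ 0) {C : ℝ}
    (hb : ∀ z, 1 < ‖z‖ → (‖z‖ ^ 2 - 1) * ‖f.eval z‖ ^ 2 ≤ C * ‖q.eval z‖ ^ 2) :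
    outerPart q ∣ f := by
  have hq0 : q ≠ 0 := by rintro rfl; exact hq 1 (by simp) (by simp)
  have hu : IsUnit (Polynomial.C q.leadingCoeff) :=
    Polynomial.isUnit_C.2 (Polynomial.leadingCoeff_ne_zero.2 hq0).isUnit
  rw [outerPart, hu.mul_left_dvd]
  refine prod_filter_dvd _ fun a ha hf => ?_
  rcases (not_lt.1 ha).eq_or_lt with ha | ha
  · rw [Polynomial.rootMultiplicity_eq_zero (hq a ha.symm)]
    exact Nat.zero_le _
  · refine rootMultiplicity_le_of_bound hf (h := fun z => ‖z‖ ^ 2 - 1)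
      ((continuous_norm.pow 2).sub continuous_const) ?_ (C := C) ?_
    · nlinarith
    · filter_upwards [(isOpen_lt continuous_const continuous_norm).mem_nhds ha] with z hz
      exact hb z hz

/-- A space of multiples of `r` of degree less than `deg r + N` has dimension at most `N`. -/
theorem finrank_le_of_dvd {V : Type*} [AddCommGroup V] [Module ℂ V] (L : V →ₗ[ℂ] ℂ[X])
    (K : Submodule ℂ V) (hL : ∀ f ∈ K, L f = 0 → f = 0) {r : ℂ[X]} (hr : r ≠ 0) (N : ℕ)
    (h : ∀ f ∈ K, r ∣ L f ∧ (L f ≠ 0 → (L f).natDegree < r.natDegree + N)) :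
    Module.finrank ℂ K ≤ N := by
  have : FiniteDimensional ℂ (Polynomial.degreeLT ℂ N) :=
    Module.Finite.equiv (Polynomial.degreeLTEquiv ℂ N).symm
  set D := (Polynomial.degreeLT ℂ N).map (LinearMap.mulLeft ℂ r) with hD
  have hmem : ∀ f : K, L f ∈ D := by
    intro f
    obtain ⟨⟨g, hg⟩, hdeg⟩ := h f f.2
    refine ⟨g, ?_, hg.symm⟩
    rcases eq_or_ne (L f) 0 with h0 | h0
    · rw [h0] at hg
      rw [(mul_eq_zero.1 hg.symm).resolve_left hr]
      exact Submodule.zero_mem _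
    · have h1 := hdeg h0
      have hg0 : g ≠ 0 := by rintro rfl; exact h0 (by rw [hg, mul_zero])
      rw [hg, Polynomial.natDegree_mul hr hg0] at h1
      rw [SetLike.mem_coe, Polynomial.mem_degreeLT]
      exact (Polynomial.natDegree_lt_iff_degree_lt hg0).1 (by omega)
  have hinj : Function.Injective ((L ∘ₗ K.subtype).codRestrict D hmem) := by
    rw [← LinearMap.ker_eq_bot, LinearMap.ker_eq_bot']
    intro f hf
    exact Subtype.ext (hL f f.2 (congrArg Subtype.val hf))
  refine (LinearMap.finrank_le_finrank_of_injective hinj).trans ?_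
  exact (Submodule.finrank_map_le _ _).trans (PositiveForm.finrank_degreeLT N).le

end

end BernsteinSzego

namespace BernsteinSzego

noncomputable section

open scoped Polynomial ComplexConjugate InnerProductSpace

namespace PositiveForm

variable {n m : ℕ} {τ : PositiveForm n m}

/-! ### The polynomial of a split of `E1 (n - 1) m` -/

theorem finrank_zMul {S : Submodule ℂ τ.H} (hS : S ≤ τ.poly (n - 1) m) :
    Module.finrank ℂ (τ.zMul S) = Module.finrank ℂ S := by
  let F : S →ₗ[ℂ] τ.zMul S :=
    { toFun := fun f => ⟨τ.ofPoly _ (X_mul_mem (hS f.2)), τ.mem_zMul.2 ⟨f, f.2, rfl⟩⟩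
      map_add' := fun f g => Subtype.ext <| τ.incl_injective <| by
        change MvPolynomial.X 0 * τ.incl (f + g : τ.H) =
          MvPolynomial.X 0 * τ.incl f + MvPolynomial.X 0 * τ.incl g
        rw [map_add, mul_add]
      map_smul' := fun c f => Subtype.ext <| τ.incl_injective <| by
        change MvPolynomial.X 0 * τ.incl (c • f : τ.H) = c • (MvPolynomial.X 0 * τ.incl f)
        rw [map_smul, mul_smul_comm] }
  have hF : Function.Bijective F := by
    constructor
    · intro f g h
      have h1 : MvPolynomial.X 0 * τ.incl f = MvPolynomial.X 0 * τ.incl g :=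
        congrArg (fun x : τ.zMul S => τ.incl x) h
      exact Subtype.ext (τ.incl_injective (mul_left_cancel₀ (MvPolynomial.X_ne_zero 0) h1))
    · rintro ⟨g, hg⟩
      obtain ⟨f, hf, h⟩ := τ.mem_zMul.1 hg
      exact ⟨⟨f, hf⟩, Subtype.ext (τ.incl_injective h.symm)⟩
  exact (LinearEquiv.ofBijective F hF).finrank_eq.symm

namespace IsShiftSplit

variable {K₁ K₂ : Submodule ℂ τ.H} (h : τ.IsShiftSplit K₁ K₂)
include h

theorem le_E1_left : K₁ ≤ τ.E1 (n - 1) m := h.1.2 ▸ le_sup_left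

theorem le_E1_right : K₂ ≤ τ.E1 (n - 1) m := h.1.2 ▸ le_sup_right

theorem finrank_add : Module.finrank ℂ K₁ + Module.finrank ℂ K₂ = n := by
  rw [← finrank_sup_of_isOrtho h.1.1, h.1.2, finrank_E1 (N := n) (by omega) (by omega)]

/-- Multiplication by `z` preserves dimension, so `K₁ ⊕ z K₂` has dimension `n` in the `n +
1`-dimensional space `E1 n m`. The normalization of `p` makes its rank one kernel `p p̄` without a
factor. -/
theorem exists_span : ∃ p : τ.H, ‖p‖ = 1 ∧ (K₁ ⊔ τ.zMul K₂) ⟂ (ℂ ∙ p) ∧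
    (K₁ ⊔ τ.zMul K₂) ⊔ (ℂ ∙ p) = τ.E1 n m := by
  set W := K₁ ⊔ τ.zMul K₂ with hW
  have hle : W ≤ τ.E1 n m := sup_le h.2.2.1 h.2.2.2
  have hdim : Module.finrank ℂ W = n := by
    rw [finrank_sup_of_isOrtho h.2.1, finrank_zMul (h.le_E1_right.trans inf_le_left),
      h.finrank_add]
  have h1 : Module.finrank ℂ (Wᗮ ⊓ τ.E1 n m : Submodule ℂ τ.H) = 1 := by
    have h2 := Submodule.finrank_add_inf_finrank_orthogonal hle
    rw [hdim, finrank_E1 (N := n + 1) (by push_cast; ring) le_rfl] at h2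
    omega
  obtain ⟨⟨v, hv⟩, hv0, hspan⟩ := finrank_eq_one_iff'.1 h1
  have hv0 : v ≠ 0 := fun h => hv0 (Subtype.ext h)
  have hn : (‖v‖ : ℂ) ≠ 0 := by exact_mod_cast norm_ne_zero_iff.2 hv0
  have hsp : (ℂ ∙ ((‖v‖ : ℂ)⁻¹ • v)) = Wᗮ ⊓ τ.E1 n m := by
    rw [Submodule.span_singleton_smul_eq (inv_ne_zero hn).isUnit]
    apply le_antisymm
    · rw [Submodule.span_singleton_le_iff_mem]; exact hv
    · intro w hw
      obtain ⟨c, hc⟩ := hspan ⟨w, hw⟩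
      exact Submodule.mem_span_singleton.2 ⟨c, congrArg Subtype.val hc⟩
  refine ⟨(‖v‖ : ℂ)⁻¹ • v, ?_, ?_, ?_⟩
  · rw [norm_smul, norm_inv, Complex.norm_real, norm_norm, inv_mul_cancel₀]
    exact_mod_cast hn
  · rw [hsp, Submodule.isOrtho_comm]
    exact inf_le_left
  · rw [hsp]
    exact Submodule.sup_orthogonal_inf_of_hasOrthogonalProjection hle

end IsShiftSplit

/-- `p` spans the orthogonal complement of `K₁ ⊕ z K₂` in `E1 n m`, in terms of kernels. -/
def IsSplitPoly (K₁ K₂ : Submodule ℂ τ.H) (p : τ.H) : Prop := ∀ z w ζ η,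
  τ.ev z w p * conj (τ.ev ζ η p) + kap K₁ z w ζ η + z * conj ζ * kap K₂ z w ζ η =
    kap (τ.poly n m) z w ζ η - w * conj η * kap (τ.poly n (m - 1)) z w ζ η

theorem IsShiftSplit.exists_isSplitPoly {K₁ K₂ : Submodule ℂ τ.H} (h : τ.IsShiftSplit K₁ K₂) :
    ∃ p : τ.H, IsSplitPoly K₁ K₂ p := by
  obtain ⟨p, hp, h1, h2⟩ := h.exists_span
  refine ⟨p, fun z w ζ η => ?_⟩
  have h3 := kap_sup h1 z w ζ η
  rw [h2, kap_sup h.2.1, kap_zMul (h.le_E1_right.trans inf_le_left), kap_span_singleton hp] at h3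
  rw [kap_poly_eq_E1 le_rfl le_rfl, h3]
  ring

theorem IsShiftSplit.kap_add {K₁ K₂ : Submodule ℂ τ.H} (h : τ.IsShiftSplit K₁ K₂) (z w ζ η : ℂ) :
    kap K₁ z w ζ η + kap K₂ z w ζ η = kap (τ.poly (n - 1) m) z w ζ η -
      w * conj η * kap (τ.poly (n - 1) (m - 1)) z w ζ η := by
  rw [kap_poly_eq_E1 (by omega) le_rfl, ← kap_sup h.1.1, h.1.2]
  ring

theorem kap_E2_eq {z : ℂ} (hz : ‖z‖ = 1) (w η : ℂ) : kap (τ.E2 n m) z w z η =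
    kap (τ.poly n m) z w z η - kap (τ.poly (n - 1) m) z w z η := by
  rw [kap_poly_eq_E2 (k := n) le_rfl le_rfl, mul_conj_eq_one hz]
  ring

theorem kap_E2_ne_zero {z : ℂ} (hz : ‖z‖ ≤ 1) (w : ℂ) : τ.kern (τ.E2 n m) z w ≠ 0 := by
  have h1 : (1 : ℂ[X]) ∈ Polynomial.degreeLT ℂ (m + 1) := by
    rw [Polynomial.mem_degreeLT, Polynomial.degree_one]
    exact_mod_cast Nat.succ_pos m
  obtain ⟨φ, hφ, h⟩ := exists_mem_E2_slice (τ := τ) hz h1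
  intro h0
  have h2 := inner_kern z w hφ
  rw [h0, inner_zero_left, ← eval_sliceL, h, Polynomial.eval_one] at h2
  exact one_ne_zero h2.symm

section

variable {K₁ K₂ : Submodule ℂ τ.H} (h : τ.IsShiftSplit K₁ K₂) {p : τ.H} (hp : IsSplitPoly K₁ K₂ p)
include h hp

/-- On the unit circle the weight `z z̄` of the kernel of `z K₂` is `1`. Subtracting the kernel
identity for `E1 (n - 1) m` therefore eliminates `K₁` and `K₂` at once. -/
theorem split_circle {z : ℂ} (hz : ‖z‖ = 1) (w η : ℂ) :
    τ.ev z w p * conj (τ.ev z η p) =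
      (kap (τ.poly n m) z w z η - kap (τ.poly (n - 1) m) z w z η) - w * conj η *
      (kap (τ.poly n (m - 1)) z w z η - kap (τ.poly (n - 1) (m - 1)) z w z η) := by
  have h1 := hp z w z η
  have h2 := h.kap_add z w z η
  rw [mul_conj_eq_one hz] at h1
  linear_combination h1 - h2

/-- Apply the reversal symmetry to the four kernels in `split_circle`. Those of degree `m - 1` in
`w` pick up one power of `w η̄` less than the others, so the factor in front of them disappears. -/
theorem split_circle_reverse {z w η : ℂ} (hz : ‖z‖ = 1) (hw : w ≠ 0) (hη : η ≠ 0) :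
    (w * conj η) ^ m * conj (τ.ev z (conj w)⁻¹ p * conj (τ.ev z (conj η)⁻¹ p)) =
      (kap (τ.poly n m) z w z η - kap (τ.poly (n - 1) m) z w z η) -
      (kap (τ.poly n (m - 1)) z w z η - kap (τ.poly (n - 1) (m - 1)) z w z η) := by
  have h00 := kap_poly_symm (τ := τ) 0 0 hz hw hη
  have h10 := kap_poly_symm (τ := τ) 1 0 hz hw hη
  have h01 := kap_poly_symm (τ := τ) 0 1 hz hw hη
  have h11 := kap_poly_symm (τ := τ) 1 1 hz hw hη
  simp only [Nat.cast_zero, Nat.cast_one, sub_zero, pow_zero, one_mul, pow_one] at h00 h10 h01 h11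
  have hη' : conj η ≠ 0 := (map_ne_zero _).2 hη
  have hne : w * conj η ≠ 0 := mul_ne_zero hw hη'
  rw [split_circle h hp hz]
  simp only [map_sub, map_mul, map_inv₀, Complex.conj_conj]
  have e : w * conj η * (w⁻¹ * (conj η)⁻¹) = 1 := by field_simp
  apply mul_left_cancel₀ hne
  linear_combination -(w * conj η) * h00 + w * conj η * h10 + h01 - h11 - (w * conj η) ^ m *
    (conj (kap (τ.poly n (m - 1)) z (conj w)⁻¹ z (conj η)⁻¹) -
      conj (kap (τ.poly (n - 1) (m - 1)) z (conj w)⁻¹ z (conj η)⁻¹)) * e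

/-- The Christoffel-Darboux formula results from subtracting `w η̄` times the reversed identity from
the direct one: the kernels of degree `m - 1` in `w` cancel. -/
theorem split_christoffel_darboux {z w η : ℂ} (hz : ‖z‖ = 1) (hw : w ≠ 0) (hη : η ≠ 0) :
    (1 - w * conj η) * kap (τ.E2 n m) z w z η = τ.ev z w p * conj (τ.ev z η p) - w * conj η *
      ((w * conj η) ^ m * conj (τ.ev z (conj w)⁻¹ p * conj (τ.ev z (conj η)⁻¹ p))) := by
  rw [split_circle_reverse h hp hz hw hη, split_circle h hp hz, kap_E2_eq hz]
  ring

/-- At `w = 0` the value `|p(z, 0)|²` is the diagonal of a nonvanishing kernel. For `0 < |w| < 1` a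
zero would make the two sides of the Christoffel-Darboux formula on the diagonal have opposite
signs. For `|w| = 1` the point is its own reflection, so a zero would kill both terms on the right
and hence the whole kernel section at `w`. -/
theorem split_ev_ne_zero {z w : ℂ} (hz : ‖z‖ = 1) (hw : ‖w‖ ≤ 1) : τ.ev z w p ≠ 0 := by
  intro h0
  rcases eq_or_ne w 0 with rfl | hw0
  · have h1 := split_circle h hp hz 0 0
    rw [h0, zero_mul, zero_mul, sub_zero, ← kap_E2_eq hz, kap_self] at h1
    exact kap_E2_ne_zero (τ := τ) hz.le 0 (by simpa using h1.symm)
  rcases hw.lt_or_eq with hw | hw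
  · have h1 := split_christoffel_darboux h hp hz hw0 hw0
    have h2 : conj (τ.ev z (conj w)⁻¹ p * conj (τ.ev z (conj w)⁻¹ p)) =
        ((‖τ.ev z (conj w)⁻¹ p‖ ^ 2 : ℝ) : ℂ) := by
      rw [Complex.mul_conj, Complex.normSq_eq_norm_sq, Complex.conj_ofReal]
    rw [h0, zero_mul, zero_sub, h2, kap_self, Complex.mul_conj, Complex.normSq_eq_norm_sq] at h1
    have h3 : (1 - ‖w‖ ^ 2) * ‖τ.kern (τ.E2 n m) z w‖ ^ 2 =
        -(‖w‖ ^ 2 * ((‖w‖ ^ 2) ^ m * ‖τ.ev z (conj w)⁻¹ p‖ ^ 2)) := by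
      apply Complex.ofReal_injective
      push_cast at h1 ⊢
      exact h1
    have h4 : 0 < (1 - ‖w‖ ^ 2) * ‖τ.kern (τ.E2 n m) z w‖ ^ 2 := by
      refine mul_pos ?_ (pow_pos (norm_pos_iff.2 (kap_E2_ne_zero hz.le w)) 2)
      have := norm_nonneg w
      nlinarith
    have h5 : 0 ≤ ‖w‖ ^ 2 * ((‖w‖ ^ 2) ^ m * ‖τ.ev z (conj w)⁻¹ p‖ ^ 2) := by positivity
    linarith
  · have h1 : (1 - Polynomial.C (conj w) * Polynomial.X) * Polynomial.X *
        τ.sliceL z (τ.kern (τ.E2 n m) z w) = 0 := by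
      refine Polynomial.funext fun v => ?_
      simp only [Polynomial.eval_mul, Polynomial.eval_sub, Polynomial.eval_one, Polynomial.eval_C,
        Polynomial.eval_X, Polynomial.eval_zero, eval_sliceL]
      rcases eq_or_ne v 0 with rfl | hv
      · simp
      · have h1 := split_christoffel_darboux h hp hz hv hw0
        rw [inv_conj_of_norm_eq_one hw, h0] at h1
        simp only [map_zero, mul_zero, sub_zero] at h1
        rw [mul_comm (conj w), mul_assoc, mul_left_comm]
        change v * ((1 - v * conj w) * kap (τ.E2 n m) z v z w) = 0
        rw [h1, mul_zero]
    have h2 : (1 - Polynomial.C (conj w) * Polynomial.X : ℂ[X]) * Polynomial.X ≠ 0 := by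
      refine mul_ne_zero (fun h => ?_) Polynomial.X_ne_zero
      simpa using congrArg (Polynomial.eval 0) h
    have h3 := (mul_eq_zero.1 h1).resolve_left h2
    have h4 : kap (τ.E2 n m) z w z w = 0 := by
      rw [kap, ← eval_sliceL, h3, Polynomial.eval_zero]
    rw [kap_self] at h4
    exact kap_E2_ne_zero (τ := τ) hz.le w (by simpa using h4)

theorem split_noZerosOnFace : NoZerosOnFace (τ.incl p) := fun z w hz hw => by
  rw [← ev_apply]; exact split_ev_ne_zero h hp hz hw

/-! ### The number of zeros -/

/-- With `P_{n,m} = F2 ⊕ P_{n-1,m}`, the kernel identities at `w = 0` express `|p(z, 0)|²` as the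
diagonal kernel of `F2` plus `1 - |z|²` times that of `K₂`. -/
theorem split_bound_right {f : τ.H} (hf : f ∈ K₂) {z : ℂ} (hz : ‖z‖ < 1) :
    (1 - ‖z‖ ^ 2) * ‖(τ.valW f).eval z‖ ^ 2 ≤ ‖f‖ ^ 2 * ‖(τ.valW p).eval z‖ ^ 2 := by
  rw [eval_valW, eval_valW]
  have h1 := hp z 0 z 0
  have h2 := h.kap_add z 0 z 0
  rw [kap_poly_eq_F2 (τ := τ) n m] at h1
  simp only [kap_self, Complex.mul_conj, Complex.normSq_eq_norm_sq, map_zero, mul_zero, zero_mul,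
    sub_zero] at h1 h2
  have h3 : ‖τ.ev z 0 p‖ ^ 2 = ‖τ.kern (τ.F2 n m) z 0‖ ^ 2 +
      (1 - ‖z‖ ^ 2) * ‖τ.kern K₂ z 0‖ ^ 2 := by
    apply Complex.ofReal_injective
    push_cast at h1 h2 ⊢
    linear_combination h1 - h2
  have h4 := norm_ev_sq_le hf z 0
  have h5 : 0 ≤ 1 - ‖z‖ ^ 2 := sub_nonneg.2 (pow_le_one₀ (norm_nonneg _) hz.le)
  calc _ ≤ (1 - ‖z‖ ^ 2) * (‖τ.kern K₂ z 0‖ ^ 2 * ‖f‖ ^ 2) := by gcongr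
    _ = ‖f‖ ^ 2 * ((1 - ‖z‖ ^ 2) * ‖τ.kern K₂ z 0‖ ^ 2) := by ring
    _ ≤ _ := by
      gcongr
      rw [h3]
      exact le_add_of_nonneg_left (sq_nonneg _)

/-- With `P_{n,m} = E2 ⊕ z P_{n-1,m}` instead, the same identities express `|p(z, 0)|²` as the
diagonal kernel of `E2` plus `|z|² - 1` times that of `K₁`. -/
theorem split_bound_left {f : τ.H} (hf : f ∈ K₁) {z : ℂ} (hz : 1 < ‖z‖) :
    (‖z‖ ^ 2 - 1) * ‖(τ.valW f).eval z‖ ^ 2 ≤ ‖f‖ ^ 2 * ‖(τ.valW p).eval z‖ ^ 2 := by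
  rw [eval_valW, eval_valW]
  have h1 := hp z 0 z 0
  have h2 := h.kap_add z 0 z 0
  rw [kap_poly_eq_E2 (τ := τ) (k := n) le_rfl le_rfl] at h1
  simp only [kap_self, Complex.mul_conj, Complex.normSq_eq_norm_sq, map_zero, mul_zero, zero_mul,
    sub_zero] at h1 h2
  have h3 : ‖τ.ev z 0 p‖ ^ 2 = ‖τ.kern (τ.E2 n m) z 0‖ ^ 2 +
      (‖z‖ ^ 2 - 1) * ‖τ.kern K₁ z 0‖ ^ 2 := by
    apply Complex.ofReal_injective
    push_cast at h1 h2 ⊢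
    linear_combination h1 - (‖z‖ : ℂ) ^ 2 * h2
  have h4 := norm_ev_sq_le hf z 0
  have h5 : 0 ≤ ‖z‖ ^ 2 - 1 := sub_nonneg.2 (one_le_pow₀ hz.le)
  calc _ ≤ (‖z‖ ^ 2 - 1) * (‖τ.kern K₁ z 0‖ ^ 2 * ‖f‖ ^ 2) := by gcongr
    _ = ‖f‖ ^ 2 * ((‖z‖ ^ 2 - 1) * ‖τ.kern K₁ z 0‖ ^ 2) := by ring
    _ ≤ _ := by
      gcongr
      rw [h3]
      exact le_add_of_nonneg_left (sq_nonneg _)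

/-- On `K₁` the values at `w = 0` are multiples of the outer part of `q` of degree less than that of
`q`; on `K₂` they are multiples of the inner part of degree less than `n`. These give `dim K₁ ≤ d'`
and `dim K₂ ≤ n - d'`, where `d'` is the number of zeros in the disk, and the two dimensions add up
to `n`. -/
theorem split_zerosInDisk : zerosInDisk (τ.valW p) = Module.finrank ℂ K₁ := by
  set q := τ.valW p with hq
  have hcirc : ∀ z, ‖z‖ = 1 → q.eval z ≠ 0 := fun z hz => by
    rw [hq, eval_valW]; exact split_ev_ne_zero h hp hz (by simp)
  have hq0 : q ≠ 0 := by rintro h0; exact hcirc 1 (by simp) (by simp [h0])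
  have hdeg : q.natDegree ≤ n := by
    have := valW_mem (τ := τ) (k := n) (N := n + 1) (by push_cast; ring) (τ.mem_poly_self p)
    rw [Polynomial.mem_degreeLT] at this
    exact Nat.lt_succ_iff.1 ((Polynomial.natDegree_lt_iff_degree_lt hq0).2 this)
  have hsum := natDegree_outerPart_add hq0
  have hE : ∀ f ∈ τ.E1 (n - 1) m, τ.valW f = 0 → f = 0 := fun f hf =>
    E1_eq_zero (by omega) le_rfl hf
  have h1 : Module.finrank ℂ K₁ ≤ zerosInDisk q := by
    refine finrank_le_of_dvd τ.valW K₁ (fun f hf => hE f (h.le_E1_left hf))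
      (outerPart_ne_zero hq0) _ fun f hf => ⟨?_, fun h0 => ?_⟩
    · exact outerPart_dvd hcirc fun z hz => split_bound_left h hp hf hz
    · have := natDegree_lt_of_bound h0 fun z hz => split_bound_left h hp hf hz
      rw [← hq] at this
      omega
  have h2 : Module.finrank ℂ K₂ ≤ n - zerosInDisk q := by
    refine finrank_le_of_dvd τ.valW K₂ (fun f hf => hE f (h.le_E1_right hf))
      (innerPart_monic q).ne_zero _ fun f hf => ⟨?_, fun h0 => ?_⟩
    · exact innerPart_dvd fun z hz => split_bound_right h hp hf hz
    · have := valW_mem (τ := τ) (k := n - 1) (N := n) (by ring) (h.le_E1_right hf).1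
      rw [Polynomial.mem_degreeLT] at this
      have := (Polynomial.natDegree_lt_iff_degree_lt h0).2 this
      rw [natDegree_innerPart]
      omega
  have := h.finrank_add
  omega

end

end PositiveForm

end

end BernsteinSzego

namespace BernsteinSzego

noncomputable section

open scoped Polynomial ComplexConjugate InnerProductSpace

namespace PositiveForm

variable {n m : ℕ} {τ : PositiveForm n m}

/-! ### The moments of the polynomial of a split -/

theorem kern_zMul {S : Submodule ℂ τ.H} (z w : ℂ) {g : τ.H}
    (hg : τ.incl g = MvPolynomial.X 0 * τ.incl (τ.kern S z w)) :
    τ.kern (τ.zMul S) z w = conj z • g := by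
  symm
  refine eq_kern (Submodule.smul_mem _ _ (τ.mem_zMul.2 ⟨_, kern_mem S z w, hg⟩)) fun f hf => ?_
  obtain ⟨f₀, hf₀, hf⟩ := τ.mem_zMul.1 hf
  rw [inner_smul_left, τ.inner_mul_mul toLaurent_mul_conjInv_X0 hf hg, inner_kern _ _ hf₀,
    τ.ev_mul hf, RingHomCompTriple.comp_apply, RingHom.id_apply, MvPolynomial.eval_X]
  rfl

theorem reversal_mem_E2 {f : τ.H} (hf : f ∈ τ.F2 n m) : τ.reversal f ∈ τ.E2 n m := by
  refine ⟨τ.mem_poly_self _, fun g hg => ?_⟩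
  obtain ⟨g₀, hg₀, h⟩ := τ.mem_zMul.1 hg
  rw [← τ.reversal_reversal g, τ.inner_reversal, ← inner_conj_symm, map_eq_zero]
  refine hf.2 _ ?_
  have h1 := rev_mul_mem (n := n) (m := m) (a := 1) (b := 0) (f := τ.incl g₀)
    (by simpa using mem_poly τ |>.1 hg₀)
  rw [mem_poly, incl_reversal, h]
  simpa using h1

theorem eq_zero_of_ev_eq_zero {f : τ.H} (h : ∀ z w, ‖z‖ ≤ 1 → τ.ev z w f = 0) : f = 0 := by
  apply τ.incl_injective
  rw [map_zero]
  refine eq_zero_of_slice_eq_zero (D := Metric.closedBall (0 : ℂ) 1) ?_ fun z hz => ?_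
  · exact infinite_of_mem_nhds (0 : ℂ) (Metric.closedBall_mem_nhds _ one_pos)
  · refine Polynomial.funext fun w => ?_
    rw [eval_slice, ← ev_apply, h z w (by simpa using hz), Polynomial.eval_zero]

/-- `E2` is spanned by its kernel vectors at the points `(z, w)` with `|w| < 1`. -/
theorem span_kern_E2 {z : ℂ} (hz : ‖z‖ ≤ 1) :
    τ.E2 n m ≤ Submodule.span ℂ {k | ∃ w : ℂ, ‖w‖ < 1 ∧ k = τ.kern (τ.E2 n m) z w} := by
  set U := Submodule.span ℂ {k | ∃ w : ℂ, ‖w‖ < 1 ∧ k = τ.kern (τ.E2 n m) z w} with hU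
  have hle : U ≤ τ.E2 n m := Submodule.span_le.2 <| by rintro _ ⟨w, -, rfl⟩; exact kern_mem _ _ _
  intro f hf
  have h0 : f - U.starProjection f ∈ Uᗮ := U.sub_starProjection_mem_orthogonal f
  have h1 : f - U.starProjection f ∈ τ.E2 n m :=
    Submodule.sub_mem _ hf (hle (U.starProjection_apply_mem f))
  have h2 : f - U.starProjection f = 0 := by
    refine E2_eq_zero hz h1 ?_
    refine Polynomial.eq_zero_of_infinite_isRoot _ (Set.Infinite.mono (s := Metric.ball 0 1) ?_
      (infinite_of_mem_nhds (0 : ℂ) (Metric.ball_mem_nhds _ one_pos)))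
    intro w hw
    have hw : ‖w‖ < 1 := by simpa using hw
    change (τ.sliceL z _).eval w = 0
    rw [eval_sliceL, ← inner_kern z w h1]
    exact h0 _ (Submodule.subset_span ⟨w, hw, rfl⟩)
  rw [sub_eq_zero] at h2
  rw [h2]
  exact U.starProjection_apply_mem f

section

variable {K₁ K₂ : Submodule ℂ τ.H} (h : τ.IsShiftSplit K₁ K₂) {p : τ.H} (hp : IsSplitPoly K₁ K₂ p)
include h hp

/-- The Christoffel-Darboux formula is exactly the hypothesis of `avg_mul_conj_kernel`. So the slice
of the kernel of `E2` reproduces every slice of degree at most `m` in the space weighted by `1 /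
|p(z, ·)|²`. -/
theorem split_ip_kern {z : ℂ} (hz : ‖z‖ = 1) (f : τ.H) {η : ℂ} (hη : ‖η‖ < 1) :
    ip (τ.sliceL z p) (τ.sliceL z f) (τ.sliceL z (τ.kern (τ.E2 n m) z η)) = τ.ev z η f := by
  have ha : ∀ w, ‖w‖ ≤ 1 → (τ.sliceL z p).eval w ≠ 0 :=
    (split_noZerosOnFace h hp).slice_ne_zero hz
  rw [← eval_sliceL]
  refine avg_mul_conj_kernel ha (τ.natDegree_sliceL z f) hη
    (c := conj η ^ m * τ.ev z (conj η)⁻¹ p) fun w hw => ?_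
  simp only [eval_sliceL]
  change (1 - w * conj η) * kap (τ.E2 n m) z w z η = _
  -- At `η = 0` the constant `c` contains the inverse of zero, but it enters only multiplied by the
  -- conjugate of `η`. The identity is then `split_circle` itself.
  rcases eq_or_ne η 0 with rfl | hη0
  · rw [split_circle h hp hz, kap_E2_eq hz]
    simp
  · rw [split_christoffel_darboux h hp hz (ne_zero_of_norm_eq_one hw) hη0,
      inv_conj_of_norm_eq_one hw, map_mul, Complex.conj_conj]
    ring

/-- Both sides reproduce against kernel vectors of `E2` at points `(z, w)` with `|w| < 1`, and these
span `E2`. The point is that the left side does not depend on `z`. -/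
theorem split_ip_E2 {z : ℂ} (hz : ‖z‖ = 1) {f g : τ.H} (hf : f ∈ τ.E2 n m) (hg : g ∈ τ.E2 n m) :
    ip (τ.sliceL z p) (τ.sliceL z f) (τ.sliceL z g) = ⟪g, f⟫_ℂ := by
  have ha : ∀ w, ‖w‖ ≤ 1 → (τ.sliceL z p).eval w ≠ 0 :=
    (split_noZerosOnFace h hp).slice_ne_zero hz
  have hg' := span_kern_E2 hz.le hg
  clear hg
  induction hg' using Submodule.span_induction with
  | zero => rw [map_zero, inner_zero_left]; simpa using ip_smul_right (a := τ.sliceL z p) 0 _ 0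
  | mem k hk =>
    obtain ⟨w, hw, rfl⟩ := hk
    rw [split_ip_kern h hp hz f hw, inner_kern z w hf]
  | add x y _ _ hx hy => rw [map_add, ip_add_right ha, inner_add_left, hx, hy]
  | smul c x _ hx => rw [map_smul, ip_smul_right, inner_smul_left, hx]

omit h hp in
/-- On the closed disk the slices of an element of `τ.H` are combinations of slices of a basis of
`E2`, with coefficients that are quotients of polynomials without poles. -/
theorem exists_slice_eq_sum : ∃ (φ : Fin (m + 1) → τ.H) (D : ℂ[X]),
    (∀ i, φ i ∈ τ.E2 n m) ∧ τ.E2 n m ≤ Submodule.span ℂ (Set.range φ) ∧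
    Pairwise (fun i j => ⟪φ i, φ j⟫_ℂ = 0) ∧
    (∀ z, ‖z‖ ≤ 1 → D.eval z ≠ 0) ∧ ∀ f : τ.H, ∃ A : Fin (m + 1) → ℂ[X], ∀ z,
      D.eval z • τ.sliceL z f = ∑ i, (A i).eval z • τ.sliceL z (φ i) := by
  let b := (stdOrthonormalBasis ℂ (τ.E2 n m)).reindex (finCongr finrank_E2)
  let Φ : Matrix (Fin (m + 1)) (Fin (m + 1)) ℂ[X] := fun i k => (bi (τ.incl (b i))).coeff k
  have hΦ : ∀ z i, ∀ k : Fin (m + 1), (Φ i k).eval z = (τ.sliceL z (b i)).coeff k := fun z i k =>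
    (coeff_slice z _ k).symm
  refine ⟨fun i => b i, Φ.det, fun i => (b i).2, ?_, ?_, ?_, ?_⟩
  · intro f hf
    have := b.sum_repr ⟨f, hf⟩
    have h1 := congrArg (τ.E2 n m).subtype this
    rw [map_sum] at h1
    change _ = f at h1
    rw [← h1]
    exact Submodule.sum_mem _ fun i _ => Submodule.smul_mem _ _ (Submodule.subset_span ⟨i, rfl⟩)
  · exact fun i j hij => b.orthonormal.2 hij
  -- A zero of the determinant would yield a nontrivial combination of the basis with vanishing
  -- slice at `z`, contrary to `E2_eq_zero`.
  · intro z hz h0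
    have h1 : (Φ.map (Polynomial.evalRingHom z)).det = 0 := by
      rw [← RingHom.mapMatrix_apply, ← RingHom.map_det]
      exact h0
    obtain ⟨c, hc, hcΦ⟩ := Matrix.exists_vecMul_eq_zero_iff.2 h1
    have h2 : (∑ i, c i • b i : τ.E2 n m) = 0 := by
      apply Subtype.ext
      refine E2_eq_zero hz (Subtype.mem _) ?_
      change τ.sliceL z ((τ.E2 n m).subtype (∑ i, c i • b i)) = 0
      ext k
      rw [map_sum, map_sum, Polynomial.finsetSum_coeff, Polynomial.coeff_zero]
      rcases lt_or_ge k (m + 1) with hk | hk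
      · have := congrFun hcΦ ⟨k, hk⟩
        rw [Pi.zero_apply] at this
        rw [← this]
        refine Finset.sum_congr rfl fun i _ => ?_
        change _ = c i * (Φ i ⟨k, hk⟩).eval z
        rw [hΦ, map_smul, map_smul, Polynomial.coeff_smul, smul_eq_mul]
        rfl
      · exact Finset.sum_eq_zero fun i _ =>
          Polynomial.coeff_eq_zero_of_natDegree_lt ((τ.natDegree_sliceL z _).trans_lt hk)
    exact hc (funext (Fintype.linearIndependent_iff.1 b.toBasis.linearIndependent c (by simpa using h2)))
  · intro f
    let v : Fin (m + 1) → ℂ[X] := fun k => (bi (τ.incl f)).coeff k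
    -- Cramer's rule, over the polynomials in `z`.
    refine ⟨Matrix.vecMul v Φ.adjugate, fun z => ?_⟩
    have h1 : Matrix.vecMul (Matrix.vecMul v Φ.adjugate) Φ = Φ.det • v := by
      rw [Matrix.vecMul_vecMul, Matrix.adjugate_mul, Matrix.vecMul_smul, Matrix.vecMul_one]
    ext k
    rw [Polynomial.finsetSum_coeff, Polynomial.coeff_smul, smul_eq_mul]
    rcases lt_or_ge k (m + 1) with hk | hk
    · have := congrArg (Polynomial.eval z) (congrFun h1 ⟨k, hk⟩)
      change Polynomial.eval z (∑ i, _ * Φ i ⟨k, hk⟩) = Polynomial.eval z (Φ.det * v ⟨k, hk⟩) at this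
      rw [Polynomial.eval_mul, Polynomial.eval_finsetSum] at this
      have e : (v ⟨k, hk⟩).eval z = (τ.sliceL z f).coeff k := (coeff_slice z _ k).symm
      rw [e] at this
      rw [← this]
      refine Finset.sum_congr rfl fun i _ => ?_
      rw [Polynomial.eval_mul, hΦ, Polynomial.coeff_smul, smul_eq_mul]
    · rw [Polynomial.coeff_eq_zero_of_natDegree_lt ((τ.natDegree_sliceL z _).trans_lt hk), mul_zero]
      refine (Finset.sum_eq_zero fun i _ => ?_).symm
      rw [Polynomial.coeff_smul,
        Polynomial.coeff_eq_zero_of_natDegree_lt ((τ.natDegree_sliceL z _).trans_lt hk), smul_zero]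

/-- By orthogonality in each slice, the inner product of the slices of `f` and of a basis vector is
a constant times `A_j / D`, holomorphic on the closed disk. The additional factor `z` makes its mean
vanish. -/
theorem split_bs_X0_mul {f g : τ.H} (hg : g ∈ τ.E2 n m) :
    bs (τ.incl p) (MvPolynomial.X 0 * τ.incl f) (τ.incl g) = 0 := by
  have hface := split_noZerosOnFace h hp
  obtain ⟨φ, D, hφ, hspan, hortho, hD, hf⟩ := exists_slice_eq_sum (τ := τ)
  obtain ⟨A, hA⟩ := hf f
  have hg' := hspan hg
  clear hg
  induction hg' using Submodule.span_induction with
  | zero => rw [map_zero, bs_zero_right]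
  | add x y _ _ hx hy => rw [map_add, bs_add_right hface, hx, hy, add_zero]
  | smul c x _ hx => rw [map_smul, bs_smul_right, hx, mul_zero]
  | mem x hx =>
    obtain ⟨j, rfl⟩ := hx
    rw [bs, ← avg_pow_mul_div hD (Polynomial.C ⟪φ j, φ j⟫_ℂ * A j) one_ne_zero]
    refine avg_congr fun z hz => ?_
    have ha : ∀ w, ‖w‖ ≤ 1 → (τ.sliceL z p).eval w ≠ 0 := hface.slice_ne_zero hz
    have hDz := hD z hz.le
    rw [slice_mul, slice_X0, ← Polynomial.smul_eq_C_mul, ip_smul_left, pow_one]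
    congr 1
    have h1 := congrArg (fun r => ip (τ.sliceL z p) r (τ.sliceL z (φ j))) (hA z)
    rw [ip_smul_left, ip_sum_left ha, Finset.sum_eq_single j] at h1
    · rw [eq_div_iff hDz, Polynomial.eval_mul, Polynomial.eval_C,
        ← split_ip_E2 h hp hz (hφ j) (hφ j)]
      rw [ip_smul_left] at h1
      change ip (τ.sliceL z p) (τ.sliceL z f) (τ.sliceL z (φ j)) * _ = _
      linear_combination h1
    · intro i _ hij
      rw [ip_smul_left, split_ip_E2 h hp hz (hφ i) (hφ j), hortho hij.symm, mul_zero]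
    · exact fun h => absurd (Finset.mem_univ j) h

theorem split_bs_E2 (f : τ.H) {g : τ.H} (hg : g ∈ τ.E2 n m) :
    bs (τ.incl p) (τ.incl f) (τ.incl g) = ⟪g, f⟫_ℂ := by
  have hf := τ.mem_poly_self f
  rw [← E2_sup] at hf
  obtain ⟨a, ha, b, hb, rfl⟩ := Submodule.mem_sup.1 hf
  have hb0 : ⟪g, b⟫_ℂ = 0 := (τ.E2_isOrtho n m).symm hb g hg
  obtain ⟨b', -, hbb⟩ := τ.mem_zMul.1 hb
  rw [map_add, bs_add_left (split_noZerosOnFace h hp), hbb, split_bs_X0_mul h hp hg, inner_add_right,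
    hb0, add_zero, add_zero]
  exact (avg_congr fun z hz => split_ip_E2 h hp hz ha hg).trans (avg_const _)

/-- Reversal carries `F2` into `E2` and is antiunitary for both inner products. -/
theorem split_bs_F2 (f : τ.H) {g : τ.H} (hg : g ∈ τ.F2 n m) :
    bs (τ.incl p) (τ.incl f) (τ.incl g) = ⟪g, f⟫_ℂ := by
  have h1 := split_bs_E2 h hp (τ.reversal f) (reversal_mem_E2 hg)
  rw [τ.inner_reversal, incl_reversal, incl_reversal, bs_rev (τ.incl_mem f) (τ.incl_mem g)] at h1
  rw [← conj_bs, h1, inner_conj_symm]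

/-- Write `f = φ + (z - ζ) g` with `φ` in `E2`, where the inner products are known to agree. For the
rest, let `κ` be the kernel of `P_{n-1,m}`. The two decompositions of the full kernel give `κ - ζ̄ z
κ = kern E2 - kern F2`, a vector for which they agree as well, and invariance under multiplication
by `z` reduces the term with `(z - ζ) g` to it. -/
theorem split_bs_rep (f : τ.H) {ζ : ℂ} (hζ : ‖ζ‖ ≤ 1) (η : ℂ) :
    bs (τ.incl p) (τ.incl f) (τ.incl (τ.kern (τ.poly n m) ζ η)) = τ.ev ζ η f := by
  have hface := split_noZerosOnFace h hp
  set S := τ.poly (n - 1) m with hS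
  set κ := τ.kern S ζ η with hκ
  have hκS : κ ∈ S := kern_mem S ζ η
  obtain ⟨κ', -, hκ'⟩ := τ.exists_X0_mul le_rfl hκS
  have hF : τ.kern (τ.poly n m) ζ η = τ.kern (τ.F2 n m) ζ η + κ := by
    rw [hκ, hS, ← kern_sup (τ.F2_isOrtho n m), F2_sup]
  have hE : τ.kern (τ.poly n m) ζ η = τ.kern (τ.E2 n m) ζ η + conj ζ • κ' := by
    rw [← kern_zMul ζ η hκ', ← kern_sup (τ.E2_isOrtho n m), E2_sup]
  have hEm := kern_mem (τ.E2 n m) ζ η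
  have hFm := kern_mem (τ.F2 n m) ζ η
  obtain ⟨φ, hφ, g, hg, g', hg', rfl⟩ := exists_E2_add_mul hζ f
  have e1 : bs (τ.incl p) (τ.incl g') (τ.incl κ') = bs (τ.incl p) (τ.incl g) (τ.incl κ) := by
    rw [hg', hκ', bs_X0_mul]
  have e1' : ⟪κ', g'⟫_ℂ = ⟪κ, g⟫_ℂ := τ.inner_mul_mul toLaurent_mul_conjInv_X0 hg' hκ'
  have e2 : bs (τ.incl p) (τ.incl φ) (τ.incl (τ.kern (τ.poly n m) ζ η)) = τ.ev ζ η φ := by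
    rw [← conj_bs, split_bs_E2 h hp _ hφ, inner_conj_symm, inner_kern _ _ (τ.mem_poly_self φ)]
  have hcomb : κ - conj ζ • κ' = τ.kern (τ.E2 n m) ζ η - τ.kern (τ.F2 n m) ζ η := by
    rw [sub_eq_sub_iff_add_eq_add, add_comm κ, ← hF, hE]
  have e3 : bs (τ.incl p) (τ.incl g') (τ.incl κ) - ζ * bs (τ.incl p) (τ.incl g') (τ.incl κ') =
      ⟪κ - conj ζ • κ', g'⟫_ℂ := by
    rw [hcomb, inner_sub_left, ← split_bs_E2 h hp _ hEm, ← split_bs_F2 h hp _ hFm]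
    have h1 : τ.kern (τ.F2 n m) ζ η + κ = τ.kern (τ.E2 n m) ζ η + conj ζ • κ' := hF ▸ hE
    have h2 := congrArg (fun x => bs (τ.incl p) (τ.incl g') (τ.incl x)) h1
    simp only [map_add, map_smul, bs_add_right hface, bs_smul_right, Complex.conj_conj] at h2
    linear_combination h2
  rw [inner_sub_left, inner_smul_left, Complex.conj_conj] at e3
  have hev : τ.ev ζ η g' = ζ * τ.ev ζ η g := by rw [τ.ev_mul hg', MvPolynomial.eval_X]; rfl
  have e4 : ⟪κ, g'⟫_ℂ + ⟪τ.kern (τ.F2 n m) ζ η, g'⟫_ℂ = τ.ev ζ η g' := by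
    rw [add_comm, ← inner_add_left, ← hF, inner_kern _ _ (τ.mem_poly_self g')]
  have e5 : ⟪κ, g⟫_ℂ + ⟪τ.kern (τ.F2 n m) ζ η, g⟫_ℂ = τ.ev ζ η g := by
    rw [add_comm, ← inner_add_left, ← hF, inner_kern _ _ (τ.mem_poly_self g)]
  have e6 : ∀ x : τ.H, bs (τ.incl p) (τ.incl x) (τ.incl (τ.kern (τ.poly n m) ζ η)) =
      ⟪τ.kern (τ.F2 n m) ζ η, x⟫_ℂ + bs (τ.incl p) (τ.incl x) (τ.incl κ) := fun x => by
    rw [hF, map_add, bs_add_right hface, split_bs_F2 h hp _ hFm]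
  have e7 : bs (τ.incl p) (τ.incl (φ + (g' - ζ • g)))
      (τ.incl (τ.kern (τ.poly n m) ζ η)) = bs (τ.incl p) (τ.incl φ)
      (τ.incl (τ.kern (τ.poly n m) ζ η)) + (bs (τ.incl p) (τ.incl g')
      (τ.incl (τ.kern (τ.poly n m) ζ η)) - ζ * bs (τ.incl p) (τ.incl g)
      (τ.incl (τ.kern (τ.poly n m) ζ η))) := by
    rw [sub_eq_add_neg, ← neg_smul, map_add, map_add, bs_add_left hface, bs_add_left hface, map_smul,
      bs_smul_left]
    ring
  rw [e7, e2, e6, e6, map_add, map_sub, map_smul, smul_eq_mul]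
  linear_combination e3 + ζ * e1 - ζ * e1' + e4 - ζ * e5

theorem split_inner_eq (f g : τ.H) : ⟪g, f⟫_ℂ = bs (τ.incl p) (τ.incl f) (τ.incl g) := by
  have hface := split_noZerosOnFace h hp
  set U := Submodule.span ℂ {k | ∃ z w : ℂ, ‖z‖ ≤ 1 ∧ k = τ.kern (τ.poly n m) z w} with hU
  have hg : g ∈ U := by
    have h0 : g - U.starProjection g ∈ Uᗮ := U.sub_starProjection_mem_orthogonal g
    have h2 : g - U.starProjection g = 0 := by
      refine eq_zero_of_ev_eq_zero fun z w hz => ?_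
      rw [← inner_kern z w (τ.mem_poly_self _)]
      exact h0 _ (Submodule.subset_span ⟨z, w, hz, rfl⟩)
    rw [sub_eq_zero] at h2
    rw [h2]
    exact U.starProjection_apply_mem g
  induction hg using Submodule.span_induction with
  | zero => rw [map_zero, inner_zero_left, bs_zero_right]
  | add x y _ _ hx hy => rw [map_add, bs_add_right hface, inner_add_left, hx, hy]
  | smul c x _ hx => rw [map_smul, bs_smul_right, inner_smul_left, hx]
  | mem x hx =>
    obtain ⟨z, w, hz, rfl⟩ := hx
    rw [split_bs_rep h hp f hz w, inner_kern _ _ (τ.mem_poly_self f)]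

end

/-- A split yields a Bernstein-Szegő polynomial. -/
theorem IsShiftSplit.exists_bernsteinSzego {K₁ K₂ : Submodule ℂ τ.H} (h : τ.IsShiftSplit K₁ K₂) :
    ∃ p : Poly2, NoZerosOnFace p ∧ p.degreeOf 0 ≤ n ∧ p.degreeOf 1 ≤ m ∧
      zerosInDisk (atWZero p) = Module.finrank ℂ K₁ ∧ τ.HasBernsteinSzegoMoments p := by
  obtain ⟨p, hp⟩ := h.exists_isSplitPoly
  have hface := split_noZerosOnFace h hp
  have hdeg := degreeOf_le_of_mem_polySpace (τ.incl_mem p)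
  exact ⟨τ.incl p, hface, hdeg.1, hdeg.2, split_zerosInDisk h hp,
    (τ.hasBernsteinSzegoMoments_iff hface).2 (split_inner_eq h hp)⟩

end PositiveForm

end

end BernsteinSzego

/-! ### From a Bernstein-Szegő polynomial to a split. -/

namespace BernsteinSzego

noncomputable section

open scoped Polynomial ComplexConjugate

/-! ### Fourier coefficients of rational functions -/

theorem fc_zpow (t j : ℤ) : fc (fun z => z ^ t) j = if j = t then 1 else 0 := by
  have h : fc (fun z => z ^ t) j = avg fun z => z ^ (t - j) := avg_congr fun z hz => by
    rw [← zpow_add₀ (PositiveForm.ne_zero_of_norm_eq_one hz), neg_add_eq_sub]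
  rw [h, avg_zpow]
  simp only [sub_eq_zero, eq_comm]

theorem fc_eval_natCast (f : ℂ[X]) (l : ℕ) : fc (fun z => f.eval z) l = f.coeff l := by
  have h : ∀ z, ‖z‖ = 1 → f.eval z = ∑ i ∈ f.support, f.coeff i * z ^ (i : ℤ) := fun z _ => by
    simp_rw [zpow_natCast]; exact Polynomial.eval_eq_sum
  rw [fc_congr h, fc_sum fun i _ => (CircleCont.zpow _).const_mul _]
  simp only [fc_const_mul, fc_zpow, Nat.cast_inj, mul_ite, mul_one, mul_zero, Finset.sum_ite_eq,
    Polynomial.mem_support_iff, ne_eq, ite_not]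
  split_ifs with h0
  · exact h0.symm
  · rfl

theorem fc_div_of_neg {a : ℂ[X]} (ha : ∀ w, ‖w‖ ≤ 1 → a.eval w ≠ 0) (b : ℂ[X]) {j : ℤ}
    (hj : j < 0) : fc (fun z => b.eval z / a.eval z) j = 0 := by
  obtain ⟨s, rfl⟩ := Int.eq_negSucc_of_lt_zero hj
  rw [← avg_pow_mul_div ha b s.succ_ne_zero]
  refine avg_congr fun z _ => ?_
  rw [Int.neg_negSucc, zpow_natCast]

theorem fc_eval_of_neg (f : ℂ[X]) {j : ℤ} (hj : j < 0) : fc (fun z => f.eval z) j = 0 := by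
  simpa using fc_div_of_neg (a := 1) (by simp) f hj

/-- Multiplication by a polynomial of degree at most `n` shifts the spectrum by at most `n`. -/
theorem fc_eval_mul {a : ℂ[X]} {n : ℕ} (ha : a.natDegree ≤ n) {F : ℂ → ℂ} (hF : CircleCont F)
    (j : ℤ) : fc (fun z => a.eval z * F z) j =
      ∑ i ∈ Finset.range (n + 1), a.coeff i * fc F (j - i) := by
  have h : ∀ z, ‖z‖ = 1 → a.eval z * F z =
      ∑ i ∈ Finset.range (n + 1), a.coeff i * (z ^ i * F z) := fun z _ => by
    rw [Polynomial.eval_eq_sum_range' (Nat.lt_succ_of_le ha), Finset.sum_mul]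
    simp_rw [mul_assoc]
  rw [fc_congr h, fc_sum fun i _ => ((CircleCont.pow i).mul hF).const_mul _]
  simp only [fc_const_mul, fc_pow_mul]

/-- A strictly proper rational function with all poles in the open unit disk has only negative
frequencies. -/
theorem fc_div_of_nonneg {a b : ℂ[X]} (ha : ∀ w, 1 ≤ ‖w‖ → a.eval w ≠ 0)
    (hab : b.degree < a.degree) {j : ℤ} (hj : 0 ≤ j) :
    fc (fun z => b.eval z / a.eval z) j = 0 := by
  rcases eq_or_ne b 0 with rfl | hb
  · simp [fc, avg_const]
  obtain ⟨d, hd⟩ : ∃ d, a.natDegree = d + 1 :=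
    Nat.exists_eq_succ_of_ne_zero fun h => by
      have := Polynomial.natDegree_lt_natDegree hb hab
      omega
  have hbd : b.natDegree ≤ d := by
    have := Polynomial.natDegree_lt_natDegree hb hab
    omega
  -- Reflection in the circle moves the zeros of `a` outside the closed disk. On the circle,
  -- conjugation then turns `b / a` into `z` times a function holomorphic on the disk; the factor
  -- `z` is the gap between the degrees.
  have hrev : ∀ w, ‖w‖ ≤ 1 → (crev (d + 1) a).eval w ≠ 0 := by
    intro w hw
    rcases eq_or_ne w 0 with rfl | hw0
    · rw [← Polynomial.coeff_zero_eq_eval_zero, coeff_crev, if_pos (Nat.zero_le _), Nat.sub_zero,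
        ← hd, map_ne_zero]
      change a.leadingCoeff ≠ 0
      rw [Polynomial.leadingCoeff_ne_zero]
      rintro rfl
      simp at hd
    · rw [eval_crev_of_ne_zero hd.le hw0]
      refine mul_ne_zero (pow_ne_zero _ hw0) ((map_ne_zero _).2 (ha _ ?_))
      rw [norm_inv, RCLike.norm_conj]
      exact (one_le_inv₀ (norm_pos_iff.2 hw0)).2 hw
  obtain ⟨s, rfl⟩ := Int.eq_ofNat_of_zero_le hj
  rw [← map_eq_zero (starRingEnd ℂ), fc, ← avg_conj, ← avg_pow_mul_div hrev (crev d b) s.succ_ne_zero]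
  refine avg_congr fun z hz => ?_
  have hz0 := PositiveForm.ne_zero_of_norm_eq_one hz
  have h1 : conj (a.eval z) ≠ 0 := (map_ne_zero _).2 (ha z hz.ge)
  rw [eval_crev hbd hz, eval_crev hd.le hz, map_mul, map_div₀, zpow_neg, zpow_natCast, map_inv₀,
    map_pow, conj_eq_inv hz, inv_pow, inv_inv]
  field_simp
  rw [Nat.succ_eq_add_one]
  ring

/-! ### Trigonometric polynomials -/

/-- `F` is on the unit circle a trigonometric polynomial of degree at most `n`. -/
def IsTrig (n : ℕ) (F : ℂ → ℂ) : Prop := ∃ γ : ℤ → ℂ, ∀ z, ‖z‖ = 1 →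
  F z = ∑ i ∈ Finset.Icc (-n : ℤ) n, γ i * z ^ i

namespace IsTrig

variable {n : ℕ} {F G : ℂ → ℂ}

theorem sub (hF : IsTrig n F) (hG : IsTrig n G) : IsTrig n fun z => F z - G z := by
  obtain ⟨γ, hγ⟩ := hF
  obtain ⟨δ, hδ⟩ := hG
  refine ⟨fun i => γ i - δ i, fun z hz => ?_⟩
  simp only [hγ z hz, hδ z hz, sub_mul, Finset.sum_sub_distrib]

theorem zero : IsTrig n fun _ => 0 := ⟨0, fun z _ => by simp⟩

theorem sum {ι : Type*} {s : Finset ι} {F : ι → ℂ → ℂ} (h : ∀ i ∈ s, IsTrig n (F i)) :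
    IsTrig n fun z => ∑ i ∈ s, F i z := by
  choose! γ hγ using h
  refine ⟨fun j => ∑ i ∈ s, γ i j, fun z hz => ?_⟩
  simp only [Finset.sum_mul]
  rw [Finset.sum_comm]
  exact Finset.sum_congr rfl fun i hi => hγ i hi z hz

theorem const_mul (c : ℂ) (hF : IsTrig n F) : IsTrig n fun z => c * F z := by
  obtain ⟨γ, hγ⟩ := hF
  exact ⟨fun i => c * γ i, fun z hz => by simp only [hγ z hz, Finset.mul_sum, mul_assoc]⟩

theorem zpow {j : ℤ} (h1 : -n ≤ j) (h2 : j ≤ n) : IsTrig n fun z => z ^ j :=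
  ⟨fun i => if i = j then 1 else 0, fun z _ => by simp [h1, h2]⟩

theorem congr (hF : IsTrig n F) (h : ∀ z, ‖z‖ = 1 → G z = F z) : IsTrig n G := by
  obtain ⟨γ, hγ⟩ := hF
  exact ⟨γ, fun z hz => (h z hz).trans (hγ z hz)⟩

theorem eval_mul_conj {a b : ℂ[X]} (ha : a.natDegree ≤ n) (hb : b.natDegree ≤ n) :
    IsTrig n fun z => a.eval z * conj (b.eval z) := by
  have h : IsTrig n fun z => ∑ i ∈ Finset.range (n + 1), ∑ j ∈ Finset.range (n + 1),
      (a.coeff i * conj (b.coeff j)) * z ^ ((i : ℤ) - j) := by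
    refine sum fun i hi => sum fun j hj => const_mul _ (zpow ?_ ?_) <;>
    · rw [Finset.mem_range] at hi hj
      omega
  refine h.congr fun z hz => ?_
  have hz0 := PositiveForm.ne_zero_of_norm_eq_one hz
  rw [Polynomial.eval_eq_sum_range' (Nat.lt_succ_of_le ha),
    Polynomial.eval_eq_sum_range' (Nat.lt_succ_of_le hb), map_sum, Finset.sum_mul_sum]
  refine Finset.sum_congr rfl fun i _ => Finset.sum_congr rfl fun j _ => ?_
  rw [map_mul, map_pow, conj_eq_inv hz, zpow_sub₀ hz0, zpow_natCast, zpow_natCast, inv_pow]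
  field_simp

end IsTrig

/-! ### Injectivity of block Toeplitz operators with positive symbol -/

/-- A block Toeplitz operator with positive symbol is injective on sequences that tend to `0`. -/
theorem toeplitz_injective {ι : Type*} [Fintype ι] {n : ℕ} {γ : ι → ι → ℤ → ℂ} {ε : ℝ}
    (hε : 0 < ε) {k₀ : ι} (hγ : ∀ z : ℂ, ‖z‖ = 1 → ∀ v : ι → ℂ, ε * ‖v k₀‖ ^ 2 ≤
      (∑ l, (∑ k, (∑ i ∈ Finset.Icc (-n : ℤ) n, γ k l i * z ^ i) * v k) * conj (v l)).re)
    {v : ℤ → ι → ℂ} (hneg : ∀ j < 0, v j = 0)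
    (hlim : ∀ k, Filter.Tendsto (fun j => v j k) Filter.atTop (nhds 0))
    (hT : ∀ j, 0 ≤ j → ∀ l, ∑ k, ∑ i ∈ Finset.Icc (-n : ℤ) n, γ k l i * v (j - i) k = 0)
    (j₀ : ℤ) : v j₀ k₀ = 0 := by
  classical
  -- `V K` is the truncation of the sequence at index `K`, so that positivity of the symbol can be
  -- used although the sequence is only known to tend to `0`. `F K` is the symbol applied to it.
  let V : ℤ → ι → ℂ → ℂ := fun K k z => ∑ j ∈ Finset.Icc 0 K, v j k * z ^ j
  let F : ℤ → ι → ℂ → ℂ := fun K l z =>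
    ∑ k, (∑ i ∈ Finset.Icc (-n : ℤ) n, γ k l i * z ^ i) * V K k z
  have hV : ∀ K k, CircleCont (V K k) := fun K k =>
    CircleCont.sum fun j _ => (CircleCont.zpow j).const_mul _
  have hF : ∀ K l, CircleCont (F K l) := fun K l => CircleCont.sum fun k _ =>
    (CircleCont.sum fun i _ => (CircleCont.zpow i).const_mul _).mul (hV K k)
  have hfcV : ∀ K k j, fc (V K k) j = if j ≤ K then v j k else 0 := by
    intro K k j
    have : fc (V K k) j = ∑ i ∈ Finset.Icc 0 K, v i k * if j = i then 1 else 0 := by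
      rw [show V K k = fun z => ∑ j ∈ Finset.Icc 0 K, v j k * z ^ j from rfl,
        fc_sum fun i _ => (CircleCont.zpow i).const_mul _]
      simp only [fc_const_mul, fc_zpow]
    rw [this]
    simp only [mul_ite, mul_one, mul_zero, Finset.sum_ite_eq, Finset.mem_Icc]
    by_cases h0 : 0 ≤ j
    · simp [h0]
    · simp [hneg j (not_le.1 h0)]
  have hfcF : ∀ K l j, fc (F K l) j = ∑ k, ∑ i ∈ Finset.Icc (-n : ℤ) n,
      γ k l i * if j - i ≤ K then v (j - i) k else 0 := by
    intro K l j
    have h1 : ∀ z, ‖z‖ = 1 → F K l z = ∑ k, ∑ i ∈ Finset.Icc (-n : ℤ) n,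
        γ k l i * (z ^ i * V K k z) := fun z _ => by
      simp only [F, Finset.sum_mul, mul_assoc]
    rw [fc_congr h1, fc_sum fun k _ => CircleCont.sum fun i _ =>
      ((CircleCont.zpow i).mul (hV K k)).const_mul _]
    refine Finset.sum_congr rfl fun k _ => ?_
    rw [fc_sum fun i _ => ((CircleCont.zpow i).mul (hV K k)).const_mul _]
    simp only [fc_const_mul, fc_zpow_mul, hfcV]
  have hQ : ∀ K l, avg (fun z => F K l z * conj (V K l z)) =
      ∑ j ∈ Finset.Icc 0 K, conj (v j l) * fc (F K l) j := by
    intro K l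
    have h1 : ∀ z, ‖z‖ = 1 → F K l z * conj (V K l z) =
        ∑ j ∈ Finset.Icc 0 K, conj (v j l) * (z ^ (-j) * F K l z) := fun z hz => by
      simp only [V, map_sum, map_mul, map_zpow₀, conj_eq_inv hz, Finset.mul_sum, inv_zpow, zpow_neg]
      exact Finset.sum_congr rfl fun j _ => by ring
    rw [avg_congr h1, avg_sum fun j _ => ((CircleCont.zpow _).mul (hF K l)).const_mul _]
    simp only [avg_const_mul, fc]
  -- The symbol has bandwidth `n`. For `j ≤ K - n` the truncation is not felt and the equation `hT`
  -- makes the coefficient of `F K` vanish; only the last `n` indices contribute to the quadratic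
  -- form.
  have hQ' : ∀ K : ℤ, n ≤ K → ∀ l, avg (fun z => F K l z * conj (V K l z)) =
      ∑ s ∈ Finset.range n, conj (v (K - s) l) * ∑ k, ∑ i ∈ Finset.Icc (-n : ℤ) n,
        γ k l i * if -(s : ℤ) ≤ i then v (K - s - i) k else 0 := by
    intro K hK l
    rw [hQ, ← Finset.sum_subset (s₁ := (Finset.range n).image fun s : ℕ => K - s)]
    · rw [Finset.sum_image fun a _ b _ hab => by simpa using hab]
      refine Finset.sum_congr rfl fun s _ => ?_
      rw [hfcF]
      refine congrArg _ (Finset.sum_congr rfl fun k _ => Finset.sum_congr rfl fun i _ => ?_)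
      congr 1
      exact if_congr (by omega) rfl rfl
    · intro j hj
      obtain ⟨s, hs, rfl⟩ := Finset.mem_image.1 hj
      rw [Finset.mem_range] at hs
      rw [Finset.mem_Icc]
      omega
    · intro j hj hj'
      rw [Finset.mem_Icc] at hj
      have hjK : j ≤ K - n := by
        by_contra hlt
        exact hj' (Finset.mem_image.2 ⟨(K - j).toNat, by rw [Finset.mem_range]; omega, by omega⟩)
      rw [hfcF, ← mul_zero (conj (v j l)), ← hT j hj.1 l]
      refine congrArg _ (Finset.sum_congr rfl fun k _ => Finset.sum_congr rfl fun i hi => ?_)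
      rw [Finset.mem_Icc] at hi
      rw [if_pos (by omega)]
  -- The number of boundary terms does not depend on `K`, and their entries tend to `0`.
  have hlim' : Filter.Tendsto (fun K : ℤ => ∑ l, ∑ s ∈ Finset.range n, conj (v (K - s) l) *
      ∑ k, ∑ i ∈ Finset.Icc (-n : ℤ) n, γ k l i * if -(s : ℤ) ≤ i then v (K - s - i) k else 0)
      Filter.atTop (nhds 0) := by
    have hz : (0 : ℂ) = ∑ l : ι, ∑ s ∈ Finset.range n, conj (0 : ℂ) *
        ∑ k : ι, ∑ i ∈ Finset.Icc (-n : ℤ) n, γ k l i * 0 := by simp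
    rw [congrArg nhds hz]
    have hsh : ∀ (t : ℤ) k, Filter.Tendsto (fun K => v (K - t) k) Filter.atTop (nhds 0) := fun t k =>
      (hlim k).comp (Filter.tendsto_atTop_add_const_right _ (-t) Filter.tendsto_id)
    refine tendsto_finsetSum _ fun l _ => tendsto_finsetSum _ fun s _ => ?_
    refine ((Complex.continuous_conj.tendsto 0).comp (hsh s l)).mul ?_
    refine tendsto_finsetSum _ fun k _ => tendsto_finsetSum _ fun i _ => ?_
    refine tendsto_const_nhds.mul ?_
    split_ifs
    · simp_rw [sub_sub]
      exact hsh _ k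
    · exact tendsto_const_nhds
  have hbound : ∀ K : ℤ, n ≤ K → j₀ ≤ K → ε * ‖v j₀ k₀‖ ^ 2 ≤
      (∑ l, ∑ s ∈ Finset.range n, conj (v (K - s) l) * ∑ k, ∑ i ∈ Finset.Icc (-n : ℤ) n,
        γ k l i * if -(s : ℤ) ≤ i then v (K - s - i) k else 0).re := by
    intro K hK hj
    simp_rw [← hQ' K hK]
    rw [← avg_sum fun l _ => (hF K l).mul (hV K l).conjugate]
    have h1 : ε * ‖v j₀ k₀‖ ^ 2 ≤ ε * (avg fun z => V K k₀ z * conj (V K k₀ z)).re := by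
      refine mul_le_mul_of_nonneg_left ?_ hε.le
      have := le_hasSum (hasSum_sq_fc' (hV K k₀)) j₀ fun j _ => sq_nonneg _
      rwa [hfcV, if_pos hj] at this
    refine h1.trans ?_
    rw [← Complex.re_ofReal_mul, ← avg_const_mul]
    refine re_avg_mono (((hV K k₀).mul (hV K k₀).conjugate).const_mul _)
      (CircleCont.sum fun l _ => (hF K l).mul (hV K l).conjugate) fun z hz => ?_
    rw [Complex.mul_conj, ← Complex.ofReal_mul, Complex.ofReal_re, Complex.normSq_eq_norm_sq]
    exact hγ z hz fun k => V K k z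
  have h0 : ε * ‖v j₀ k₀‖ ^ 2 ≤ 0 := by
    refine ge_of_tendsto ((Complex.continuous_re.tendsto 0).comp hlim') ?_
    filter_upwards [Filter.eventually_ge_atTop (n : ℤ), Filter.eventually_ge_atTop j₀] with K h1 h2
    exact hbound K h1 h2
  have h1 : ‖v j₀ k₀‖ ^ 2 ≤ 0 := nonpos_of_mul_nonpos_right h0 hε
  exact norm_eq_zero.1 (pow_eq_zero_iff two_ne_zero |>.1 (le_antisymm h1 (sq_nonneg _)))

end

end BernsteinSzego

namespace BernsteinSzego

noncomputable section

open scoped Polynomial ComplexConjugate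

/-! ### The inverse of the Gram matrix of `1, w, …, w ^ (m - 1)` -/

/-- The polynomial that represents the `l`-th coefficient on polynomials of degree less than `m`;
its coefficients are given by the Gohberg-Semencul formula. -/
def coeffRep (m : ℕ) (a : ℂ[X]) (l : ℕ) : ℂ[X] := ∑ i ∈ Finset.range (l + 1), Polynomial.X ^ i *
  (Polynomial.C (conj (a.coeff (l - i))) * a -
    Polynomial.C (conj ((crev m a).coeff (l - i))) * crev m a)

theorem coeff_coeffRep (m : ℕ) (a : ℂ[X]) (l k : ℕ) :
    (coeffRep m a l).coeff k = ∑ i ∈ Finset.range (l + 1), if i ≤ k then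
      a.coeff (k - i) * conj (a.coeff (l - i)) -
        (crev m a).coeff (k - i) * conj ((crev m a).coeff (l - i)) else 0 := by
  rw [coeffRep, Polynomial.finsetSum_coeff]
  refine Finset.sum_congr rfl fun i _ => ?_
  rw [Polynomial.coeff_X_pow_mul', Polynomial.coeff_sub, Polynomial.coeff_C_mul,
    Polynomial.coeff_C_mul, mul_comm (conj _), mul_comm (conj _)]

/-- The two products in the Gohberg-Semencul formula cancel beyond degree `m - 1`: in the range
where neither factor vanishes, the sum for `a` becomes the sum for its reversal after `t ↦ L - t`.
-/
theorem coeff_coeffRep_eq_zero {m : ℕ} {a : ℂ[X]} (ha : a.natDegree ≤ m) {l k : ℕ} (hl : l < m)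
    (hk : m ≤ k) : (coeffRep m a l).coeff k = 0 := by
  have hsmall : ∀ i, m < k - i → (if i ≤ k then a.coeff (k - i) * conj (a.coeff (l - i)) -
        (crev m a).coeff (k - i) * conj ((crev m a).coeff (l - i)) else 0) = 0 := by
    intro i hi
    rw [Polynomial.coeff_eq_zero_of_natDegree_lt (ha.trans_lt hi), coeff_crev, if_neg (not_le.2 hi)]
    simp
  rw [coeff_coeffRep]
  rcases lt_or_ge l (k - m) with h | h
  · refine Finset.sum_eq_zero fun i hi => hsmall i ?_
    rw [Finset.mem_range] at hi
    omega
  · obtain ⟨L, rfl⟩ := Nat.exists_eq_add_of_le h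
    rw [show k - m + L + 1 = (k - m) + (L + 1) by ring, Finset.sum_range_add, Finset.sum_eq_zero,
      zero_add]
    · have h1 : ∀ t ∈ Finset.range (L + 1), (if k - m + t ≤ k then
          a.coeff (k - (k - m + t)) * conj (a.coeff (k - m + L - (k - m + t))) -
          (crev m a).coeff (k - (k - m + t)) * conj ((crev m a).coeff (k - m + L - (k - m + t)))
          else 0) = a.coeff (m - t) * conj (a.coeff (L - t)) -
            conj (a.coeff t) * a.coeff (m - (L - t)) := by
        intro t ht
        rw [Finset.mem_range] at ht
        rw [if_pos (by omega), show k - (k - m + t) = m - t by omega,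
          show k - m + L - (k - m + t) = L - t by omega, coeff_crev, coeff_crev,
          if_pos (by omega), if_pos (by omega), Complex.conj_conj, show m - (m - t) = t by omega]
      rw [Finset.sum_congr rfl h1, Finset.sum_sub_distrib, sub_eq_zero, ← Finset.sum_range_reflect]
      refine Finset.sum_congr rfl fun t ht => ?_
      rw [Finset.mem_range] at ht
      rw [show L + 1 - 1 - t = L - t by omega, show L - (L - t) = t by omega, mul_comm]
    · intro i hi
      rw [Finset.mem_range] at hi
      exact hsmall i (by omega)

theorem coeffRep_eq_sum {m : ℕ} {a : ℂ[X]} (ha : a.natDegree ≤ m) {l : ℕ} (hl : l < m) :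
    coeffRep m a l = ∑ k ∈ Finset.range m, (coeffRep m a l).coeff k • Polynomial.X ^ k := by
  ext j
  simp only [Polynomial.finsetSum_coeff, Polynomial.coeff_smul, Polynomial.coeff_X_pow, smul_eq_mul,
    mul_ite, mul_one, mul_zero, Finset.sum_ite_eq, Finset.mem_range]
  split_ifs with h
  · rfl
  · exact coeff_coeffRep_eq_zero ha hl (not_lt.1 h)

section

variable {a : ℂ[X]} (ha : ∀ w, ‖w‖ ≤ 1 → a.eval w ≠ 0)
include ha

/-- After conjugation the integrand is a positive power of `w` times a polynomial over `a`. The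
strict bound on the degree of `f` supplies the power that is needed when `i = 0`. -/
theorem ip_crev_eq_zero {m : ℕ} (hm : a.natDegree ≤ m) {f : ℂ[X]} (hf : f.natDegree < m) (i : ℕ) :
    ip a f (Polynomial.X ^ i * crev m a) = 0 := by
  obtain ⟨s, rfl⟩ : ∃ s, m = s + 1 := ⟨m - 1, by omega⟩
  rw [← map_eq_zero (starRingEnd ℂ), ip, ← avg_conj,
    ← avg_pow_mul_div ha (crev s f) i.succ_ne_zero]
  refine avg_congr fun w hw => ?_
  have hw0 := PositiveForm.ne_zero_of_norm_eq_one hw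
  have h1 := ha w hw.le
  have h2 : conj (a.eval w) ≠ 0 := (map_ne_zero _).2 h1
  rw [Polynomial.eval_mul, Polynomial.eval_pow, Polynomial.eval_X, eval_crev hm hw,
    eval_crev (Nat.lt_succ_iff.1 hf) hw]
  simp only [map_mul, map_div₀, Complex.conj_conj]
  field_simp
  rw [Nat.succ_eq_add_one]
  ring

theorem circleCont_div (f : ℂ[X]) : CircleCont fun w => f.eval w / a.eval w :=
  (CircleCont.polynomial f).div (CircleCont.polynomial a) fun w hw => ha w hw.le

theorem ip_X_pow_mul_self (f : ℂ[X]) (i : ℕ) :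
    ip a f (Polynomial.X ^ i * a) = fc (fun w => f.eval w / a.eval w) i := by
  refine avg_congr fun w hw => ?_
  have h1 := ha w hw.le
  have h2 : conj (a.eval w) ≠ 0 := (map_ne_zero _).2 h1
  rw [Polynomial.eval_mul, Polynomial.eval_pow, Polynomial.eval_X, map_mul, map_pow, conj_eq_inv hw,
    zpow_neg, zpow_natCast, inv_pow]
  field_simp

/-- The part with the reversal of `a` is orthogonal to `f`. What remains is the convolution of the
coefficients of `a` with those of `f / a`, which has no negative frequencies, hence the coefficient
of `a (f / a) = f`. -/
theorem ip_coeffRep {m : ℕ} (hm : a.natDegree ≤ m) {f : ℂ[X]} (hf : f.natDegree < m) {l : ℕ} :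
    ip a f (coeffRep m a l) = f.coeff l := by
  have h1 : ∀ i, ip a f (Polynomial.X ^ i * (Polynomial.C (conj (a.coeff (l - i))) * a -
      Polynomial.C (conj ((crev m a).coeff (l - i))) * crev m a)) =
      a.coeff (l - i) * fc (fun w => f.eval w / a.eval w) i := by
    intro i
    have : Polynomial.X ^ i * (Polynomial.C (conj (a.coeff (l - i))) * a -
      Polynomial.C (conj ((crev m a).coeff (l - i))) * crev m a) =
      conj (a.coeff (l - i)) • (Polynomial.X ^ i * a) +
        (-conj ((crev m a).coeff (l - i))) • (Polynomial.X ^ i * crev m a) := by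
      simp only [Polynomial.smul_eq_C_mul, Polynomial.C_neg]
      ring
    rw [this, ip_add_right ha, ip_smul_right, ip_smul_right, ip_crev_eq_zero ha hm hf,
      ip_X_pow_mul_self ha, mul_zero, add_zero, Complex.conj_conj]
  rw [coeffRep, ip_sum_right ha, Finset.sum_congr rfl fun i _ => h1 i]
  have h2 : ∀ w, ‖w‖ = 1 → f.eval w = a.eval w * (f.eval w / a.eval w) := fun w hw => by
    rw [mul_div_cancel₀ _ (ha w hw.le)]
  rw [← fc_eval_natCast, fc_congr h2, fc_eval_mul (n := m + l) (by omega) (circleCont_div ha f),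
    ← Finset.sum_range_reflect]
  have h3 : ∑ i ∈ Finset.range (m + l + 1), a.coeff i *
      fc (fun w => f.eval w / a.eval w) (l - i) = ∑ i ∈ Finset.range (l + 1), a.coeff i *
      fc (fun w => f.eval w / a.eval w) (l - i) := by
    refine (Finset.sum_subset (Finset.range_mono (by omega)) fun i _ hi => ?_).symm
    rw [Finset.mem_range] at hi
    rw [fc_div_of_neg ha f (by omega), mul_zero]
  rw [h3]
  refine Finset.sum_congr rfl fun i hi => ?_
  rw [Finset.mem_range] at hi
  rw [show l + 1 - 1 - i = l - i by omega, show l - (l - i) = i by omega, Nat.cast_sub (by omega)]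

/-- The coefficients of a polynomial of degree less than `m` in terms of its inner products with
`1, w, …, w ^ (m - 1)`. -/
theorem coeff_eq_sum_ip {m : ℕ} (hm : a.natDegree ≤ m) {f : ℂ[X]} (hf : f.natDegree < m) {l : ℕ}
    (hl : l < m) : f.coeff l = ∑ k : Fin m, conj ((coeffRep m a l).coeff k) *
      ip a f (Polynomial.X ^ (k : ℕ)) := by
  rw [← ip_coeffRep ha hm hf (l := l), coeffRep_eq_sum hm hl, ip_sum_right ha]
  rw [← Fin.sum_univ_eq_sum_range (fun k => ip a f ((coeffRep m a l).coeff k • Polynomial.X ^ k)) m,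
    ← coeffRep_eq_sum hm hl]
  simp only [ip_smul_right]

/-- The inverse of the Gram matrix is positive. -/
theorem sum_coeffRep_pos {m : ℕ} (hm : a.natDegree ≤ m) {v : Fin m → ℂ} (hv : v ≠ 0) :
    0 < (∑ l : Fin m, (∑ k : Fin m, conj ((coeffRep m a l).coeff k) * v k) * conj (v l)).re := by
  obtain ⟨P, hP⟩ : ∃ P : (Fin m → ℂ) →ₗ[ℂ] ℂ[X],
      ∀ x, P x = ∑ l : Fin m, x l • Polynomial.X ^ (l : ℕ) := ⟨
    { toFun := fun x => ∑ l : Fin m, x l • Polynomial.X ^ (l : ℕ)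
      map_add' := fun x y => by simp only [Pi.add_apply, add_smul, Finset.sum_add_distrib]
      map_smul' := fun c x => by simp [Finset.smul_sum, mul_smul] }, fun _ => rfl⟩
  -- `L` is the conjugate of the Gram matrix up to transposition conventions: it sends coefficients
  -- to inner products with powers of `w`.
  let L : (Fin m → ℂ) →ₗ[ℂ] (Fin m → ℂ) :=
    { toFun := fun x k => ip a (P x) (Polynomial.X ^ (k : ℕ))
      map_add' := fun x y => by ext k; simp only [map_add, ip_add_left ha, Pi.add_apply]
      map_smul' := fun c x => by
        ext k; simp only [map_smul, ip_smul_left, Pi.smul_apply, smul_eq_mul, RingHom.id_apply] }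
  have hm0 : 0 < m := by
    rcases Nat.eq_zero_or_pos m with rfl | h
    · exact absurd (Subsingleton.elim v 0) hv
    · exact h
  have hcoeff : ∀ x (l : Fin m), (P x).coeff l = x l := by
    intro x l
    simp [hP, Polynomial.finsetSum_coeff, Polynomial.coeff_X_pow, Fin.val_inj]
  have hdeg : ∀ x, (P x).natDegree < m := by
    intro x
    rw [Nat.lt_iff_le_pred hm0]
    rw [hP]
    refine Polynomial.natDegree_sum_le_of_forall_le _ _ fun i _ => ?_
    refine (Polynomial.natDegree_smul_le _ _).trans ?_
    rw [Polynomial.natDegree_X_pow]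
    omega
  have hip : ∀ x, ip a (P x) (P x) = ∑ l, x l * conj (L x l) := by
    intro x
    conv_lhs => rw [← conj_ip]; rhs; rhs; rw [hP]
    rw [ip_sum_right ha, map_sum]
    refine Finset.sum_congr rfl fun l _ => ?_
    rw [ip_smul_right, map_mul, Complex.conj_conj]
    rfl
  have hinj : Function.Injective L := by
    rw [← LinearMap.ker_eq_bot, LinearMap.ker_eq_bot']
    intro x hx
    by_contra h0
    have hPx : P x ≠ 0 := fun h => h0 (funext fun l => by rw [← hcoeff x l, h]; simp)
    have := ip_self_pos ha hPx
    rw [hip, hx] at this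
    simp at this
  -- With `v = L x` the form becomes the squared norm of the polynomial with coefficients `x`.
  obtain ⟨x, rfl⟩ := LinearMap.injective_iff_surjective.1 hinj v
  have hx : ∀ l : Fin m, ∑ k : Fin m, conj ((coeffRep m a l).coeff k) * L x k = x l := fun l => by
    rw [← hcoeff x l, coeff_eq_sum_ip ha hm (hdeg x) l.2]
    rfl
  simp only [hx]
  rw [← hip]
  refine ip_self_pos ha fun h => hv ?_
  have : x = 0 := funext fun l => by rw [← hcoeff x l, h]; simp
  rw [this, map_zero]

/-- The decomposition `f = c a + w h`, where `h` is expressed by the inner products of `f` with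
`w, …, w ^ m`. -/
theorem coeff_succ_eq {m : ℕ} (hm : a.natDegree ≤ m) {f : ℂ[X]} (hf : f.natDegree ≤ m) {l : ℕ}
    (hl : l < m) : f.coeff (l + 1) = f.eval 0 / a.eval 0 * a.coeff (l + 1) +
      ∑ k : Fin m, conj ((coeffRep m a l).coeff k) * ip a f (Polynomial.X ^ (k + 1 : ℕ)) := by
  set c := f.eval 0 / a.eval 0 with hc
  set h := (f - c • a).divX with hh
  have h0 : (f - c • a).coeff 0 = 0 := by
    rw [Polynomial.coeff_sub, Polynomial.coeff_smul, Polynomial.coeff_zero_eq_eval_zero,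
      Polynomial.coeff_zero_eq_eval_zero, smul_eq_mul, hc, div_mul_cancel₀ _ (ha 0 (by simp)), sub_self]
  have hX : f = c • a + Polynomial.X * h := by
    have := Polynomial.X_mul_divX_add (f - c • a)
    rw [h0, map_zero, add_zero] at this
    rw [hh, this]
    ring
  have hdeg : h.natDegree < m := by
    rw [hh, Polynomial.natDegree_divX_eq_natDegree_tsub_one]
    have h1 : (f - c • a).natDegree ≤ m := (Polynomial.natDegree_sub_le _ _).trans
      (max_le hf ((Polynomial.natDegree_smul_le _ _).trans hm))
    omega
  have hcoeff : h.coeff l = f.coeff (l + 1) - c * a.coeff (l + 1) := by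
    rw [hh, Polynomial.coeff_divX, Polynomial.coeff_sub, Polynomial.coeff_smul, smul_eq_mul]
  -- Since `a` is orthogonal to the multiples of `w`, these inner products see only `h`.
  have hip : ∀ k : ℕ, ip a f (Polynomial.X ^ (k + 1)) = ip a h (Polynomial.X ^ k) := by
    intro k
    rw [hX, ip_add_left ha, ip_smul_left, pow_succ', ip_self_X_mul ha, ip_X_mul, mul_zero, zero_add]
  simp only [hip]
  rw [← coeff_eq_sum_ip ha hm hdeg hl, hcoeff]
  ring

/-- Expand `g` along `a, w, …, w ^ m` and use `⟨f, a⟩ = f(0) / a(0)`. This separates the value at `w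
= 0` from the inner products with the powers of `w`. -/
theorem ip_eq_sum {m : ℕ} (hm : a.natDegree ≤ m) (f : ℂ[X]) {g : ℂ[X]} (hg : g.natDegree ≤ m) :
    ip a f g = f.eval 0 / a.eval 0 * conj (g.eval 0 / a.eval 0) +
      ∑ l : Fin m, ip a f (Polynomial.X ^ (l + 1 : ℕ)) *
        conj (g.coeff (l + 1) - g.eval 0 / a.eval 0 * a.coeff (l + 1)) := by
  have hself : ∀ f : ℂ[X], ∃ h, f = (f.eval 0 / a.eval 0) • a + Polynomial.X * h := by
    intro f
    set c := f.eval 0 / a.eval 0 with hc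
    have h0 : (f - c • a).coeff 0 = 0 := by
      rw [Polynomial.coeff_sub, Polynomial.coeff_smul, Polynomial.coeff_zero_eq_eval_zero,
        Polynomial.coeff_zero_eq_eval_zero, smul_eq_mul, hc, div_mul_cancel₀ _ (ha 0 (by simp)), sub_self]
    refine ⟨(f - c • a).divX, ?_⟩
    have := Polynomial.X_mul_divX_add (f - c • a)
    rw [h0, map_zero, add_zero] at this
    rw [this]
    ring
  have hfa : ip a f a = f.eval 0 / a.eval 0 := by
    obtain ⟨h, hh⟩ := hself f
    conv_lhs => rw [hh]
    rw [ip_add_left ha, ip_smul_left, ip_self_self ha, ← conj_ip a (Polynomial.X * h),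
      ip_self_X_mul ha, map_zero, mul_one, add_zero]
  set c := g.eval 0 / a.eval 0 with hc
  have hg' : g = c • a + ∑ l : Fin m, (g.coeff (l + 1) - c * a.coeff (l + 1)) •
      Polynomial.X ^ (l + 1 : ℕ) := by
    ext j
    simp only [Polynomial.coeff_add, Polynomial.finsetSum_coeff, Polynomial.coeff_smul,
      Polynomial.coeff_X_pow, smul_eq_mul, mul_ite, mul_one, mul_zero]
    rcases j with _ | j
    · rw [Finset.sum_eq_zero fun l _ => if_neg (by omega), add_zero,
        Polynomial.coeff_zero_eq_eval_zero, Polynomial.coeff_zero_eq_eval_zero, hc,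
        div_mul_cancel₀ _ (ha 0 (by simp))]
    · rcases lt_or_ge j m with hj | hj
      · rw [Finset.sum_eq_single ⟨j, hj⟩ (fun l _ hl => if_neg fun h => hl (Fin.ext (by simpa using h.symm)))
          (fun h => absurd (Finset.mem_univ _) h), if_pos rfl]
        ring
      · rw [Finset.sum_eq_zero fun l _ => if_neg (by omega),
          Polynomial.coeff_eq_zero_of_natDegree_lt (by omega),
          Polynomial.coeff_eq_zero_of_natDegree_lt (p := a) (by omega)]
        ring
  conv_lhs => rw [hg']
  rw [ip_add_right ha, ip_smul_right, hfa, ip_sum_right ha, mul_comm]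
  simp only [ip_smul_right]
  congr 1
  exact Finset.sum_congr rfl fun l _ => mul_comm _ _

end

end

end BernsteinSzego

namespace BernsteinSzego

noncomputable section

open scoped Polynomial ComplexConjugate InnerProductSpace

/-! ### Fourier coefficients of the slices -/

/-- The value at `w = 0` of `f / p`. -/
def valQuot (p f : Poly2) (z : ℂ) : ℂ := (slice z f).eval 0 / (slice z p).eval 0

/-- The inner products of the slices of `f` with `w, w ^ 2, …`. -/
def powInner (p f : Poly2) (k : ℕ) (z : ℂ) : ℂ :=
  ip (slice z p) (slice z f) (Polynomial.X ^ (k + 1))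

variable {p : Poly2} {n m : ℕ}

theorem valQuot_eq (p f : Poly2) (z : ℂ) :
    valQuot p f z = (atWZero f).eval z / (atWZero p).eval z := by
  simp only [valQuot, eval_slice, atWZero_eval]

theorem circleCont_valQuot (hp : NoZerosOnFace p) (f : Poly2) : CircleCont (valQuot p f) := by
  refine ((CircleCont.polynomial (atWZero f)).div (CircleCont.polynomial (atWZero p))
    fun z hz => ?_).congr fun z _ => valQuot_eq p f z
  rw [atWZero_eval]
  exact hp z 0 hz (by simp)

theorem circleCont_powInner (hp : NoZerosOnFace p) (f : Poly2) (k : ℕ) :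
    CircleCont (powInner p f k) :=
  (circleCont_bs hp f (MvPolynomial.X 1 ^ (k + 1))).congr fun z _ => by
    rw [powInner, slice_pow, slice_X1]

/-- This links spectra and orthogonality: being orthogonal to `z ^ s w ^ (k + 1)` on the torus is
the vanishing of one Fourier coefficient. -/
theorem fc_powInner_natCast (f : Poly2) (k s : ℕ) : fc (powInner p f k) s =
    bs p f (MvPolynomial.X 0 ^ s * MvPolynomial.X 1 ^ (k + 1)) := by
  refine avg_congr fun z hz => ?_
  rw [slice_mul, slice_pow, slice_pow, slice_X0, slice_X1, ← Polynomial.C_pow,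
    ← Polynomial.smul_eq_C_mul, ip_smul_right, powInner, map_pow, conj_eq_inv hz, zpow_neg,
    zpow_natCast, inv_pow]

theorem fc_powInner_X0_mul (f : Poly2) (k : ℕ) (j : ℤ) :
    fc (powInner p (MvPolynomial.X 0 * f) k) j = fc (powInner p f k) (j - 1) := by
  rw [← fc_zpow_mul]
  refine fc_congr (fun z _ => ?_) j
  rw [powInner, slice_mul, slice_X0, ← Polynomial.smul_eq_C_mul, ip_smul_left, zpow_one, powInner]

/-- The entries are sums of products of a coefficient of `p(z, ·)` with a conjugate of another one,
each polynomial in `z` of degree at most `n`. The bandwidth thus matches the number of coefficients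
that vanish on `E1 (n - 1) m`. -/
theorem isTrig_coeffRep (hpm : p ∈ polySpace n m) (k l : ℕ) :
    IsTrig n fun z => conj ((coeffRep m (slice z p) l).coeff k) := by
  have hdeg := natDegree_coeff_bi_le hpm
  have h : IsTrig n fun z => ∑ i ∈ Finset.range (l + 1), conj (if i ≤ k then
      (slice z p).coeff (k - i) * conj ((slice z p).coeff (l - i)) -
        (crev m (slice z p)).coeff (k - i) * conj ((crev m (slice z p)).coeff (l - i)) else 0) := by
    refine IsTrig.sum fun i _ => ?_
    split_ifs with h1
    · have h2 : IsTrig n fun z => (if k - i ≤ m then if l - i ≤ m then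
          ((bi p).coeff (m - (k - i))).eval z * conj (((bi p).coeff (m - (l - i))).eval z)
          else 0 else 0) := by
        split_ifs
        · exact IsTrig.eval_mul_conj (hdeg _) (hdeg _)
        · exact IsTrig.zero
        · exact IsTrig.zero
      refine ((IsTrig.eval_mul_conj (hdeg (l - i)) (hdeg (k - i))).sub h2).congr fun z _ => ?_
      simp only [coeff_crev, coeff_slice]
      split_ifs <;> simp [mul_comm]
    · simpa using IsTrig.zero
  refine h.congr fun z _ => ?_
  rw [coeff_coeffRep, map_sum]

/-- Positivity at each point is `sum_coeffRep_pos`; compactness of the product of the circle and the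
unit sphere makes it uniform. -/
theorem exists_symbol (hp : NoZerosOnFace p) (hpm : p ∈ polySpace n m) :
    ∃ (γ : Fin m → Fin m → ℤ → ℂ) (ε : ℝ), 0 < ε ∧
      (∀ k l : Fin m, ∀ z : ℂ, ‖z‖ = 1 → conj ((coeffRep m (slice z p) l).coeff k) =
        ∑ i ∈ Finset.Icc (-n : ℤ) n, γ k l i * z ^ i) ∧
      ∀ z : ℂ, ‖z‖ = 1 → ∀ (v : Fin m → ℂ) (k₀ : Fin m), ε * ‖v k₀‖ ^ 2 ≤
        (∑ l, (∑ k, (∑ i ∈ Finset.Icc (-n : ℤ) n, γ k l i * z ^ i) * v k) * conj (v l)).re := by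
  choose γ hγ using fun k l : Fin m => isTrig_coeffRep hpm (k : ℕ) (l : ℕ)
  let Q : ℂ → (Fin m → ℂ) → ℂ := fun z v =>
    ∑ l, (∑ k, (∑ i ∈ Finset.Icc (-n : ℤ) n, γ k l i * z ^ i) * v k) * conj (v l)
  have hpos : ∀ z, ‖z‖ = 1 → ∀ v, v ≠ 0 → 0 < (Q z v).re := by
    intro z hz v hv
    have := sum_coeffRep_pos (hp.slice_ne_zero hz) (natDegree_slice_le hpm z) hv
    simp only [hγ _ _ z hz] at this
    exact this
  have hcont : ContinuousOn (fun x : ℂ × (Fin m → ℂ) => (Q x.1 x.2).re)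
      (Metric.sphere 0 1 ×ˢ Metric.sphere 0 1) := by
    refine Complex.continuous_re.comp_continuousOn ?_
    refine continuousOn_finsetSum _ fun l _ => ContinuousOn.mul ?_ ?_
    · refine continuousOn_finsetSum _ fun k _ => ContinuousOn.mul ?_ ?_
      · refine continuousOn_finsetSum _ fun i _ => continuousOn_const.mul ?_
        refine continuousOn_fst.zpow₀ i fun x hx => Or.inl ?_
        exact PositiveForm.ne_zero_of_norm_eq_one (by simpa using hx.1)
      · exact ((continuous_apply k).comp continuous_snd).continuousOn
    · exact (Complex.continuous_conj.comp ((continuous_apply l).comp continuous_snd)).continuousOn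
  obtain ⟨ε, hε, hmin⟩ := ((isCompact_sphere (0 : ℂ) 1).prod
    (isCompact_sphere (0 : Fin m → ℂ) 1)).exists_forall_le' hcont (a := 0) fun x hx =>
      hpos x.1 (by simpa using hx.1) x.2 fun h0 => by simpa [h0] using hx.2
  refine ⟨γ, ε, hε, fun k l z hz => hγ k l z hz, fun z hz v k₀ => ?_⟩
  change _ ≤ (Q z v).re
  rcases eq_or_ne v 0 with rfl | hv
  · simp [Q]
  have hv' : 0 < ‖v‖ := norm_pos_iff.2 hv
  have h1 := hmin (z, (‖v‖⁻¹ : ℂ) • v) ⟨by simpa using hz, by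
    rw [mem_sphere_zero_iff_norm, norm_smul, norm_inv, Complex.norm_real, norm_norm,
      inv_mul_cancel₀ hv'.ne']⟩
  have h2 : Q z ((‖v‖⁻¹ : ℂ) • v) = ((‖v‖⁻¹ ^ 2 : ℝ) : ℂ) * Q z v := by
    simp only [Q, Pi.smul_apply, smul_eq_mul, map_mul, map_inv₀, Complex.conj_ofReal,
      Finset.mul_sum, Finset.sum_mul]
    refine Finset.sum_congr rfl fun l _ => Finset.sum_congr rfl fun k _ =>
      Finset.sum_congr rfl fun i _ => ?_
    push_cast
    ring
  simp only at h1
  rw [h2, Complex.re_ofReal_mul] at h1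
  have h3 : ε * ‖v‖ ^ 2 ≤ (Q z v).re := by
    have := mul_le_mul_of_nonneg_left h1 (sq_nonneg ‖v‖)
    rwa [← mul_assoc, ← mul_pow, mul_inv_cancel₀ hv'.ne', one_pow, one_mul, mul_comm] at this
  refine le_trans ?_ h3
  gcongr
  exact norm_le_pi_norm v k₀

theorem fc_sub {F G : ℂ → ℂ} (hF : CircleCont F) (hG : CircleCont G) (j : ℤ) :
    fc (fun z => F z - G z) j = fc F j - fc G j := by
  simp only [fc, mul_sub]
  exact avg_sub ((CircleCont.zpow _).mul hF) ((CircleCont.zpow _).mul hG)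

/-- The Fourier coefficients of `c a + w h = f`. -/
theorem sum_symbol_eq (hp : NoZerosOnFace p) (hpm : p ∈ polySpace n m)
    {γ : Fin m → Fin m → ℤ → ℂ}
    (hγ : ∀ k l : Fin m, ∀ z : ℂ, ‖z‖ = 1 → conj ((coeffRep m (slice z p) l).coeff k) =
        ∑ i ∈ Finset.Icc (-n : ℤ) n, γ k l i * z ^ i) {f : Poly2} (hf : f ∈ polySpace n m)
    (l : Fin m) (j : ℤ) :
    ∑ k, ∑ i ∈ Finset.Icc (-n : ℤ) n, γ k l i * fc (powInner p f k) (j - i) =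
      fc (fun z => ((bi f).coeff (l + 1)).eval z) j - ∑ i ∈ Finset.range (n + 1),
        ((bi p).coeff (l + 1)).coeff i * fc (valQuot p f) (j - i) := by
  have hc := circleCont_valQuot hp f
  have hu := circleCont_powInner hp f
  have h1 : ∀ z, ‖z‖ = 1 → ∑ k, ∑ i ∈ Finset.Icc (-n : ℤ) n, γ k l i *
      (z ^ i * powInner p f k z) = ((bi f).coeff (l + 1)).eval z -
        ((bi p).coeff (l + 1)).eval z * valQuot p f z := by
    intro z hz
    have := coeff_succ_eq (hp.slice_ne_zero hz) (natDegree_slice_le hpm z)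
      (natDegree_slice_le hf z) l.2
    rw [coeff_slice, coeff_slice] at this
    rw [this]
    simp only [hγ _ _ z hz, Finset.sum_mul, mul_assoc]
    rw [valQuot, mul_comm (Polynomial.eval z _), add_sub_cancel_left]
    rfl
  rw [← fc_eval_mul (natDegree_coeff_bi_le hpm _) hc, ← fc_sub (CircleCont.polynomial _)
    ((CircleCont.polynomial _).mul hc), ← fc_congr h1, fc_sum fun (k : Fin m) _ => CircleCont.sum fun i _ =>
      ((CircleCont.zpow i).mul (hu k)).const_mul _]
  refine Finset.sum_congr rfl fun k _ => ?_
  rw [fc_sum fun i _ => ((CircleCont.zpow i).mul (hu k)).const_mul _]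
  simp only [fc_const_mul, fc_zpow_mul]

theorem atTop_le_cofinite : (Filter.atTop : Filter ℤ) ≤ Filter.cofinite := by
  rw [Int.cofinite_eq]; exact le_sup_right

/-- The coefficients from index `n` on solve a homogeneous Toeplitz equation: there, `f` has no
coefficients and `c` none of the frequencies involved. The zeros at `0, …, n - 1` decouple them from
the negative indices. -/
theorem fc_powInner_eq_zero_of_nonneg (hp : NoZerosOnFace p) (hpm : p ∈ polySpace n m) {f : Poly2}
    (hf : f ∈ polySpace (n - 1) m) (hc : ∀ j, 0 ≤ j → fc (valQuot p f) j = 0)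
    (hu : ∀ k : Fin m, ∀ j : ℤ, 0 ≤ j → j < n → fc (powInner p f k) j = 0) (k : Fin m) {j : ℤ}
    (hj : 0 ≤ j) : fc (powInner p f k) j = 0 := by
  rcases lt_or_ge j n with hjn | hjn
  · exact hu k j hj hjn
  obtain ⟨γ, ε, hε, hγ, hpos⟩ := exists_symbol hp hpm
  have hf' : f ∈ polySpace n m := polySpace_mono (by omega) le_rfl hf
  let v : ℤ → Fin m → ℂ := fun j k => if 0 ≤ j then fc (powInner p f k) (n + j) else 0
  -- The extension by zero agrees with the true coefficients down to index `-n`, which is as far as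
  -- the Toeplitz equation reaches.
  have hv : ∀ i : ℤ, -n ≤ i → ∀ k, v i k = fc (powInner p f k) (n + i) := by
    intro i hi k
    by_cases h0 : 0 ≤ i
    · simp [v, h0]
    · simp only [v, if_neg h0]
      exact (hu k _ (by omega) (by omega)).symm
  have := toeplitz_injective hε (fun z hz v => hpos z hz v k) (v := v)
    (fun j hj => by ext k; simp [v, not_le.2 hj]) (fun k => ?_) (fun j hj l => ?_) (j - n)
  · rw [hv _ (by omega)] at this
    rwa [add_sub_cancel] at this
  · have h1 : Filter.Tendsto (fun j : ℤ => fc (powInner p f k) (n + j)) Filter.atTop (nhds 0) :=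
      ((tendsto_fc (circleCont_powInner hp f k)).comp
        (add_right_injective (n : ℤ)).tendsto_cofinite).mono_left atTop_le_cofinite
    refine h1.congr' ?_
    filter_upwards [Filter.eventually_ge_atTop 0] with j hj
    exact (hv j (by omega) k).symm
  · have h1 := sum_symbol_eq hp hpm hγ hf' l (n + j)
    have h2 : fc (fun z => ((bi f).coeff (l + 1)).eval z) (n + j) = 0 := by
      obtain ⟨s, rfl⟩ := Int.eq_ofNat_of_zero_le hj
      rw [← Nat.cast_add, fc_eval_natCast]
      exact coeff_bi_eq_zero hf (Or.inl (by push_cast; omega))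
    have h3 : ∑ i ∈ Finset.range (n + 1),
        ((bi p).coeff (l + 1)).coeff i * fc (valQuot p f) (n + j - i) = 0 :=
      Finset.sum_eq_zero fun i hi => by
        rw [Finset.mem_range] at hi
        rw [hc _ (by omega), mul_zero]
    rw [h2, h3, sub_zero] at h1
    rw [← h1]
    refine Finset.sum_congr rfl fun k _ => Finset.sum_congr rfl fun i hi => ?_
    rw [Finset.mem_Icc] at hi
    rw [hv _ (by omega), add_sub_assoc]

/-- The mirror image on the negative half line, where polynomials in `z` have no coefficients. The
substitution `j ↦ -1 - j` reverses the sequence and replaces the symbol at `z` by the symbol at `1 /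
z`. -/
theorem fc_powInner_eq_zero_of_lt (hp : NoZerosOnFace p) (hpm : p ∈ polySpace n m) {f : Poly2}
    (hf : f ∈ polySpace n m) (hc : ∀ j < 0, fc (valQuot p f) j = 0)
    (hu : ∀ k : Fin m, ∀ j : ℤ, 0 ≤ j → j < n → fc (powInner p f k) j = 0) (k : Fin m) {j : ℤ}
    (hj : j < n) : fc (powInner p f k) j = 0 := by
  rcases le_or_gt 0 j with hj0 | hj0
  · exact hu k j hj0 hj
  obtain ⟨γ, ε, hε, hγ, hpos⟩ := exists_symbol hp hpm
  let v : ℤ → Fin m → ℂ := fun j k => if 0 ≤ j then fc (powInner p f k) (-1 - j) else 0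
  have hv : ∀ i : ℤ, -n ≤ i → ∀ k, v i k = fc (powInner p f k) (-1 - i) := by
    intro i hi k
    by_cases h0 : 0 ≤ i
    · simp [v, h0]
    · simp only [v, if_neg h0]
      exact (hu k _ (by omega) (by omega)).symm
  have hflip : ∀ F : ℤ → ℂ, ∑ i ∈ Finset.Icc (-n : ℤ) n, F (-i) =
      ∑ i ∈ Finset.Icc (-n : ℤ) n, F i := fun F =>
    Finset.sum_nbij' (fun i => -i) (fun i => -i) (by simp; omega) (by simp; omega) (by simp)
      (by simp) (by simp)
  have := toeplitz_injective (n := n) hε (γ := fun k l i => γ k l (-i)) (k₀ := k) (fun z hz v => ?_)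
    (v := v) (fun j hj => by ext k; simp [v, not_le.2 hj]) (fun k => ?_) (fun j hj l => ?_) (-1 - j)
  · rw [hv _ (by omega)] at this
    rwa [sub_sub_cancel] at this
  · have h1 := hpos z⁻¹ (by rw [norm_inv, hz, inv_one]) v k
    have h2 : ∀ k l, ∑ i ∈ Finset.Icc (-n : ℤ) n, γ k l (-i) * z ^ i =
        ∑ i ∈ Finset.Icc (-n : ℤ) n, γ k l i * z⁻¹ ^ i := fun k l => by
      rw [← hflip fun i => γ k l i * z⁻¹ ^ i]
      simp only [inv_zpow', neg_neg]
    simp only [h2]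
    exact h1
  · have h1 : Filter.Tendsto (fun j : ℤ => fc (powInner p f k) (-1 - j)) Filter.atTop (nhds 0) :=
      ((tendsto_fc (circleCont_powInner hp f k)).comp
        (sub_right_injective (b := (-1 : ℤ))).tendsto_cofinite).mono_left atTop_le_cofinite
    refine h1.congr' ?_
    filter_upwards [Filter.eventually_ge_atTop 0] with j hj
    exact (hv j (by omega) k).symm
  · have h1 := sum_symbol_eq hp hpm hγ hf l (-1 - j)
    have h3 : ∑ i ∈ Finset.range (n + 1),
        ((bi p).coeff (l + 1)).coeff i * fc (valQuot p f) (-1 - j - i) = 0 :=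
      Finset.sum_eq_zero fun i _ => by rw [hc _ (by omega), mul_zero]
    rw [fc_eval_of_neg _ (by omega), h3, sub_zero] at h1
    rw [← h1]
    refine Finset.sum_congr rfl fun k _ => ?_
    rw [← hflip]
    refine Finset.sum_congr rfl fun i hi => ?_
    rw [Finset.mem_Icc] at hi
    rw [hv _ (by omega), neg_neg]
    congr 2
    ring

/-- Orthogonality of functions with separated spectra. -/
theorem bs_eq_zero (hp : NoZerosOnFace p) (hpm : p ∈ polySpace n m) {f g : Poly2}
    (hg : g ∈ polySpace n m) (hcf : ∀ j, 0 ≤ j → fc (valQuot p f) j = 0)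
    (huf : ∀ k : Fin m, ∀ j, 0 ≤ j → fc (powInner p f k) j = 0)
    (hcg : ∀ j < 0, fc (valQuot p g) j = 0) (e : ℕ) : bs p f (MvPolynomial.X 0 ^ e * g) = 0 := by
  have hcont := circleCont_valQuot hp
  let H : Fin m → ℂ → ℂ := fun l z => ((bi g).coeff (l + 1)).eval z -
    ((bi p).coeff (l + 1)).eval z * valQuot p g z
  have hH : ∀ l, CircleCont (H l) := fun l =>
    (CircleCont.polynomial _).sub ((CircleCont.polynomial _).mul (hcont g))
  have hfcH : ∀ l, ∀ j < 0, fc (H l) j = 0 := by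
    intro l j hj
    have h1 : fc (H l) j = _ := fc_sub (CircleCont.polynomial _)
      ((CircleCont.polynomial _).mul (hcont g)) j
    rw [h1, fc_eval_of_neg _ hj, fc_eval_mul (natDegree_coeff_bi_le hpm _) (hcont g),
      Finset.sum_eq_zero, sub_zero]
    intro i _
    rw [hcg _ (by omega), mul_zero]
  -- The spectra of the factors containing `f` are negative, those of the factors containing `g` are
  -- nonnegative. Multiplying the latter by `z ^ e` only moves them further away.
  have h1 : bs p f (MvPolynomial.X 0 ^ e * g) = avg fun z =>
      valQuot p f z * conj (z ^ e * valQuot p g z) +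
        ∑ l : Fin m, powInner p f l z * conj (z ^ e * H l z) := by
    refine avg_congr fun z hz => ?_
    rw [slice_mul, slice_pow, slice_X0, ← Polynomial.C_pow, ← Polynomial.smul_eq_C_mul,
      ip_smul_right, ip_eq_sum (hp.slice_ne_zero hz) (natDegree_slice_le hpm z) _
        (natDegree_slice_le hg z)]
    simp only [coeff_slice, map_mul (starRingEnd ℂ) (z ^ e), mul_add, Finset.mul_sum]
    congr 1
    · rw [mul_left_comm]; rfl
    · refine Finset.sum_congr rfl fun l _ => ?_
      rw [mul_left_comm, mul_comm (_ / _) (Polynomial.eval z _)]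
      rfl
  rw [h1, avg_add ((hcont f).mul ((CircleCont.pow e).mul (hcont g)).conjugate)
    (CircleCont.sum fun (l : Fin m) _ => (circleCont_powInner hp f l).mul
      ((CircleCont.pow e).mul (hH l)).conjugate),
    avg_sum fun (l : Fin m) _ => (circleCont_powInner hp f l).mul ((CircleCont.pow e).mul (hH l)).conjugate,
    avg_mul_conj_eq_zero (hcont f) ((CircleCont.pow e).mul (hcont g)), zero_add]
  · refine Finset.sum_eq_zero fun l _ => avg_mul_conj_eq_zero (circleCont_powInner hp f l)
      ((CircleCont.pow e).mul (hH l)) fun j => ?_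
    rcases le_or_gt 0 j with hj | hj
    · exact Or.inl (huf l j hj)
    · exact Or.inr (by rw [fc_pow_mul]; exact hfcH l _ (by omega))
  · intro j
    rcases le_or_gt 0 j with hj | hj
    · exact Or.inl (hcf j hj)
    · exact Or.inr (by rw [fc_pow_mul]; exact hcg _ (by omega))

end

end BernsteinSzego

namespace BernsteinSzego

noncomputable section

open scoped Polynomial ComplexConjugate InnerProductSpace

namespace PositiveForm

variable {n m : ℕ} {τ : PositiveForm n m}

/-! ### The split of a Bernstein-Szegő polynomial -/

theorem X0_pow_mul_X1_pow_mem {k : ℤ} {s : ℕ} (hs : (s : ℤ) ≤ k) (hk : k ≤ n) (j : Fin m) :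
    ∃ g ∈ τ.wMul (τ.poly k (m - 1)),
      τ.incl g = MvPolynomial.X 0 ^ s * MvPolynomial.X 1 ^ (j + 1 : ℕ) := by
  have hmem : (MvPolynomial.X 0 ^ s * MvPolynomial.X 1 ^ (j : ℕ) : Poly2) ∈
      polySpace k (m - 1) := monomial_mem_polySpace hs (by omega)
  refine ⟨τ.ofPoly _ (monomial_mem_polySpace (s := s) (t := j + 1) (by omega) (by omega)),
    τ.mem_wMul.2 ⟨τ.ofPoly _ (polySpace_mono hk (by omega) hmem), hmem, ?_⟩, rfl⟩
  rw [incl_ofPoly, incl_ofPoly]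
  ring

section

variable {p : Poly2} (hp : NoZerosOnFace p)
  (hτ : ∀ f g : τ.H, ⟪g, f⟫_ℂ = bs p (τ.incl f) (τ.incl g))
include hτ

theorem fc_powInner_eq_zero {k : ℤ} (hk : k ≤ n) {f : τ.H} (hf : f ∈ τ.E1 k m) (l : Fin m) {j : ℤ}
    (hj : 0 ≤ j) (hjk : j ≤ k) : fc (powInner p (τ.incl f) l) j = 0 := by
  obtain ⟨s, rfl⟩ := Int.eq_ofNat_of_zero_le hj
  obtain ⟨g, hg, h⟩ := X0_pow_mul_X1_pow_mem (τ := τ) hjk hk l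
  rw [fc_powInner_natCast, ← h, ← hτ]
  exact hf.2 g hg

include hp

/-- The coefficients in the hypothesis are the inner products with the monomials that span `w
P_{n,m-1}`. -/
theorem mem_E1_of_fc_powInner {f : τ.H}
    (h : ∀ (l : Fin m) (j : ℤ), 0 ≤ j → j ≤ n → fc (powInner p (τ.incl f) l) j = 0) :
    f ∈ τ.E1 n m := by
  refine ⟨τ.mem_poly_self f, fun g hg => ?_⟩
  obtain ⟨g₀, hg₀, hgg⟩ := τ.mem_wMul.1 hg
  rw [hτ, hgg]
  have hg₀ : τ.incl g₀ ∈ polySpace n (m - 1) := hg₀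
  clear hgg
  generalize τ.incl g₀ = G at hg₀ ⊢
  induction hg₀ using Submodule.span_induction with
  | zero => rw [mul_zero, bs_zero_right]
  | add x y _ _ hx hy => rw [mul_add, bs_add_right hp, hx, hy, add_zero]
  | smul c x _ hx => rw [mul_smul_comm, bs_smul_right, hx, mul_zero]
  | mem x hx =>
    obtain ⟨s, t, hs, ht, rfl⟩ := hx
    have h1 := h ⟨t, by omega⟩ s (by omega) hs
    rw [fc_powInner_natCast] at h1
    rw [← h1]
    congr 1
    ring

end

/-- The elements of `E1 (n - 1) m` whose value at `w = 0` is a multiple of `r`. -/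
def dvdSpace (τ : PositiveForm n m) (r : ℂ[X]) (N : ℕ) : Submodule ℂ τ.H :=
  τ.E1 (n - 1) m ⊓ ((Polynomial.degreeLT ℂ N).map (LinearMap.mulLeft ℂ r)).comap τ.valW

theorem exists_of_mem_dvdSpace {r : ℂ[X]} {N : ℕ} {f : τ.H} (hf : f ∈ dvdSpace τ r N) :
    ∃ g : ℂ[X], g.degree < N ∧ atWZero (τ.incl f) = r * g := by
  obtain ⟨-, g, hg, h⟩ := hf
  exact ⟨g, Polynomial.mem_degreeLT.1 hg, h.symm⟩

/-- The values at `w = 0` of `E1 (n - 1) m` exhaust the polynomials of degree less than `n`, so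
every product `r g` allowed by the degree bound occurs, exactly once. -/
theorem finrank_dvdSpace {r : ℂ[X]} (hr : r ≠ 0) {N : ℕ} (hN : r.natDegree + N ≤ n) :
    Module.finrank ℂ (dvdSpace τ r N) = N := by
  have hinj : Function.Injective (τ.valW ∘ₗ (dvdSpace τ r N).subtype) := by
    rw [← LinearMap.ker_eq_bot, LinearMap.ker_eq_bot']
    exact fun f hf => Subtype.ext (E1_eq_zero (by omega) le_rfl f.2.1 hf)
  have hrange : LinearMap.range (τ.valW ∘ₗ (dvdSpace τ r N).subtype) =
      (Polynomial.degreeLT ℂ N).map (LinearMap.mulLeft ℂ r) := by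
    apply le_antisymm
    · rintro _ ⟨f, rfl⟩
      exact f.2.2
    · rintro _ ⟨g, hg, rfl⟩
      have hmem : r * g ∈ Polynomial.degreeLT ℂ n := by
        rcases eq_or_ne g 0 with rfl | hg0
        · rw [mul_zero]; exact Submodule.zero_mem _
        · rw [SetLike.mem_coe, Polynomial.mem_degreeLT,
            ← Polynomial.natDegree_lt_iff_degree_lt hg0] at hg
          rw [Polynomial.mem_degreeLT,
            ← Polynomial.natDegree_lt_iff_degree_lt (mul_ne_zero hr hg0),
            Polynomial.natDegree_mul hr hg0]
          omega
      obtain ⟨f, hf, h⟩ := exists_mem_E1 (τ := τ) (k := n - 1) (by ring) (by omega) hmem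
      refine ⟨⟨f, hf, ?_⟩, h⟩
      rw [SetLike.mem_coe, Submodule.mem_comap, h]
      exact ⟨g, hg, rfl⟩
  rw [← LinearMap.finrank_range_of_inj hinj, hrange]
  refine (LinearEquiv.finrank_eq (Submodule.equivMapOfInjective _
    (fun _ _ h => mul_left_cancel₀ hr h) _)).symm.trans (finrank_degreeLT N)

/-- A Bernstein-Szegő polynomial yields a split. -/
theorem exists_isShiftSplit {p : Poly2} (hp : NoZerosOnFace p) (hpm : p ∈ polySpace n m)
    (hτ : τ.HasBernsteinSzegoMoments p) : ∃ K₁ K₂ : Submodule ℂ τ.H,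
      τ.IsShiftSplit K₁ K₂ ∧ Module.finrank ℂ K₁ = zerosInDisk (atWZero p) := by
  have hτ := (τ.hasBernsteinSzegoMoments_iff hp).1 hτ
  set q := atWZero p with hq
  set d := zerosInDisk q with hd
  have hcirc : ∀ z, ‖z‖ = 1 → q.eval z ≠ 0 := fun z hz => by
    rw [hq, atWZero_eval]; exact hp z 0 hz (by simp)
  have hq0 : q ≠ 0 := by rintro h0; exact hcirc 1 (by simp) (by simp [h0])
  have hdeg : q.natDegree ≤ n := by
    rw [hq, atWZero_eq_coeff]; exact natDegree_coeff_bi_le hpm 0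
  have hsum := natDegree_outerPart_add hq0
  have hinner := natDegree_innerPart q
  have hfac := innerPart_mul_outerPart q
  set K₁ := dvdSpace τ (outerPart q) d with hK₁
  set K₂ := dvdSpace τ (innerPart q) (n - d) with hK₂
  have hdim₁ : Module.finrank ℂ K₁ = d := finrank_dvdSpace (outerPart_ne_zero hq0) (by omega)
  have hdim₂ : Module.finrank ℂ K₂ = n - d :=
    finrank_dvdSpace (innerPart_monic q).ne_zero (by omega)
  have hpoly : ∀ {f : τ.H}, f ∈ τ.E1 (n - 1) m → τ.incl f ∈ polySpace (n - 1) m := fun hf => hf.1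
  have hu : ∀ f ∈ τ.E1 (n - 1) m, ∀ k : Fin m, ∀ j : ℤ, 0 ≤ j → j < n →
      fc (powInner p (τ.incl f) k) j = 0 := fun f hf k j h0 h1 =>
    fc_powInner_eq_zero hτ (by omega) hf k h0 (by omega)
  -- The outer part cancels, leaving a strictly proper fraction with poles only in the disk.
  have hc₁ : ∀ f ∈ K₁, ∀ j, 0 ≤ j → fc (valQuot p (τ.incl f)) j = 0 := by
    intro f hf j hj
    obtain ⟨g, hg, hfg⟩ := exists_of_mem_dvdSpace hf
    have h1 : g.degree < (innerPart q).degree := by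
      rwa [Polynomial.degree_eq_natDegree (innerPart_monic q).ne_zero, hinner]
    rw [← fc_div_of_nonneg (fun w hw => innerPart_eval_ne_zero hw) h1 hj]
    refine fc_congr (fun z hz => ?_) j
    have hqz : q.eval z = (innerPart q).eval z * (outerPart q).eval z := by
      rw [← Polynomial.eval_mul, hfac]
    rw [valQuot_eq, hfg, ← hq, hqz, Polynomial.eval_mul, mul_comm (Polynomial.eval z (innerPart q))]
    exact mul_div_mul_left _ _ (outerPart_eval_ne_zero hcirc hz.le)
  -- The inner part cancels, leaving a fraction holomorphic on the closed disk.
  have hc₂ : ∀ f ∈ K₂, ∀ j < 0, fc (valQuot p (τ.incl f)) j = 0 := by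
    intro f hf j hj
    obtain ⟨g, -, hfg⟩ := exists_of_mem_dvdSpace hf
    rw [← fc_div_of_neg (fun w hw => outerPart_eval_ne_zero hcirc hw) g hj]
    refine fc_congr (fun z hz => ?_) j
    have hqz : q.eval z = (innerPart q).eval z * (outerPart q).eval z := by
      rw [← Polynomial.eval_mul, hfac]
    rw [valQuot_eq, hfg, ← hq, hqz, Polynomial.eval_mul]
    exact mul_div_mul_left _ _ (innerPart_eval_ne_zero hz.ge)
  have hu₁ : ∀ f ∈ K₁, ∀ k : Fin m, ∀ j, 0 ≤ j → fc (powInner p (τ.incl f) k) j = 0 :=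
    fun f hf k j hj => fc_powInner_eq_zero_of_nonneg hp hpm (hpoly hf.1) (hc₁ f hf)
      (hu f hf.1) k hj
  have hu₂ : ∀ f ∈ K₂, ∀ k : Fin m, ∀ j : ℤ, j < n → fc (powInner p (τ.incl f) k) j = 0 :=
    fun f hf k j hj => fc_powInner_eq_zero_of_lt hp hpm (τ.incl_mem f) (hc₂ f hf)
      (hu f hf.1) k hj
  have hortho : K₁ ⟂ K₂ := by
    rw [Submodule.isOrtho_comm, Submodule.isOrtho_iff_inner_eq]
    intro g hg f hf
    have := bs_eq_zero hp hpm (τ.incl_mem g) (hc₁ f hf) (hu₁ f hf) (hc₂ g hg) 0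
    rwa [pow_zero, one_mul, ← hτ] at this
  refine ⟨K₁, K₂, ⟨⟨hortho, ?_⟩, ?_, ?_, ?_⟩, hdim₁⟩
  · refine Submodule.eq_of_le_of_finrank_eq (sup_le inf_le_left inf_le_left) ?_
    rw [finrank_sup_of_isOrtho hortho, hdim₁, hdim₂, finrank_E1 (N := n) (by ring) (by omega)]
    omega
  · rw [Submodule.isOrtho_comm, Submodule.isOrtho_iff_inner_eq]
    intro g hg f hf
    obtain ⟨g₀, hg₀, hgg⟩ := τ.mem_zMul.1 hg
    have := bs_eq_zero hp hpm (τ.incl_mem g₀) (hc₁ f hf) (hu₁ f hf) (hc₂ g₀ hg₀) 1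
    rwa [pow_one, ← hgg, ← hτ] at this
  · exact fun f hf => mem_E1_of_fc_powInner hp hτ fun l j hj _ => hu₁ f hf l j hj
  · intro g hg
    obtain ⟨g₀, hg₀, hgg⟩ := τ.mem_zMul.1 hg
    -- Multiplication by `z` shifts the window `0 ≤ j ≤ n` to `-1 ≤ j ≤ n - 1`, and `hu₂` covers it
    -- including the index `-1`.
    refine mem_E1_of_fc_powInner hp hτ fun l j _ hj => ?_
    rw [hgg, fc_powInner_X0_mul]
    exact hu₂ g₀ hg₀ l _ (by omega)

end PositiveForm

end

end BernsteinSzego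

theorem mainTheorem5 (n m d : ℕ) (hd : d ≤ n) (τ : BernsteinSzego.PositiveForm n m) :
    List.TFAE [
      ∃ p : MvPolynomial (Fin 2) ℂ,
        BernsteinSzego.NoZerosOnFace p ∧
        MvPolynomial.degreeOf 0 p ≤ n ∧ MvPolynomial.degreeOf 1 p ≤ m ∧
        BernsteinSzego.zerosInDisk (BernsteinSzego.atWZero p) = d ∧
        τ.HasBernsteinSzegoMoments p,
      ∃ K₁ K₂ : Submodule ℂ τ.H,
        τ.IsShiftSplit K₁ K₂ ∧ Module.finrank ℂ K₁ = d,
      τ.MatrixCondition ∧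
        Module.finrank ℂ τ.spaceA ≤ d ∧
        (d : ℤ) ≤ (n : ℤ) - (Module.finrank ℂ τ.spaceB : ℤ)] := by
  tfae_have 1 → 2 := by
    rintro ⟨p, hp, h0, h1, rfl, hτ⟩
    exact BernsteinSzego.PositiveForm.exists_isShiftSplit hp
      (BernsteinSzego.mem_polySpace_of_degreeOf h0 h1) hτ
  tfae_have 2 → 1 := by
    rintro ⟨K₁, K₂, h, rfl⟩
    exact h.exists_bernsteinSzego
  tfae_have 2 ↔ 3 := BernsteinSzego.PositiveForm.shiftSplit_iff_matrixCondition τ hd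
  tfae_finish
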